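/- **Theorem 3.4.** Let $1<p<\infty$, let $I=(a,b)$ with $a<b$ real, and put $|I|=b-a$; functions and Banach spaces are real. Let $\mathring W^2_p(I)$ be the closure of $C_0^\infty(I)$ in the Sobolev space $W^2_p(I)$, normed by $\|u''\|_{p,I}$, and let $E:\mathring W^2_p(I)\to L_p(I)$ be the embedding. Put $$\mathcal B(0,1)=\sup\Big\{\frac{\|u-Ku\|_{p,(0,1)}}{\|u''\|_{p,(0,1)}}: u\in W^2_p(0,1),\ u''\neq 0\Big\},\qquad Ku(x)=u(0)+(u(1)-u(0))x,$$ where $u$ stands for its continuous representative on $[0,1]$, and $$J^0(0,1)=\sup\Big\{\frac{\|u\|_{p,(0,1)}}{\|u''\|_{p,(0,1)}}: u\in W^2_p(0,1)\cap \mathring W^1_p(0,1),\ u''\neq 0\Big\}.$$ Then $\mathcal B(0,1)=J^0(0,1)=\lambda_1^{-1/p}$, where $\lambda_1>0$ is the least eigenvalue of the one-dimensional $p$-biharmonic problem with Navier boundary conditions $$(|u''|^{p-2}u'')''=\lambda|u|^{p-2}u \ \text{ in } (0,1),\qquad u=u''=0 \ \text{ at } 0 \text{ and } 1,$$ understood weakly: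 $u\in W^2_p(0,1)\cap\mathring W^1_p(0,1)$, $u\ne0$, and $\int_0^1|u''|^{p-2}u''v''=\lambda\int_0^1|u|^{p-2}uv$ for all $v\in W^2_p(0,1)\cap\mathring W^1_p(0,1)$. Let $a_n(E)=\inf\{\|E-F\|:\operatorname{rank}F<n\}$ be the approximation numbers of $E$. Then $$\Big(\frac{|I|}{n+1}\Big)^2\mathcal B(0,1)\le a_n(E)\quad(n\ge1),\qquad a_n(E)\le\Big(\frac{|I|}{n-1}\Big)^2\mathcal B(0,1)\quad(n\ge2),$$ and $\lim_{n\to\infty}n^2a_n(E)=|I|^2\mathcal B(0,1)$. The same bounds and limit hold with $a_n$ replaced by any injective strict $s$-number; in particular, they hold for the Bernstein numbers $b_n(E)=\sup_{\dim X_n=n}\inf_{0\ne x\in X_n}\|Ex\|/\|x\|$ and the Gelfand numbers $c_n(E)=\inf\{\|E|_M\|: M \text{ a closed subspace of codimension}<n\}$. Here a strict $s$-number is a rule that assigns to every bounded linear map $T$ between Banach spaces numbers $s_n(T)$, $n\ge1$, such that $\|T\|=s_1(T)\ge s_2(T)\ge\dots\ge0$; $s_n(S+T)\le s_n(S)+\|T\|$;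 $s_n(BTA)\le\|B\|\,s_n(T)\,\|A\|$; $s_n(T)=0$ if $\operatorname{rank}T<n$; and $s_n(\mathrm{Id}_X)=1$ for every Banach space $X$ with $\dim X\ge n$. It is injective if $s_n(JT)=s_n(T)$ for every linear isometric embedding $J$ of the target space of $T$ into another Banach space. -/

import Mathlib

open MeasureTheory Set Filter Topology
open scoped ENNReal NNReal ContDiff

noncomputable section

namespace SobolevEmbedding

/-! ### Sobolev spaces on an interval -/

/-- Lebesgue measure on the open interval `(a, b)`. -/
abbrev mu (a b : ℝ) : Measure ℝ := volume.restrict (Ioo a b)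

/-- The (real) Lebesgue space of order `p` on `(a, b)`. -/
abbrev LpI (p : ℝ≥0∞) (a b : ℝ) := Lp ℝ p (mu a b)

/-- `φ` is a smooth function with compact support contained in `(a, b)`. -/
def IsTestFunction (a b : ℝ) (φ : ℝ → ℝ) : Prop :=
  ContDiff ℝ ∞ φ ∧ HasCompactSupport φ ∧ tsupport φ ⊆ Ioo a b

/-- `v` is the `j`-th distributional derivative of `u` on `(a, b)`. -/
def HasWeakDeriv (a b : ℝ) (j : ℕ) (u v : ℝ → ℝ) : Prop :=
  ∀ φ : ℝ → ℝ, IsTestFunction a b φ →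
    ∫ x in Ioo a b, u x * iteratedDeriv j φ x = (-1) ^ j * ∫ x in Ioo a b, v x * φ x

lemma IsTestFunction.hasCompactSupport_iteratedDeriv {a b : ℝ} {φ : ℝ → ℝ}
    (h : IsTestFunction a b φ) (j : ℕ) :
    HasCompactSupport (iteratedDeriv j φ) ∧ tsupport (iteratedDeriv j φ) ⊆ Ioo a b := by
  induction j with
  | zero => simpa using h.2
  | succ j ih =>
    rw [iteratedDeriv_succ]
    exact ⟨ih.1.deriv, tsupport_deriv_subset.trans ih.2⟩

lemma IsTestFunction.continuous_iteratedDeriv {a b : ℝ} {φ : ℝ → ℝ}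
    (h : IsTestFunction a b φ) (j : ℕ) : Continuous (iteratedDeriv j φ) :=
  h.1.continuous_iteratedDeriv j (by exact_mod_cast le_top)

/-- Pairing with a continuous compactly supported function is a bounded functional. -/
lemma exists_pairing (p : ℝ≥0∞) [hp : Fact (1 ≤ p)] (a b : ℝ) {g : ℝ → ℝ} (hg : Continuous g)
    (hc : HasCompactSupport g) :
    ∃ L : LpI p a b →L[ℝ] ℝ, ∀ u, L u = ∫ x in Ioo a b, u x * g x := by
  have h1 : Fact (1 ≤ (1 - p⁻¹)⁻¹) := by simp [fact_iff]
  have hpq : ENNReal.HolderConjugate p (1 - p⁻¹)⁻¹ :=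
    ENNReal.HolderConjugate.inv_one_sub_inv' hp.out
  have hm : MemLp g (1 - p⁻¹)⁻¹ (mu a b) := hg.memLp_of_hasCompactSupport hc
  refine ⟨((ContinuousLinearMap.mul ℝ ℝ).lpPairing (mu a b) p (1 - p⁻¹)⁻¹).flip (hm.toLp g),
    fun u => ?_⟩
  rw [ContinuousLinearMap.flip_apply, ContinuousLinearMap.lpPairing_eq_integral]
  apply integral_congr_ae
  filter_upwards [hm.coeFn_toLp] with x hx
  simp [hx]

/-- The set of tuples `(u, u', …, u^(k))` of functions in `L_p(a, b)`, the `j`-th of which is the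
`j`-th distributional derivative of the first, is closed in the product space and a subspace. -/
lemma weakDeriv_aux (p : ℝ≥0∞) [Fact (1 ≤ p)] (a b : ℝ) (k : ℕ) :
    ∃ S : Submodule ℝ (Fin (k + 1) → LpI p a b),
      IsClosed (S : Set (Fin (k + 1) → LpI p a b)) ∧
      ∀ x, x ∈ S ↔ ∀ j : Fin (k + 1), HasWeakDeriv a b (j : ℕ) (x 0) (x j) := by
  have key : ∀ (j : Fin (k + 1)) (φ : {φ : ℝ → ℝ // IsTestFunction a b φ}),
      ∃ L : (Fin (k + 1) → LpI p a b) →L[ℝ] ℝ, ∀ x, L x =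
        (∫ y in Ioo a b, x 0 y * iteratedDeriv j φ.1 y) -
          (-1) ^ (j : ℕ) * ∫ y in Ioo a b, x j y * φ.1 y := by
    rintro j ⟨φ, hφ⟩
    obtain ⟨L₁, h₁⟩ := exists_pairing p a b (hφ.continuous_iteratedDeriv j)
      (hφ.hasCompactSupport_iteratedDeriv j).1
    obtain ⟨L₂, h₂⟩ := exists_pairing p a b hφ.1.continuous hφ.2.1
    exact ⟨L₁ ∘L ContinuousLinearMap.proj 0 -
      ((-1) ^ (j : ℕ) : ℝ) • (L₂ ∘L ContinuousLinearMap.proj j), fun x => by simp [h₁, h₂]⟩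
  choose L hL using key
  refine ⟨⨅ j, ⨅ φ, LinearMap.ker (L j φ : (Fin (k + 1) → LpI p a b) →ₗ[ℝ] ℝ), ?_, fun x => ?_⟩
  · simp only [Submodule.coe_iInf]
    exact isClosed_iInter fun j => isClosed_iInter fun φ =>
      isClosed_singleton.preimage (L j φ).continuous
  · simp only [Submodule.mem_iInf, LinearMap.mem_ker, ContinuousLinearMap.coe_coe, hL, sub_eq_zero,
      HasWeakDeriv, Subtype.forall]

/-- The Sobolev space `W^k_p(a, b)`. An element `u` is stored together with its distributional
derivatives, as the tuple `(u, u', …, u^(k))` of elements of `L_p(a, b)`; it carries the norm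
`max_j ‖u^(j)‖_p`, which is equivalent to the usual one. -/
def Sobolev (p : ℝ≥0∞) [Fact (1 ≤ p)] (a b : ℝ) (k : ℕ) :
    Submodule ℝ (Fin (k + 1) → LpI p a b) where
  carrier := {x | ∀ j : Fin (k + 1), HasWeakDeriv a b (j : ℕ) (x 0) (x j)}
  add_mem' := by
    obtain ⟨S, -, h⟩ := weakDeriv_aux p a b k
    intro x y hx hy
    exact (h _).1 (S.add_mem ((h _).2 hx) ((h _).2 hy))
  zero_mem' := by
    obtain ⟨S, -, h⟩ := weakDeriv_aux p a b k
    exact (h _).1 S.zero_mem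
  smul_mem' := by
    obtain ⟨S, -, h⟩ := weakDeriv_aux p a b k
    intro c x hx
    exact (h _).1 (S.smul_mem c ((h _).2 hx))

variable (p : ℝ≥0∞) [Fact (1 ≤ p)] (a b : ℝ) (k : ℕ)

lemma isClosed_sobolev : IsClosed (Sobolev p a b k : Set (Fin (k + 1) → LpI p a b)) := by
  obtain ⟨S, hS, h⟩ := weakDeriv_aux p a b k
  convert hS using 1
  ext x
  exact (h x).symm

instance : CompleteSpace (Sobolev p a b k) :=
  (isClosed_sobolev p a b k).completeSpace_coe

/-- The test functions, as a subspace of `W^k_p(a, b)`. -/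
def testFunctions : Submodule ℝ (Sobolev p a b k) where
  carrier := {x | ∃ φ, IsTestFunction a b φ ∧ ∀ j, x.1 j =ᵐ[mu a b] iteratedDeriv (j : ℕ) φ}
  add_mem' := by
    rintro x y ⟨φ, hφ, hx⟩ ⟨ψ, hψ, hy⟩
    refine ⟨φ + ψ, ⟨hφ.1.add hψ.1, hφ.2.1.add hψ.2.1,
      (tsupport_add φ ψ).trans (union_subset hφ.2.2 hψ.2.2)⟩, fun j => ?_⟩
    have h : iteratedDeriv (j : ℕ) (φ + ψ) = iteratedDeriv j φ + iteratedDeriv j ψ := by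
      ext t
      exact iteratedDeriv_add (hφ.1.contDiffAt.of_le (by exact_mod_cast le_top))
        (hψ.1.contDiffAt.of_le (by exact_mod_cast le_top))
    rw [h]
    exact (Lp.coeFn_add (x.1 j) (y.1 j)).trans ((hx j).add (hy j))
  zero_mem' := by
    refine ⟨0, ⟨contDiff_const, HasCompactSupport.zero, by simp⟩, fun j => ?_⟩
    have h : iteratedDeriv (j : ℕ) (0 : ℝ → ℝ) = 0 := by
      ext t
      simp [Pi.zero_def]
    rw [h]
    exact Lp.coeFn_zero ℝ p (mu a b)
  smul_mem' := by
    rintro c x ⟨φ, hφ, hx⟩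
    refine ⟨c • φ, ⟨contDiff_const.smul hφ.1, hφ.2.1.smul_left,
      (closure_mono (Function.support_const_smul_subset c φ)).trans hφ.2.2⟩, fun j => ?_⟩
    have h : iteratedDeriv (j : ℕ) (c • φ) = c • iteratedDeriv j φ := by
      ext t
      exact iteratedDeriv_const_smul_field c φ
    rw [h]
    exact (Lp.coeFn_smul c (x.1 j)).trans ((hx j).const_smul c)

/-- The zero-boundary Sobolev space: the closure of the test functions in `W^k_p(a, b)`. It is a
type of its own because it is normed by `‖u^(k)‖_p` and not as a subspace of `W^k_p(a, b)`. -/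
def Sobolev₀ : Type := (testFunctions p a b k).topologicalClosure

namespace Sobolev₀

instance : AddCommGroup (Sobolev₀ p a b k) :=
  inferInstanceAs (AddCommGroup (testFunctions p a b k).topologicalClosure)

instance : Module ℝ (Sobolev₀ p a b k) :=
  inferInstanceAs (Module ℝ (testFunctions p a b k).topologicalClosure)

/-- The inclusion of the zero-boundary space in `W^k_p(a, b)`. -/
def incl : Sobolev₀ p a b k →ₗ[ℝ] Sobolev p a b k :=
  (testFunctions p a b k).topologicalClosure.subtype

/-- The map sending `u` to its `j`-th distributional derivative. -/
def derivₗ (j : Fin (k + 1)) : Sobolev₀ p a b k →ₗ[ℝ] LpI p a b :=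
  LinearMap.proj j ∘ₗ (Sobolev p a b k).subtype ∘ₗ incl p a b k

end Sobolev₀

/-- Poincaré's inequality for a smooth function supported in `(a, b)`. -/
lemma poincare_aux : ∃ C : ℝ≥0∞, C ≠ ⊤ ∧ ∀ g : ℝ → ℝ, ContDiff ℝ 1 g → HasCompactSupport g →
    tsupport g ⊆ Ioo a b → eLpNorm g p (mu a b) ≤ C * eLpNorm (deriv g) p (mu a b) := by
  have hp1 : 1 ≤ p := Fact.out
  have hinv : p.toReal⁻¹ ≤ 1 := by
    rcases eq_or_ne p ⊤ with rfl | hp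
    · simp
    · have h : 1 ≤ p.toReal := by
        rw [← ENNReal.toReal_one]
        exact ENNReal.toReal_mono hp hp1
      exact inv_le_one_of_one_le₀ h
  refine ⟨mu a b univ ^ (1 - p.toReal⁻¹) * mu a b univ ^ p.toReal⁻¹,
    ENNReal.mul_ne_top (ENNReal.rpow_ne_top_of_nonneg (by linarith) (measure_ne_top _ _))
      (ENNReal.rpow_ne_top_of_nonneg (by positivity) (measure_ne_top _ _)), ?_⟩
  intro g hg hc hs
  have hcd : Continuous (deriv g) := hg.continuous_deriv le_rfl
  have h1 : ∀ x, ‖g x‖ₑ ≤ eLpNorm (deriv g) 1 (mu a b) := by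
    intro x
    rw [← HasCompactSupport.integral_Iic_deriv_eq hg hc x, eLpNorm_one_eq_lintegral_enorm]
    refine (enorm_integral_le_lintegral_enorm _).trans
      ((setLIntegral_le_lintegral _ _).trans_eq ?_)
    rw [setLIntegral_eq_of_support_subset]
    intro t ht
    exact hs (tsupport_deriv_subset (subset_tsupport _ (by simpa using ht)))
  have h2 := eLpNorm_le_eLpNorm_mul_rpow_measure_univ (μ := mu a b) hp1
    hcd.aestronglyMeasurable
  simp only [ENNReal.toReal_one, div_one, one_div] at h2
  calc eLpNorm g p (mu a b)
      ≤ eLpNorm (deriv g) 1 (mu a b) • mu a b univ ^ p.toReal⁻¹ :=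
        eLpNorm_le_of_ae_enorm_bound (ae_of_all _ h1)
    _ ≤ (eLpNorm (deriv g) p (mu a b) * mu a b univ ^ (1 - p.toReal⁻¹)) •
          mu a b univ ^ p.toReal⁻¹ := by gcongr
    _ = _ := by
      simp only [smul_eq_mul]
      ring

namespace Sobolev₀

/-- Poincaré's inequality: all derivatives are controlled by the one of highest order. -/
lemma exists_bound : ∃ C : ℝ≥0, ∀ (u : Sobolev₀ p a b k) (j : Fin (k + 1)),
    ‖derivₗ p a b k j u‖ ≤ C * ‖derivₗ p a b k (Fin.last k) u‖ := by
  obtain ⟨C, hC, h⟩ := poincare_aux p a b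
  have hstep : ∀ φ, IsTestFunction a b φ → ∀ i j : ℕ,
      eLpNorm (iteratedDeriv j φ) p (mu a b) ≤
        C ^ i * eLpNorm (iteratedDeriv (j + i) φ) p (mu a b) := by
    intro φ hφ i
    induction i with
    | zero => simp
    | succ i ih =>
      intro j
      have hs := hφ.hasCompactSupport_iteratedDeriv (j + i)
      have hd : ContDiff ℝ 1 (iteratedDeriv (j + i) φ) := by
        refine contDiff_one_iff_deriv.2 ⟨?_, ?_⟩
        · exact hφ.1.differentiable_iteratedDeriv _ (by exact_mod_cast ENat.natCast_lt_top _)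
        · rw [← iteratedDeriv_succ]
          exact hφ.continuous_iteratedDeriv _
      calc _ ≤ _ := ih j
        _ ≤ C ^ i * (C * eLpNorm (deriv (iteratedDeriv (j + i) φ)) p (mu a b)) := by
          gcongr
          exact h _ hd hs.1 hs.2
        _ = _ := by
          rw [← iteratedDeriv_succ, pow_succ, mul_assoc, add_assoc]
  refine ⟨(max 1 C.toNNReal) ^ k, fun u j => ?_⟩
  have hclosed : IsClosed {x : Sobolev p a b k |
      ‖x.1 j‖ ≤ ((max 1 C.toNNReal) ^ k : ℝ≥0) * ‖x.1 (Fin.last k)‖} := by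
    refine isClosed_le ?_ ?_
    · exact ((continuous_apply j).comp continuous_subtype_val).norm
    · exact continuous_const.mul ((continuous_apply _).comp continuous_subtype_val).norm
  refine closure_minimal (s := (testFunctions p a b k : Set (Sobolev p a b k))) ?_ hclosed u.2
  rintro x ⟨φ, hφ, hx⟩
  have hj : (j : ℕ) + (k - j) = k := by omega
  have h1 := hstep φ hφ (k - j) j
  rw [hj] at h1
  have e1 : eLpNorm (iteratedDeriv (j : ℕ) φ) p (mu a b) = eLpNorm (x.1 j) p (mu a b) :=
    (eLpNorm_congr_ae (hx j)).symm
  have e2 : eLpNorm (iteratedDeriv k φ) p (mu a b) = eLpNorm (x.1 (Fin.last k)) p (mu a b) :=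
    (eLpNorm_congr_ae (hx (Fin.last k))).symm
  rw [e1, e2] at h1
  have h2 : ‖x.1 j‖ ≤ C.toReal ^ (k - j : ℕ) * ‖x.1 (Fin.last k)‖ := by
    rw [Lp.norm_def, Lp.norm_def, ← ENNReal.toReal_pow, ← ENNReal.toReal_mul]
    exact ENNReal.toReal_mono
      (ENNReal.mul_ne_top (ENNReal.pow_ne_top hC) (Lp.eLpNorm_ne_top _)) h1
  refine h2.trans ?_
  gcongr
  have h3 : C.toReal ≤ ((max 1 C.toNNReal : ℝ≥0) : ℝ) := by
    exact_mod_cast le_max_right 1 C.toNNReal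
  have h4 : (1 : ℝ) ≤ ((max 1 C.toNNReal : ℝ≥0) : ℝ) := by
    exact_mod_cast le_max_left 1 C.toNNReal
  push_cast at h3 h4 ⊢
  exact (pow_le_pow_left₀ (by positivity) h3 _).trans (pow_le_pow_right₀ h4 (by omega))

lemma derivₗ_last_injective : Function.Injective (derivₗ p a b k (Fin.last k)) := by
  obtain ⟨C, hC⟩ := exists_bound p a b k
  refine (injective_iff_map_eq_zero _).2 fun u hu => ?_
  have h : ∀ j, derivₗ p a b k j u = 0 := fun j => by
    have := hC u j
    rw [hu, norm_zero, mul_zero] at this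
    exact norm_le_zero_iff.1 this
  exact Subtype.ext (Subtype.ext (funext h))

lemma isComplete_range_derivₗ_last : IsComplete (range (derivₗ p a b k (Fin.last k))) := by
  obtain ⟨C, hC⟩ := exists_bound p a b k
  have hV : CompleteSpace (testFunctions p a b k).topologicalClosure :=
    (testFunctions p a b k).isClosed_topologicalClosure.completeSpace_coe
  have hD : AntilipschitzWith C
      fun u : (testFunctions p a b k).topologicalClosure => u.1.1 (Fin.last k) := by
    refine AntilipschitzWith.of_le_mul_dist fun u v => ?_
    rw [Subtype.dist_eq, Subtype.dist_eq, dist_eq_norm, dist_eq_norm]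
    exact (pi_norm_le_iff_of_nonneg (by positivity)).2 fun j => hC (u - v) j
  have hc : UniformContinuous
      fun u : (testFunctions p a b k).topologicalClosure => u.1.1 (Fin.last k) :=
    (Pi.uniformContinuous_proj _ (Fin.last k)).comp
      (uniformContinuous_subtype_val.comp uniformContinuous_subtype_val)
  exact hD.isComplete_range hc

/-- The norm of the zero-boundary space is `‖u‖ = ‖u^(k)‖_p`. -/
instance : NormedAddCommGroup (Sobolev₀ p a b k) :=
  NormedAddCommGroup.induced _ _ (derivₗ p a b k (Fin.last k)) (derivₗ_last_injective p a b k)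

instance : NormedSpace ℝ (Sobolev₀ p a b k) :=
  NormedSpace.induced ℝ _ _ (derivₗ p a b k (Fin.last k))

lemma norm_eq (u : Sobolev₀ p a b k) : ‖u‖ = ‖derivₗ p a b k (Fin.last k) u‖ := rfl

lemma isometry_derivₗ_last : Isometry (derivₗ p a b k (Fin.last k)) :=
  AddMonoidHomClass.isometry_of_norm _ fun _ => rfl

instance : CompleteSpace (Sobolev₀ p a b k) :=
  (completeSpace_iff_isComplete_range (isometry_derivₗ_last p a b k).isUniformInducing).2
    (isComplete_range_derivₗ_last p a b k)

/-- The embedding of the zero-boundary Sobolev space of order `k` into `L_p(a, b)`. -/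
def embedding : Sobolev₀ p a b k →L[ℝ] LpI p a b :=
  LinearMap.mkContinuousOfExistsBound (derivₗ p a b k 0)
    ((exists_bound p a b k).elim fun C hC => ⟨C, fun u => hC u 0⟩)

end Sobolev₀

/-! ### The constants -/

/-- The affine function that agrees with `f` at `a` and `b`. -/
def affineInterp (f : ℝ → ℝ) (x : ℝ) : ℝ := f a + (f b - f a) / (b - a) * (x - a)

/-- `𝓑(a, b)`: the supremum of `‖u - Ku‖_p / ‖u''‖_p` over `u ∈ W²_p(a, b)` with `u'' ≠ 0`, where
`Ku` is the affine interpolant of `u` at the endpoints. The end values are those of the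
representative `f` of `u` that is continuous on `[a, b]`. -/
def constB : ℝ :=
  sSup {r | ∃ u : Sobolev p a b 2, u.1 2 ≠ 0 ∧ ∃ f : ℝ → ℝ, ContinuousOn f (Icc a b) ∧
    u.1 0 =ᵐ[mu a b] f ∧
    r = (eLpNorm (fun x => f x - affineInterp a b f x) p (mu a b)).toReal / ‖u.1 2‖}

/-- The functions in `W²_p(a, b)` that lie in the zero-boundary space of order one. -/
def navierSpace : Set (Sobolev p a b 2) :=
  {u | ∃ w : Sobolev₀ p a b 1, Sobolev₀.embedding p a b 1 w = u.1 0}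

/-- `J⁰(a, b)`: the supremum of `‖u‖_p / ‖u''‖_p` over those functions with `u'' ≠ 0`. -/
def constJ₀ : ℝ :=
  sSup {r | ∃ u ∈ navierSpace p a b, u.1 2 ≠ 0 ∧ r = ‖u.1 0‖ / ‖u.1 2‖}

/-- `ev` is an eigenvalue of the one-dimensional `p`-biharmonic problem
`(|u''|^(p-2) u'')'' = ev |u|^(p-2) u` in `(a, b)` with Navier boundary conditions
`u = u'' = 0` at `a` and `b`, in the weak sense: `u = 0` at the endpoints is built into the space,
and `u'' = 0` is the natural boundary condition, as the test functions `v` only satisfy `v = 0`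
there. -/
def IsNavierEigenvalue (ev : ℝ) : Prop :=
  ∃ u ∈ navierSpace p a b, u ≠ 0 ∧ ∀ v ∈ navierSpace p a b,
    ∫ x in Ioo a b, |u.1 2 x| ^ (p.toReal - 2) * u.1 2 x * v.1 2 x =
      ev * ∫ x in Ioo a b, |u.1 0 x| ^ (p.toReal - 2) * u.1 0 x * v.1 0 x

/-! ### `s`-numbers

Throughout, numbers are indexed by `n = 1, 2, …`; the value at `n = 0` is irrelevant. -/

section SNumbers

variable {X Y : Type} [NormedAddCommGroup X] [NormedSpace ℝ X]
  [NormedAddCommGroup Y] [NormedSpace ℝ Y]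

/-- The `n`-th approximation number. -/
def approxNumber (T : X →L[ℝ] Y) (n : ℕ) : ℝ :=
  sInf {r | ∃ F : X →L[ℝ] Y, (F : X →ₗ[ℝ] Y).rank < n ∧ r = ‖T - F‖}

/-- The `n`-th Bernstein number. -/
def bernsteinNumber (T : X →L[ℝ] Y) (n : ℕ) : ℝ :=
  sSup {r | ∃ V : Submodule ℝ X, Module.rank ℝ V = n ∧
    r = ⨅ x : {x : X // x ∈ V ∧ x ≠ 0}, ‖T x.1‖ / ‖x.1‖}

/-- The `n`-th Gelfand number. -/
def gelfandNumber (T : X →L[ℝ] Y) (n : ℕ) : ℝ :=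
  sInf {r | ∃ M : Submodule ℝ X, IsClosed (M : Set X) ∧ Module.rank ℝ (X ⧸ M) < n ∧
    r = ‖T ∘L M.subtypeL‖}

end SNumbers

/-- A rule that assigns a sequence of numbers to each bounded linear map between Banach spaces. -/
abbrev SRule : Type 1 :=
  ∀ (X Y : Type) [NormedAddCommGroup X] [NormedSpace ℝ X] [CompleteSpace X]
    [NormedAddCommGroup Y] [NormedSpace ℝ Y] [CompleteSpace Y], (X →L[ℝ] Y) → ℕ → ℝ

/-- The axioms of `s`-numbers in the strict sense. -/
structure IsStrictSNumber (s : SRule) : Prop where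
  one_eq_norm : ∀ (X Y : Type) [NormedAddCommGroup X] [NormedSpace ℝ X] [CompleteSpace X]
    [NormedAddCommGroup Y] [NormedSpace ℝ Y] [CompleteSpace Y] (T : X →L[ℝ] Y),
    s X Y T 1 = ‖T‖
  succ_le : ∀ (X Y : Type) [NormedAddCommGroup X] [NormedSpace ℝ X] [CompleteSpace X]
    [NormedAddCommGroup Y] [NormedSpace ℝ Y] [CompleteSpace Y] (T : X →L[ℝ] Y) (n : ℕ),
    1 ≤ n → s X Y T (n + 1) ≤ s X Y T n
  nonneg : ∀ (X Y : Type) [NormedAddCommGroup X] [NormedSpace ℝ X] [CompleteSpace X]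
    [NormedAddCommGroup Y] [NormedSpace ℝ Y] [CompleteSpace Y] (T : X →L[ℝ] Y) (n : ℕ),
    1 ≤ n → 0 ≤ s X Y T n
  add_le : ∀ (X Y : Type) [NormedAddCommGroup X] [NormedSpace ℝ X] [CompleteSpace X]
    [NormedAddCommGroup Y] [NormedSpace ℝ Y] [CompleteSpace Y] (S T : X →L[ℝ] Y) (n : ℕ),
    1 ≤ n → s X Y (S + T) n ≤ s X Y S n + ‖T‖
  comp_le : ∀ (W X Y Z : Type) [NormedAddCommGroup W] [NormedSpace ℝ W] [CompleteSpace W]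
    [NormedAddCommGroup X] [NormedSpace ℝ X] [CompleteSpace X]
    [NormedAddCommGroup Y] [NormedSpace ℝ Y] [CompleteSpace Y]
    [NormedAddCommGroup Z] [NormedSpace ℝ Z] [CompleteSpace Z]
    (A : W →L[ℝ] X) (T : X →L[ℝ] Y) (B : Y →L[ℝ] Z) (n : ℕ),
    1 ≤ n → s W Z (B ∘L T ∘L A) n ≤ ‖B‖ * s X Y T n * ‖A‖
  rank_lt : ∀ (X Y : Type) [NormedAddCommGroup X] [NormedSpace ℝ X] [CompleteSpace X]
    [NormedAddCommGroup Y] [NormedSpace ℝ Y] [CompleteSpace Y] (T : X →L[ℝ] Y) (n : ℕ),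
    1 ≤ n → (T : X →ₗ[ℝ] Y).rank < n → s X Y T n = 0
  id_eq_one : ∀ (X : Type) [NormedAddCommGroup X] [NormedSpace ℝ X] [CompleteSpace X] (n : ℕ),
    1 ≤ n → (n : Cardinal) ≤ Module.rank ℝ X → s X X (ContinuousLinearMap.id ℝ X) n = 1

/-- Injectivity: the numbers do not change when the target is enlarged isometrically. -/
def IsInjectiveSNumber (s : SRule) : Prop :=
  ∀ (X Y Z : Type) [NormedAddCommGroup X] [NormedSpace ℝ X] [CompleteSpace X]
    [NormedAddCommGroup Y] [NormedSpace ℝ Y] [CompleteSpace Y]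
    [NormedAddCommGroup Z] [NormedSpace ℝ Z] [CompleteSpace Z]
    (T : X →L[ℝ] Y) (J : Y →ₗᵢ[ℝ] Z) (n : ℕ),
    1 ≤ n → s X Z (J.toContinuousLinearMap ∘L T) n = s X Y T n

/-- The two-sided bounds, and the limit, for a sequence `σ 1, σ 2, …` on an interval of length `l`
with constant `B`. (The upper bound is void for `n = 1`, where its right side is infinite.) -/
def HasSharpAsymptotics (l B : ℝ) (σ : ℕ → ℝ) : Prop :=
  (∀ n : ℕ, 1 ≤ n → (l / ((n : ℝ) + 1)) ^ 2 * B ≤ σ n) ∧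
  (∀ n : ℕ, 2 ≤ n → σ n ≤ (l / ((n : ℝ) - 1)) ^ 2 * B) ∧
  Tendsto (fun n : ℕ => (n : ℝ) ^ 2 * σ n) atTop (𝓝 (l ^ 2 * B))

end SobolevEmbedding

end

/-! Write `P` for the exponent as a real number and `sp P t = |t| ^ (P - 2) * t`. Everything rests
on one positive eigenfunction. The fourth-order equation is split into the system `F'' = -G`, `(sp P
G)'' = -lam * sp P F`, with `F` and `G` odd about `0`, even about `1 / 2`, and `G > 0` on `(0, 1)`.
For existence (`exists_halfEigen`, `exists_isSinePair`), the conditions `u 0 = 0`, `u' (1 / 2) = 0`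
make the inverse of `-u''` on half of the interval an integral operator with the nonnegative
symmetric kernel `min x y`. A homogeneous functional is maximized over a class of Lipschitz
functions, compact by Arzelà–Ascoli. The equality case of Hölder's inequality shows that a maximizer
is fixed by the power method, and reflection extends the solution to the line.

Sharp constant: `u - Ku` is the Green operator applied to `-u''`, and so is `u` itself when it
vanishes at both ends. The pair `(G, F)` satisfies the hypotheses of Schur's test (`schur_test`)
with equality, so the Green operator of `(0, 1)` has norm `lam ^ (-1 / P)` on `L_p`, attained at
`G`. This gives both constants. Testing an eigenfunction against itself then shows that no
eigenvalue is smaller than `lam`.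

Upper bounds (`Sobolev₀.exists_finite_rank`): divide the interval into `n` equal pieces and
interpolate linearly. As `u` vanishes at both ends, only the `n - 1` interior nodes count and the
rank is below `n`. On each piece the error is the Green operator of that piece, and the `P`-th
powers of the errors add up.

Lower bounds (`Sobolev₀.exists_submodule`): shifted by `1 / 2`, the eigenfunction becomes a pair
`φ`, `γ` with zero first derivatives at the integers, and `γ` changes sign half way between them. On
`[0, n + 1]` let `-u''` be a multiple `c k` of `γ` on each of the `n + 2` unit intervals centred at
`0, …, n + 1`; two moment conditions put `u` in the zero-boundary space and leave dimension at least
`n`. The heart of the proof is `IsCosPair.integral_stepMul_rpow_le`: for such `u`, even with only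
`u' = 0` at the ends, `‖u''‖ ^ P ≤ lam * ‖u‖ ^ P`. Otherwise the quotient has a maximum `M > lam` on
this finite-dimensional space. Scale a maximizer by `α > 0` so that its largest coefficient becomes
`1`, and compare it with `φ`. Under zero first derivatives at the ends, two differentiations carry
an alternation of signs at `N + 1` points to an alternation at `N + 1` points. Going once around the
Euler–Lagrange system in this way yields `α * c k < 1` for every `k`, which is absurd. So no
coefficient is positive; applied to `-u`, none is negative, and `u'' = 0`.

Finally, an `n`-dimensional subspace on which `‖T x‖ ≥ C * ‖x‖`, and an operator of rank below `n`
near `T`, bound each of the `s`-numbers from below and above. -/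

noncomputable section

namespace SobolevEmbedding

/-! ### The signed power -/

/-- The signed power `|t|^(P-2) t`. -/
def sp (P t : ℝ) : ℝ := |t| ^ (P - 2) * t

section SignedPower
variable {P : ℝ}

lemma sp_neg (t : ℝ) : sp P (-t) = -sp P t := by simp [sp]

@[simp] lemma sp_zero : sp P 0 = 0 := by simp [sp]

lemma sp_of_nonneg (hP : 1 < P) {t : ℝ} (ht : 0 ≤ t) : sp P t = t ^ (P - 1) := by
  rcases ht.eq_or_lt with rfl | ht
  · rw [sp_zero, Real.zero_rpow (by linarith)]
  · rw [sp, abs_of_pos ht, show P - 1 = P - 2 + 1 by ring, Real.rpow_add_one ht.ne']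

lemma abs_sp (hP : 1 < P) (t : ℝ) : |sp P t| = |t| ^ (P - 1) := by
  rw [← sp_of_nonneg hP (abs_nonneg t), sp, sp, abs_mul, abs_abs,
    abs_of_nonneg (Real.rpow_nonneg (abs_nonneg t) _)]

lemma sp_mul_self (hP : 1 < P) (t : ℝ) : sp P t * t = |t| ^ P := by
  rcases eq_or_ne t 0 with rfl | ht
  · rw [mul_zero, abs_zero, Real.zero_rpow (by linarith)]
  · rw [sp, mul_assoc, ← abs_mul_abs_self t, ← mul_assoc, ← Real.rpow_add_one (abs_ne_zero.2 ht),
      ← Real.rpow_add_one (abs_ne_zero.2 ht)]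
    congr 1
    ring

lemma sp_mul (hP : 1 < P) {α : ℝ} (hα : 0 ≤ α) (t : ℝ) : sp P (α * t) = α ^ (P - 1) * sp P t := by
  rw [← sp_of_nonneg hP hα, sp, sp, sp, abs_mul, Real.mul_rpow (abs_nonneg _) (abs_nonneg _)]
  ring

/-- For `P < 2` the factor `|t| ^ (P - 2)` is unbounded near `0`, so continuity is read off from `P
* sp P` being the derivative of the `C¹` function `|t| ^ P`. -/
lemma continuous_sp (hP : 1 < P) : Continuous (sp P) := by
  have h := (contDiff_norm_rpow (E := ℝ) hP).continuous_deriv le_rfl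
  have h2 : deriv (fun x : ℝ => ‖x‖ ^ P) = fun x => P * sp P x := by
    ext x
    simp only [Real.norm_eq_abs]
    rw [(hasDerivAt_abs_rpow x hP).deriv, sp, mul_assoc]
  rw [h2] at h
  have h3 : sp P = fun x => P⁻¹ * (P * sp P x) := by
    ext x
    rw [inv_mul_cancel_left₀ (by linarith)]
  rw [h3]
  exact continuous_const.mul h

lemma strictMono_sp (hP : 1 < P) : StrictMono (sp P) := by
  have hnn : ∀ s t : ℝ, 0 ≤ s → s < t → sp P s < sp P t := fun s t hs hst => by
    rw [sp_of_nonneg hP hs, sp_of_nonneg hP (hs.trans hst.le)]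
    exact Real.rpow_lt_rpow hs hst (by linarith)
  have hnonneg : ∀ t : ℝ, 0 ≤ t → 0 ≤ sp P t := fun t ht => by
    rw [sp_of_nonneg hP ht]
    exact Real.rpow_nonneg ht _
  intro s t hst
  rcases le_or_gt 0 s with hs | hs
  · exact hnn s t hs hst
  rcases le_or_gt 0 t with ht | ht
  · have := hnn 0 (-s) le_rfl (by linarith)
    rw [sp_neg, sp_zero] at this
    linarith [hnonneg t ht]
  · have := hnn (-t) (-s) (by linarith) (by linarith)
    rw [sp_neg, sp_neg] at this
    linarith

lemma hasDerivAt_abs_rpow_sp (hP : 1 < P) (x : ℝ) :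
    HasDerivAt (fun t : ℝ => |t| ^ P) (P * sp P x) x := by
  rw [sp, ← mul_assoc]
  exact hasDerivAt_abs_rpow x hP

lemma continuous_abs_rpow (hP : 1 < P) : Continuous fun t : ℝ => |t| ^ P :=
  continuous_abs.rpow_const fun _ => Or.inr (by linarith)

/-- The derivative of the `P`-th power of the `L^P` norm along a line. -/
lemma hasDerivAt_integral_abs_rpow (hP : 1 < P) {f g : ℝ → ℝ} (hf : Continuous f)
    (hg : Continuous g) (a b : ℝ) :
    HasDerivAt (fun t : ℝ => ∫ x in a..b, |f x + t * g x| ^ P)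
      (P * ∫ x in a..b, sp P (f x) * g x) 0 := by
  have hsp := continuous_sp hP
  have habs := continuous_abs_rpow hP
  have h := (intervalIntegral.hasDerivAt_integral_of_dominated_loc_of_deriv_le
    (F := fun t x => |f x + t * g x| ^ P) (F' := fun t x => P * sp P (f x + t * g x) * g x)
    (x₀ := (0 : ℝ)) (a := a) (b := b) (μ := volume) (s := Metric.ball 0 1)
    (bound := fun x => P * (|f x| + |g x|) ^ (P - 1) * |g x|)
    (Metric.ball_mem_nhds _ one_pos) ?_ ?_ ?_ ?_ ?_ ?_).2
  · refine h.congr_deriv ?_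
    rw [← intervalIntegral.integral_const_mul]
    refine intervalIntegral.integral_congr fun x _ => ?_
    simp [mul_assoc]
  · exact Eventually.of_forall fun t => (habs.comp (hf.add (continuous_const.mul hg))).aestronglyMeasurable
  · exact (habs.comp (hf.add (continuous_const.mul hg))).intervalIntegrable _ _
  · exact ((continuous_const.mul (hsp.comp (hf.add (continuous_const.mul hg)))).mul
      hg).aestronglyMeasurable
  · refine ae_of_all _ fun x _ t ht => ?_
    rw [norm_mul, norm_mul, Real.norm_eq_abs, Real.norm_eq_abs, Real.norm_eq_abs, abs_sp hP,
      abs_of_pos (by linarith : 0 < P)]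
    have ht1 : |t| ≤ 1 := by simpa using (mem_ball_zero_iff.1 ht).le
    have h2 : |f x + t * g x| ≤ |f x| + |g x| := by
      refine (abs_add_le _ _).trans ?_
      rw [abs_mul]
      gcongr
      exact mul_le_of_le_one_left (abs_nonneg _) ht1
    gcongr
  · refine Continuous.intervalIntegrable ?_ _ _
    exact (continuous_const.mul ((hf.abs.add hg.abs).rpow_const fun _ => Or.inr (by linarith))).mul
      hg.abs
  · refine ae_of_all _ fun x _ t _ => ?_
    have h1 : HasDerivAt (fun t => f x + t * g x) (g x) t := by
      simpa using ((hasDerivAt_id t).mul_const (g x)).const_add (f x)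
    exact (hasDerivAt_abs_rpow_sp hP _).comp t h1

end SignedPower

/-! ### Alternation of signs under differentiation -/

/-- The mean value theorem on each gap; outside `i < N` the chosen points are arbitrary. -/
lemma exists_alternating_deriv {F F' : ℝ → ℝ} (hF : ∀ x, HasDerivAt F (F' x) x) {N : ℕ}
    {x : ℕ → ℝ} (hx : ∀ i < N, x i < x (i + 1))
    (hs : ∀ i < N, 0 < (-1) ^ i * (F (x (i + 1)) - F (x i))) :
    ∃ ξ : ℕ → ℝ, ∀ i < N, ξ i ∈ Ioo (x i) (x (i + 1)) ∧ 0 < (-1) ^ i * F' (ξ i) := by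
  have : ∀ i, ∃ ξ, i < N → ξ ∈ Ioo (x i) (x (i + 1)) ∧ 0 < (-1) ^ i * F' ξ := fun i => by
    by_cases hi : i < N
    · obtain ⟨c, hc, h⟩ := exists_hasDerivAt_eq_slope F F' (hx i hi)
        (fun y _ => (hF y).continuousAt.continuousWithinAt) (fun y _ => hF y)
      refine ⟨c, fun _ => ⟨hc, ?_⟩⟩
      rw [h, ← mul_div_assoc]
      exact div_pos (hs i hi) (sub_pos.2 (hx i hi))
    · exact ⟨0, fun h => absurd h hi⟩
  choose ξ hξ using this
  exact ⟨ξ, hξ⟩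

/-- If `F` alternates in sign along an increasing sequence and `F'` vanishes at the endpoints,
then `F''` alternates in the opposite sense. -/
lemma exists_alternating_deriv2 {F F' F'' : ℝ → ℝ} (hF : ∀ x, HasDerivAt F (F' x) x)
    (hF' : ∀ x, HasDerivAt F' (F'' x) x) {L : ℝ} (h0 : F' 0 = 0) (hL : F' L = 0) {N : ℕ}
    (hN : 1 ≤ N) {x : ℕ → ℝ} (hx : ∀ i < N, x i < x (i + 1)) (hx0 : ∀ i ≤ N, x i ∈ Icc 0 L)
    (hs : ∀ i ≤ N, (-1) ^ i * F (x i) < 0) :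
    ∃ η : ℕ → ℝ, (∀ i < N, η i < η (i + 1)) ∧ (∀ i ≤ N, η i ∈ Icc 0 L) ∧
      ∀ i ≤ N, 0 < (-1) ^ i * F'' (η i) := by
  obtain ⟨ξ, hξ⟩ := exists_alternating_deriv hF hx fun i hi => by
    have h1 := hs i hi.le
    have h2 := hs (i + 1) hi
    rw [pow_succ] at h2
    linarith
  -- The `N` points where `F'` has a strict sign are flanked by its zeros `0` and `L`. Over these `N
  -- + 2` points the increments of `F'` alternate strictly, because every gap has at least one end
  -- with a strict sign. Hence `F''` alternates at `N + 1` points, and none is lost.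
  let Ξ : ℕ → ℝ := fun i => if i = 0 then 0 else if i ≤ N then ξ (i - 1) else L
  have hΞ0 : Ξ 0 = 0 := rfl
  have hΞm : ∀ i < N, Ξ (i + 1) = ξ i := fun i hi => by
    simp [Ξ, Nat.succ_le_of_lt hi]
  have hΞL : Ξ (N + 1) = L := by simp [Ξ]
  have hmono : ∀ i < N + 1, Ξ i < Ξ (i + 1) := by
    intro i hi
    rcases Nat.eq_zero_or_pos i with rfl | hi0
    · rw [hΞ0, hΞm 0 hN]
      exact (hx0 0 (by omega)).1.trans_lt (hξ 0 hN).1.1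
    obtain ⟨j, rfl⟩ : ∃ j, i = j + 1 := ⟨i - 1, by omega⟩
    rw [hΞm j (by omega)]
    rcases eq_or_lt_of_le (Nat.le_of_lt_succ hi) with h | h
    · rw [show Ξ (j + 1 + 1) = L by rw [h, hΞL]]
      exact (hξ j (by omega)).1.2.trans_le (hx0 (j + 1) (by omega)).2
    · rw [hΞm _ h]
      exact (hξ j (by omega)).1.2.trans (hξ _ h).1.1
  obtain ⟨η, hη⟩ := exists_alternating_deriv hF' hmono fun i hi => by
    have hA : 0 ≤ (-1) ^ i * F' (Ξ (i + 1)) ∧ (i < N → 0 < (-1) ^ i * F' (Ξ (i + 1))) := by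
      rcases eq_or_lt_of_le (Nat.le_of_lt_succ hi) with h | h
      · rw [h, hΞL, hL]
        simp
      · rw [hΞm i h]
        exact ⟨(hξ i h).2.le, fun _ => (hξ i h).2⟩
    have hB : (-1) ^ i * F' (Ξ i) ≤ 0 ∧ (0 < i → (-1) ^ i * F' (Ξ i) < 0) := by
      rcases Nat.eq_zero_or_pos i with rfl | hi0
      · rw [hΞ0, h0]
        simp
      · obtain ⟨j, rfl⟩ : ∃ j, i = j + 1 := ⟨i - 1, by omega⟩
        rw [hΞm j (by omega), pow_succ]
        have := (hξ j (by omega)).2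
        constructor
        · linarith
        · intro _
          linarith
    rw [mul_sub]
    by_cases hiN : i < N
    · linarith [hA.2 hiN, hB.1]
    · linarith [hA.1, hB.2 (by omega)]
  have hΞmem : ∀ i ≤ N + 1, Ξ i ∈ Icc 0 L := by
    intro i hi
    rcases Nat.eq_zero_or_pos i with rfl | hi0
    · rw [hΞ0]
      exact ⟨le_rfl, (hx0 0 (by omega)).1.trans (hx0 0 (by omega)).2⟩
    obtain ⟨j, rfl⟩ : ∃ j, i = j + 1 := ⟨i - 1, by omega⟩
    rcases eq_or_lt_of_le hi with h | h
    · rw [h, hΞL]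
      exact ⟨(hx0 0 (by omega)).1.trans (hx0 0 (by omega)).2, le_rfl⟩
    · rw [hΞm j (by omega)]
      have := (hξ j (by omega)).1
      exact ⟨(hx0 j (by omega)).1.trans this.1.le, this.2.le.trans (hx0 (j + 1) (by omega)).2⟩
  refine ⟨η, fun i hi => (hη i (by omega)).1.2.trans (hη (i + 1) (by omega)).1.1, fun i hi => ?_,
    fun i hi => (hη i (by omega)).2⟩
  have := (hη i (by omega)).1
  exact ⟨(hΞmem i (by omega)).1.trans this.1.le, this.2.le.trans (hΞmem (i + 1) (by omega)).2⟩

/-! ### Second primitives -/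

/-- The second primitive of `q` that vanishes to first order at `0`. -/
def prim2 (q : ℝ → ℝ) (x : ℝ) : ℝ := ∫ t in (0 : ℝ)..x, ∫ s in (0 : ℝ)..t, q s

lemma hasDerivAt_primitive {q : ℝ → ℝ} (hq : Continuous q) (x : ℝ) :
    HasDerivAt (fun x => ∫ s in (0 : ℝ)..x, q s) (q x) x :=
  intervalIntegral.integral_hasDerivAt_right (hq.intervalIntegrable _ _)
    (hq.stronglyMeasurableAtFilter _ _) hq.continuousAt

lemma continuous_primitive {q : ℝ → ℝ} (hq : Continuous q) :
    Continuous fun x => ∫ s in (0 : ℝ)..x, q s :=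
  continuous_iff_continuousAt.2 fun x => (hasDerivAt_primitive hq x).continuousAt

lemma hasDerivAt_prim2 {q : ℝ → ℝ} (hq : Continuous q) (x : ℝ) :
    HasDerivAt (prim2 q) (∫ s in (0 : ℝ)..x, q s) x :=
  hasDerivAt_primitive (continuous_primitive hq) x

lemma continuous_prim2 {q : ℝ → ℝ} (hq : Continuous q) : Continuous (prim2 q) :=
  continuous_primitive (continuous_primitive hq)

/-! ### Sign-alternating eigenfunctions -/

/-- A solution `φ'' = -γ`, `(sp γ)'' = -lam sp φ` whose first derivatives vanish at the natural
numbers and for which `γ` changes sign exactly half way between them. -/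
structure IsCosPair (P lam : ℝ) (φ φ' γ ψ' : ℝ → ℝ) : Prop where
  one_lt : 1 < P
  lam_pos : 0 < lam
  deriv_φ : ∀ x, HasDerivAt φ (φ' x) x
  deriv_φ' : ∀ x, HasDerivAt φ' (-γ x) x
  deriv_ψ : ∀ x, HasDerivAt (fun y => sp P (γ y)) (ψ' x) x
  deriv_ψ' : ∀ x, HasDerivAt ψ' (-(lam * sp P (φ x))) x
  continuous_γ : Continuous γ
  φ'_nat : ∀ k : ℕ, φ' k = 0
  ψ'_nat : ∀ k : ℕ, ψ' k = 0
  γ_half : ∀ (k : ℕ) (x : ℝ), |x - k| = 1 / 2 → γ x = 0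
  γ_sign : ∀ (k : ℕ) (x : ℝ), |x - k| < 1 / 2 → 0 < (-1) ^ k * γ x

/-- The restriction of `γ` to the interval of length one centred at `k`. -/
def piece (γ : ℝ → ℝ) (k : ℕ) (x : ℝ) : ℝ := if |x - k| ≤ 1 / 2 then γ x else 0

/-- The function that equals `c k` times `γ` on the interval of length one centred at `k`. -/
def stepMul (γ : ℝ → ℝ) {N : ℕ} (c : Fin (N + 1) → ℝ) (x : ℝ) : ℝ := ∑ k, c k * piece γ k x

lemma stepMul_eq_zero {γ : ℝ → ℝ} {N : ℕ} (c : Fin (N + 1) → ℝ) {x : ℝ} (hγ : γ x = 0) :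
    stepMul γ c x = 0 := by
  refine Finset.sum_eq_zero fun k _ => ?_
  rw [piece]
  split_ifs <;> simp [hγ]

namespace IsCosPair

variable {P lam : ℝ} {φ φ' γ ψ' : ℝ → ℝ} (h : IsCosPair P lam φ φ' γ ψ') {N : ℕ}
include h

lemma continuous_piece (k : ℕ) : Continuous (piece γ k) := by
  refine continuous_if_le (by fun_prop) continuous_const h.continuous_γ.continuousOn
    continuous_const.continuousOn fun x hx => h.γ_half k x hx

lemma continuous_stepMul (c : Fin (N + 1) → ℝ) : Continuous (stepMul γ c) :=
  continuous_finsetSum _ fun k _ => continuous_const.mul (h.continuous_piece k)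

lemma piece_eq_zero (k : ℕ) {x : ℝ} (hx : 1 / 2 ≤ |x - k|) : piece γ k x = 0 := by
  rw [piece]
  split_ifs with h1
  · exact h.γ_half k x (le_antisymm h1 hx)
  · rfl

lemma stepMul_eq (c : Fin (N + 1) → ℝ) (k : Fin (N + 1)) {x : ℝ} (hx : |x - (k : ℕ)| < 1 / 2) :
    stepMul γ c x = c k * γ x := by
  rw [stepMul, Finset.sum_eq_single k]
  · rw [piece, if_pos hx.le]
  · intro j _ hj
    rw [h.piece_eq_zero, mul_zero]
    have h1 : (1 : ℝ) ≤ |((j : ℕ) : ℝ) - (k : ℕ)| := by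
      have h2 : ((j : ℕ) : ℤ) - (k : ℕ) ≠ 0 := by
        intro h3
        exact hj (Fin.ext (by omega))
      have h4 := Int.one_le_abs h2
      exact_mod_cast h4
    rw [abs_lt] at hx
    rcases le_abs.1 h1 with h2 | h2
    · exact le_abs.2 (Or.inr (by linarith))
    · exact le_abs.2 (Or.inl (by linarith))
  · simp

/-- Round to the nearest integer; distance exactly `1 / 2` is excluded because `γ` vanishes there.
-/
lemma exists_near {x : ℝ} (hx : x ∈ Icc (0 : ℝ) N) (hγ : γ x ≠ 0) :
    ∃ k : Fin (N + 1), |x - (k : ℕ)| < 1 / 2 := by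
  have h1 := abs_sub_round x
  have h2 := abs_le.1 h1
  have h0 : 0 ≤ round x := by
    have : (-1 : ℝ) < round x := by linarith [hx.1]
    have : (-1 : ℤ) < round x := by exact_mod_cast this
    omega
  obtain ⟨k, hk⟩ := Int.eq_ofNat_of_zero_le h0
  rw [hk] at h1 h2
  simp only [Int.cast_natCast] at h1 h2
  have h3 : k < N + 1 := by
    have : (k : ℝ) < N + 1 := by linarith [hx.2]
    exact_mod_cast this
  refine ⟨⟨k, h3⟩, lt_of_le_of_ne h1 fun h4 => hγ (h.γ_half k x h4)⟩

lemma piece_mul (k : ℕ) (x : ℝ) : sp P (γ x) * piece γ k x = |piece γ k x| ^ P := by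
  rw [piece]
  split_ifs
  · exact sp_mul_self h.one_lt _
  · rw [mul_zero, abs_zero, Real.zero_rpow (by linarith [h.one_lt])]

/-- At each point at most one summand is nonzero, so the power of the sum is the sum of the powers.
This makes the `L^P` norm of `u''` a diagonal function of the coefficients. -/
lemma abs_stepMul_rpow (c : Fin (N + 1) → ℝ) {x : ℝ} (hx : x ∈ Icc (0 : ℝ) N) :
    |stepMul γ c x| ^ P = ∑ k, |c k| ^ P * |piece γ k x| ^ P := by
  have hP := h.one_lt
  by_cases hγ : γ x = 0
  · rw [stepMul_eq_zero c hγ, abs_zero, Real.zero_rpow (by linarith)]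
    refine (Finset.sum_eq_zero fun k _ => ?_).symm
    rw [piece]
    split_ifs <;> simp [hγ, Real.zero_rpow (by linarith : P ≠ 0)]
  · obtain ⟨k, hk⟩ := h.exists_near hx hγ
    have h1 := h.stepMul_eq (fun j => |c j| ^ P) k hk
    rw [h.stepMul_eq c k hk, abs_mul, Real.mul_rpow (abs_nonneg _) (abs_nonneg _)]
    rw [Finset.sum_eq_single k]
    · rw [piece, if_pos hk.le]
    · intro j _ hj
      have h2 : piece γ j x = 0 := by
        have h3 := h.stepMul_eq (Pi.single j 1) k hk
        rw [Pi.single_eq_of_ne (Ne.symm hj), zero_mul, stepMul, Finset.sum_eq_single j] at h3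
        · simpa using h3
        · intro i _ hi
          simp [hi]
        · simp
      rw [h2, abs_zero, Real.zero_rpow (by linarith), mul_zero]
    · simp

/-- If `W` has negative weighted means, it takes alternating signs near the integers. -/
lemma exists_alternating {W : ℝ → ℝ} (hW : ∀ k : Fin (N + 1), ∫ x in (0 : ℝ)..N, W x * piece γ k x < 0) :
    ∃ x : ℕ → ℝ, ∀ i ≤ N, x i ∈ Icc (0 : ℝ) N ∧ |x i - i| < 1 / 2 ∧ (-1) ^ i * W (x i) < 0 := by
  have : ∀ i, ∃ x, i ≤ N → x ∈ Icc (0 : ℝ) N ∧ |x - i| < 1 / 2 ∧ (-1) ^ i * W x < 0 := by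
    intro i
    by_cases hi : i ≤ N
    · have hex : ∃ x ∈ Icc (0 : ℝ) N, W x * piece γ i x < 0 := by
        by_contra! hcon
        exact absurd (hW ⟨i, by omega⟩)
          (not_lt.2 (intervalIntegral.integral_nonneg (by positivity) hcon))
      obtain ⟨x, hx, hneg⟩ := hex
      have hnear : |x - i| < 1 / 2 := by
        by_contra! hcon
        rw [h.piece_eq_zero i hcon, mul_zero] at hneg
        exact lt_irrefl _ hneg
      refine ⟨x, fun _ => ⟨hx, hnear, ?_⟩⟩
      have hs := h.γ_sign i x hnear
      rw [piece, if_pos hnear.le] at hneg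
      rcases neg_one_pow_eq_or ℝ i with h1 | h1 <;> rw [h1] at hs ⊢ <;> nlinarith
    · exact ⟨0, fun h => absurd h hi⟩
  choose x hx using this
  exact ⟨x, hx⟩

lemma integral_sp_mul_piece_pos (k : Fin (N + 1)) (hN : 1 ≤ N) :
    0 < ∫ x in (0 : ℝ)..N, |piece γ k x| ^ P := by
  have hN' : (1 : ℝ) ≤ N := by exact_mod_cast hN
  have hk : ((k : ℕ) : ℝ) ≤ N := by exact_mod_cast Nat.le_of_lt_succ k.2
  refine intervalIntegral.integral_pos (by linarith)
    ((continuous_abs_rpow h.one_lt).comp (h.continuous_piece k)).continuousOn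
    (fun x _ => Real.rpow_nonneg (abs_nonneg _) _) ⟨k, ⟨by positivity, hk⟩, ?_⟩
  have hs := h.γ_sign k k (by simp)
  rw [piece, if_pos (by simp)]
  refine Real.rpow_pos_of_pos (abs_pos.2 fun h0 => ?_) _
  rw [h0, mul_zero] at hs
  exact lt_irrefl _ hs

lemma integral_piece_ne_zero (k : Fin (N + 1)) (hN : 1 ≤ N) :
    ∫ x in (0 : ℝ)..N, piece γ k x ≠ 0 := by
  have hN' : (1 : ℝ) ≤ N := by exact_mod_cast hN
  have hk : ((k : ℕ) : ℝ) ≤ N := by exact_mod_cast Nat.le_of_lt_succ k.2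
  have hnn : ∀ x, 0 ≤ (-1) ^ (k : ℕ) * piece γ k x := fun x => by
    by_cases hx : |x - (k : ℕ)| < 1 / 2
    · rw [piece, if_pos hx.le]
      exact (h.γ_sign k x hx).le
    · rw [h.piece_eq_zero k (not_lt.1 hx), mul_zero]
  have hpos : 0 < ∫ x in (0 : ℝ)..N, (-1) ^ (k : ℕ) * piece γ k x := by
    refine intervalIntegral.integral_pos (by linarith)
      (continuous_const.mul (h.continuous_piece k)).continuousOn
      (fun x _ => hnn x) ⟨k, ⟨by positivity, hk⟩, ?_⟩
    rw [piece, if_pos (by simp)]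
    exact h.γ_sign k k (by simp)
  intro h0
  rw [intervalIntegral.integral_const_mul, h0, mul_zero] at hpos
  exact lt_irrefl _ hpos

/-- The comparison argument: an alternating majorization of `u''` by `φ''` cannot touch. -/
lemma one_sub_pos_of_alternating (hN : 1 ≤ N) {c : Fin (N + 1) → ℝ} {α : ℝ} (hα : ∀ k, α * c k ≤ 1)
    {u u' : ℝ → ℝ} (hu : ∀ x, HasDerivAt u (u' x) x)
    (hu' : ∀ x, HasDerivAt u' (-stepMul γ c x) x) (h0 : u' 0 = 0) (hL : u' N = 0)
    {η : ℕ → ℝ} (hη : ∀ i < N, η i < η (i + 1)) (hmem : ∀ i ≤ N, η i ∈ Icc (0 : ℝ) N)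
    (hs : ∀ i ≤ N, (-1) ^ i * (α * u (η i) - φ (η i)) < 0) (k : Fin (N + 1)) : α * c k < 1 := by
  obtain ⟨w, hw, hwm, hws⟩ := exists_alternating_deriv2 (F := fun x => α * u x - φ x)
    (F' := fun x => α * u' x - φ' x) (F'' := fun x => α * (-stepMul γ c x) - (-γ x))
    (fun x => ((hu x).const_mul α).sub (h.deriv_φ x))
    (fun x => ((hu' x).const_mul α).sub (h.deriv_φ' x)) (L := N)
    (by simp [h0, show φ' 0 = 0 by simpa using h.φ'_nat 0]) (by simp [hL, h.φ'_nat N])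
    hN hη hmem hs
  have hex : ∀ i, ∃ j : Fin (N + 1), i ≤ N → |w i - (j : ℕ)| < 1 / 2 ∧ α * c j < 1 ∧
      (0 : ℝ) < (-1) ^ i * (-1) ^ (j : ℕ) := by
    intro i
    by_cases hi : i ≤ N
    · have h1 := hws i hi
      have hγ : γ (w i) ≠ 0 := by
        intro hγ
        rw [hγ, stepMul_eq_zero c hγ] at h1
        simp at h1
      obtain ⟨j, hj⟩ := h.exists_near (hwm i hi) hγ
      refine ⟨j, fun _ => ⟨hj, ?_⟩⟩
      rw [h.stepMul_eq c j hj] at h1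
      have h2 := h.γ_sign j _ hj
      -- On piece `j` the second derivative of `α * u - φ` is `(1 - α * c j) * γ`, and `γ` has the
      -- sign of `(-1) ^ j`. As `1 - α * c j ≥ 0`, a strict sign at `w i` forces both `α * c j < 1`
      -- and equal parity of `i` and `j`.
      have h3 : (-1 : ℝ) ^ i * (α * -(c j * γ (w i)) - -γ (w i)) =
        (1 - α * c j) * ((-1) ^ i * (-1) ^ (j : ℕ)) * ((-1) ^ (j : ℕ) * γ (w i)) := by
        have h4 : ((-1 : ℝ) ^ (j : ℕ)) * (-1) ^ (j : ℕ) = 1 := by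
          rw [← mul_pow]
          simp
        linear_combination (-(-1) ^ i * (1 - α * c j) * γ (w i)) * h4
      rw [h3] at h1
      have h5 := pos_of_mul_pos_left h1 h2.le
      have h6 : 0 ≤ 1 - α * c j := sub_nonneg.2 (hα j)
      have h7 : 0 < 1 - α * c j := lt_of_le_of_ne h6 fun h8 => by
        rw [← h8, zero_mul] at h5
        exact lt_irrefl _ h5
      exact ⟨by linarith, pos_of_mul_pos_right h5 h6⟩
    · exact ⟨0, fun h => absurd h hi⟩
  choose j hj using hex
  -- Consecutive indices have opposite parity and the points increase, so the indices increase
  -- strictly. A strictly increasing choice of `N + 1` indices in `Fin (N + 1)` is the identity, so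
  -- every piece is visited.
  have hstep : ∀ i < N, (j i : ℕ) < j (i + 1) := by
    intro i hi
    have h1 := hj i hi.le
    have h2 := hj (i + 1) hi
    have h3 := hw i hi
    have h4 := abs_lt.1 h1.1
    have h5 := abs_lt.1 h2.1
    have h6 : ((j i : ℕ) : ℝ) < (j (i + 1) : ℕ) + 1 := by linarith
    have h7 : (j i : ℕ) < (j (i + 1) : ℕ) + 1 := by exact_mod_cast h6
    refine lt_of_le_of_ne (by omega) fun h8 => ?_
    have h9 := h1.2.2
    have h10 := h2.2.2
    rw [← h8, pow_succ] at h10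
    linarith
  have hge : ∀ i ≤ N, i ≤ (j i : ℕ) := by
    intro i
    induction i with
    | zero => simp
    | succ i ih =>
      intro hi
      have := ih (by omega)
      have := hstep i (by omega)
      omega
  have hle : ∀ i ≤ N, (j (N - i) : ℕ) + i ≤ N := by
    intro i
    induction i with
    | zero =>
      intro _
      have := (j (N - 0)).2
      omega
    | succ i ih =>
      intro hi
      have h1 := ih (by omega)
      have h2 := hstep (N - (i + 1)) (by omega)
      rw [show N - (i + 1) + 1 = N - i by omega] at h2
      omega
  have hk := Nat.le_of_lt_succ k.2
  have h1 := hge k hk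
  have h2 := hle (N - k) (by omega)
  rw [show N - (N - (k : ℕ)) = k by omega] at h2
  have h3 : j k = k := Fin.ext (by omega)
  have h4 := (hj k hk).2.1
  rwa [h3] at h4

end IsCosPair

/-- A linear form that vanishes on the kernel of another one, in coordinates. -/
lemma exists_proportional {N : ℕ} {s b : Fin (N + 1) → ℝ} (hs : s 0 ≠ 0)
    (H : ∀ e : Fin (N + 1) → ℝ, ∑ k, e k * s k = 0 → ∑ k, e k * b k = 0) :
    ∃ κ, ∀ k, b k = κ * s k := by
  refine ⟨b 0 / s 0, fun k => ?_⟩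
  have h1 := H (fun i => (Pi.single k (s 0) : Fin (N + 1) → ℝ) i
    - (Pi.single 0 (s k) : Fin (N + 1) → ℝ) i) (by
      simp only [sub_mul, Finset.sum_sub_distrib, Pi.single_apply, ite_mul, zero_mul,
        Finset.sum_ite_eq', Finset.mem_univ, if_true]
      ring)
  simp only [sub_mul, Finset.sum_sub_distrib, Pi.single_apply, ite_mul, zero_mul,
    Finset.sum_ite_eq', Finset.mem_univ, if_true] at h1
  field_simp
  linarith

lemma prim2_zero (q : ℝ → ℝ) : prim2 q 0 = 0 := by simp [prim2]

/-- Green's formula for a second primitive, with Neumann boundary conditions. -/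
lemma integral_mul_eq_of_neumann {q v : ℝ → ℝ} (hq : Continuous q) (hv : Continuous v) {N : ℝ}
    (hqN : ∫ x in (0 : ℝ)..N, q x = 0) (hvN : ∫ x in (0 : ℝ)..N, v x = 0) (κ : ℝ) :
    ∫ x in (0 : ℝ)..N, q x * (κ - prim2 v x) = ∫ x in (0 : ℝ)..N, -prim2 q x * v x := by
  have hQ := continuous_primitive hq
  have hV := continuous_primitive hv
  have h1 := intervalIntegral.integral_mul_deriv_eq_deriv_mul (a := 0) (b := N)
    (u := fun x => κ - prim2 v x) (u' := fun x => -∫ s in (0 : ℝ)..x, v s)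
    (v := fun x => ∫ s in (0 : ℝ)..x, q s) (v' := q)
    (fun x _ => (hasDerivAt_prim2 hv x).const_sub κ) (fun x _ => hasDerivAt_primitive hq x)
    (hV.neg.intervalIntegrable _ _) (hq.intervalIntegrable _ _)
  have h2 := intervalIntegral.integral_mul_deriv_eq_deriv_mul (a := 0) (b := N)
    (u := fun x => prim2 q x) (u' := fun x => ∫ s in (0 : ℝ)..x, q s)
    (v := fun x => ∫ s in (0 : ℝ)..x, v s) (v' := v)
    (fun x _ => hasDerivAt_prim2 hq x) (fun x _ => hasDerivAt_primitive hv x)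
    (hQ.intervalIntegrable _ _) (hv.intervalIntegrable _ _)
  simp only [hqN, hvN, intervalIntegral.integral_same, mul_zero, sub_zero, zero_sub, neg_mul,
    intervalIntegral.integral_neg, neg_neg] at h1 h2 ⊢
  rw [h2, neg_neg]
  rw [← intervalIntegral.integral_congr (fun x _ => mul_comm _ _), h1]
  exact intervalIntegral.integral_congr (fun x _ => mul_comm _ _)

/-! ### Critical points of the quotient. -/

namespace IsCosPair

variable {P lam : ℝ} {φ φ' γ ψ' : ℝ → ℝ} (h : IsCosPair P lam φ φ' γ ψ') {N : ℕ}
include h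

/-- A critical point of the quotient whose value exceeds `lam` has no positive coefficient. -/
lemma nonpos_of_critical (hN : 1 ≤ N) {c : Fin (N + 1) → ℝ} {κ M : ℝ} (hM : lam < M)
    (hc : ∫ x in (0 : ℝ)..N, stepMul γ c x = 0)
    (h1 : ∫ x in (0 : ℝ)..N, sp P (κ - prim2 (stepMul γ c) x) = 0)
    (h2 : ∀ e : Fin (N + 1) → ℝ, ∫ x in (0 : ℝ)..N, stepMul γ e x = 0 →
      M * ∫ x in (0 : ℝ)..N, sp P (κ - prim2 (stepMul γ c) x) * (-prim2 (stepMul γ e) x) =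
        ∑ k, e k * (sp P (c k) * ∫ x in (0 : ℝ)..N, |piece γ k x| ^ P))
    (k₀ : Fin (N + 1)) : c k₀ ≤ 0 := by
  by_contra! hpos
  have hP := h.one_lt
  have hlam := h.lam_pos
  have hM0 : 0 < M := hlam.trans hM
  set u : ℝ → ℝ := fun x => κ - prim2 (stepMul γ c) x with hu
  have hcs : ∀ e : Fin (N + 1) → ℝ, Continuous (stepMul γ e) := fun e => h.continuous_stepMul e
  have huc : Continuous u := continuous_const.sub (continuous_prim2 (hcs c))
  set q : ℝ → ℝ := fun x => sp P (u x) with hq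
  have hqc : Continuous q := (continuous_sp hP).comp huc
  have hpc : ∀ k, Continuous (piece γ k) := h.continuous_piece
  have hG := continuous_prim2 hqc
  have hint : ∀ (e : Fin (N + 1) → ℝ) (F : ℝ → ℝ), Continuous F →
      ∫ x in (0 : ℝ)..N, F x * stepMul γ e x = ∑ k, e k * ∫ x in (0 : ℝ)..N, F x * piece γ k x := by
    intro e F hF
    simp only [stepMul, Finset.mul_sum]
    rw [intervalIntegral.integral_finsetSum]
    · refine Finset.sum_congr rfl fun k _ => ?_
      rw [← intervalIntegral.integral_const_mul]
      exact intervalIntegral.integral_congr fun x _ => by ring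
    · exact fun k _ => (hF.mul (continuous_const.mul (hpc k))).intervalIntegrable _ _
  have hint1 : ∀ e : Fin (N + 1) → ℝ,
      ∫ x in (0 : ℝ)..N, stepMul γ e x = ∑ k, e k * ∫ x in (0 : ℝ)..N, piece γ k x := by
    intro e
    have := hint e (fun _ => 1) continuous_const
    simpa using this
  -- The critical point equation is only available for directions with `∫ stepMul γ e = 0`, so it
  -- determines the weighted means of `-prim2 q` up to a Lagrange multiplier `τ`.
  obtain ⟨τ, hτ⟩ := exists_proportional (h.integral_piece_ne_zero 0 hN)
    (b := fun k => M * (∫ x in (0 : ℝ)..N, -prim2 q x * piece γ k x) -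
      sp P (c k) * ∫ x in (0 : ℝ)..N, |piece γ k x| ^ P) (fun e he => by
      rw [← hint1] at he
      have h3 := h2 e he
      have h4 := integral_mul_eq_of_neumann hqc (hcs e) h1 he 0
      simp only [zero_sub] at h4
      rw [show (fun x => q x * -prim2 (stepMul γ e) x) =
        fun x => sp P (κ - prim2 (stepMul γ c) x) * (-prim2 (stepMul γ e) x) from rfl] at h4
      rw [h4, hint e (fun x => -prim2 q x) hG.neg, Finset.mul_sum] at h3
      refine Eq.trans ?_ (sub_eq_zero.2 h3)
      rw [← Finset.sum_sub_distrib]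
      exact Finset.sum_congr rfl fun k _ => by ring)
  -- Scaling by the inverse of the largest coefficient gives `α * c k ≤ 1` with equality at `k₁`;
  -- the comparison with `φ` will contradict this equality.
  obtain ⟨k₁, -, hk₁⟩ := Finset.exists_max_image (Finset.univ : Finset (Fin (N + 1))) c
    ⟨k₀, Finset.mem_univ _⟩
  have hck : 0 < c k₁ := hpos.trans_le (hk₁ k₀ (Finset.mem_univ _))
  set α := (c k₁)⁻¹ with hα
  have hα0 : 0 < α := inv_pos.2 hck
  have hαc : ∀ k, α * c k ≤ 1 := fun k => by
    rw [hα, inv_mul_le_one₀ hck]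
    exact hk₁ k (Finset.mem_univ _)
  -- With `θ * M = lam * α ^ (P - 1)`, the function `θ * (M * (-prim2 q) - τ) - sp P γ` has second
  -- derivative `lam * (sp P φ - sp P (α * u))`. The slack `lam / M < 1` makes its weighted means
  -- strictly negative.
  set θ := lam / M * α ^ (P - 1) with hθ
  have hθM : θ * M = lam * α ^ (P - 1) := by
    rw [hθ]
    field_simp
  have hmean : ∀ k : Fin (N + 1),
      ∫ x in (0 : ℝ)..N, (θ * (M * (-prim2 q x) - τ) - sp P (γ x)) * piece γ k x < 0 := by
    intro k
    have hi1 : IntervalIntegrable (fun x => -prim2 q x * piece γ k x) volume 0 N :=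
      (hG.neg.mul (hpc k)).intervalIntegrable _ _
    have hi2 : IntervalIntegrable (fun x => piece γ k x) volume 0 N :=
      (hpc k).intervalIntegrable _ _
    have hi3 : IntervalIntegrable (fun x => |piece γ k x| ^ P) volume 0 N :=
      ((continuous_abs_rpow hP).comp (hpc k)).intervalIntegrable _ _
    have e1 : ∀ x, (θ * (M * (-prim2 q x) - τ) - sp P (γ x)) * piece γ k x =
        θ * (M * (-prim2 q x * piece γ k x) - τ * piece γ k x) - |piece γ k x| ^ P := by
      intro x
      rw [← h.piece_mul]
      ring
    simp only [e1]
    rw [intervalIntegral.integral_sub (((hi1.const_mul M).sub (hi2.const_mul τ)).const_mul θ) hi3,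
      intervalIntegral.integral_const_mul,
      intervalIntegral.integral_sub (hi1.const_mul M) (hi2.const_mul τ),
      intervalIntegral.integral_const_mul, intervalIntegral.integral_const_mul]
    have h3 := hτ k
    have h4 := h.integral_sp_mul_piece_pos k hN
    have h5 : M * (∫ x in (0 : ℝ)..N, -prim2 q x * piece γ k x) -
        τ * ∫ x in (0 : ℝ)..N, piece γ k x =
        sp P (c k) * ∫ x in (0 : ℝ)..N, |piece γ k x| ^ P := by linarith
    rw [h5]
    have h6 : θ * sp P (c k) < 1 := by
      have h7 : sp P (α * c k) ≤ 1 := by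
        have := (strictMono_sp hP).monotone (hαc k)
        rwa [sp_of_nonneg hP zero_le_one, Real.one_rpow] at this
      rw [sp_mul hP hα0.le] at h7
      have h8 : lam / M < 1 := (div_lt_one hM0).2 hM
      have h9 : 0 < lam / M := div_pos hlam hM0
      rw [hθ, mul_assoc]
      nlinarith
    nlinarith
  obtain ⟨x, hx⟩ := h.exists_alternating hmean
  have hxm : ∀ i < N, x i < x (i + 1) := by
    intro i hi
    have h3 := abs_lt.1 (hx i hi.le).2.1
    have h4 := abs_lt.1 (hx (i + 1) hi).2.1
    push_cast at h4
    linarith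
  obtain ⟨η, hη, hηm, hηs⟩ := exists_alternating_deriv2
    (F := fun x => θ * (M * (-prim2 q x) - τ) - sp P (γ x))
    (F' := fun x => θ * (M * (-∫ s in (0 : ℝ)..x, q s)) - ψ' x)
    (F'' := fun x => θ * (M * (-q x)) - (-(lam * sp P (φ x))))
    (fun x => ((((hasDerivAt_prim2 hqc x).neg.const_mul M).sub_const τ).const_mul θ).sub
      (h.deriv_ψ x))
    (fun x => (((hasDerivAt_primitive hqc x).neg.const_mul M).const_mul θ).sub (h.deriv_ψ' x))
    (L := N) (by simpa using h.ψ'_nat 0) (by rw [h1, h.ψ'_nat N]; simp) hN hxm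
    (fun i hi => (hx i hi).1) (fun i hi => (hx i hi).2.2)
  -- Since `sp P` is increasing, the alternation passes from `sp P (α * u) - sp P φ` to `α * u - φ`.
  have hz : ∀ i ≤ N, (-1) ^ i * (α * u (η i) - φ (η i)) < 0 := by
    intro i hi
    have h3 := hηs i hi
    have h4 : θ * (M * (-q (η i))) - (-(lam * sp P (φ (η i)))) =
        lam * (sp P (φ (η i)) - sp P (α * u (η i))) := by
      rw [sp_mul hP hα0.le]
      linear_combination (-q (η i)) * hθM
    rw [h4] at h3
    have hmono := strictMono_sp hP
    rcases neg_one_pow_eq_or ℝ i with h5 | h5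
    · rw [h5, one_mul] at h3 ⊢
      have h6 : sp P (α * u (η i)) < sp P (φ (η i)) := by
        linarith [pos_of_mul_pos_right h3 hlam.le]
      linarith [hmono.lt_iff_lt.1 h6]
    · rw [h5] at h3 ⊢
      have h6 : sp P (φ (η i)) < sp P (α * u (η i)) := by
        have : 0 < lam * (sp P (α * u (η i)) - sp P (φ (η i))) := by linarith
        linarith [pos_of_mul_pos_right this hlam.le]
      linarith [hmono.lt_iff_lt.1 h6]
  have hfin := h.one_sub_pos_of_alternating hN hαc (u := u)
    (u' := fun x => -∫ s in (0 : ℝ)..x, stepMul γ c s)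
    (fun x => (hasDerivAt_prim2 (hcs c) x).const_sub κ)
    (fun x => (hasDerivAt_primitive (hcs c) x).neg) (by simp) (by simp [hc]) hη hηm hz k₁
  rw [hα, inv_mul_cancel₀ hck.ne'] at hfin
  exact lt_irrefl _ hfin

end IsCosPair

/-! ### The extremal property of the step multiples. -/

namespace IsCosPair

variable {P lam : ℝ} {φ φ' γ ψ' : ℝ → ℝ} (h : IsCosPair P lam φ φ' γ ψ') {N : ℕ}
include h

lemma integral_stepMul (c : Fin (N + 1) → ℝ) (x : ℝ) :
    ∫ s in (0 : ℝ)..x, stepMul γ c s = ∑ k, c k * ∫ s in (0 : ℝ)..x, piece γ k s := by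
  simp only [stepMul]
  rw [intervalIntegral.integral_finsetSum]
  · simp only [intervalIntegral.integral_const_mul]
  · exact fun k _ => (continuous_const.mul (h.continuous_piece k)).intervalIntegrable _ _

lemma prim2_stepMul (c : Fin (N + 1) → ℝ) (x : ℝ) :
    prim2 (stepMul γ c) x = ∑ k, c k * prim2 (piece γ k) x := by
  simp only [prim2, h.integral_stepMul]
  rw [intervalIntegral.integral_finsetSum]
  · simp only [intervalIntegral.integral_const_mul]
  · exact fun k _ => (continuous_const.mul
      (continuous_primitive (h.continuous_piece k))).intervalIntegrable _ _

/-- Two differentiations give `stepMul γ c = 0` inside the interval, and each piece contains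
interior points where `γ ≠ 0`. This keeps the denominator of the quotient positive away from the
origin. -/
lemma eq_zero_of_prim2_eq (hN : 1 ≤ N) (c : Fin (N + 1) → ℝ) (κ : ℝ)
    (hz : ∀ x ∈ Icc (0 : ℝ) N, κ - prim2 (stepMul γ c) x = 0) : c = 0 ∧ κ = 0 := by
  have hN' : (1 : ℝ) ≤ N := by exact_mod_cast hN
  have hcs := h.continuous_stepMul c
  have hloc : ∀ {F F' : ℝ → ℝ}, (∀ x, HasDerivAt F (F' x) x) → (∀ x ∈ Ioo (0 : ℝ) N, F x = 0) →
      ∀ x ∈ Ioo (0 : ℝ) N, F' x = 0 := by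
    intro F F' hF h0 x hx
    refine (hF x).unique ((hasDerivAt_const x (0 : ℝ)).congr_of_eventuallyEq ?_)
    filter_upwards [isOpen_Ioo.mem_nhds hx] with y hy using h0 y hy
  have h1 := hloc (fun x => (hasDerivAt_prim2 hcs x).const_sub κ) (fun x hx => hz x ⟨hx.1.le, hx.2.le⟩)
  have h2 := hloc (fun x => (hasDerivAt_primitive hcs x).neg) h1
  constructor
  · ext k
    have hk : ((k : ℕ) : ℝ) ≤ N := by exact_mod_cast Nat.le_of_lt_succ k.2
    obtain ⟨x, hx, hxk⟩ : ∃ x ∈ Ioo (0 : ℝ) N, |x - (k : ℕ)| < 1 / 2 := by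
      rcases Nat.eq_zero_or_pos (k : ℕ) with h0 | h0
      · refine ⟨1 / 4, ⟨by norm_num, by linarith⟩, ?_⟩
        rw [h0, abs_lt]
        norm_num
      · have h1 : (1 : ℝ) ≤ (k : ℕ) := by exact_mod_cast h0
        refine ⟨(k : ℕ) - 1 / 4, ⟨by linarith, by linarith⟩, ?_⟩
        rw [abs_lt]
        constructor <;> linarith
    have h3 := h2 x hx
    rw [neg_eq_zero, h.stepMul_eq c k hxk] at h3
    have h4 := h.γ_sign k x hxk
    refine (mul_eq_zero.1 h3).resolve_right fun h5 => ?_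
    rw [h5, mul_zero] at h4
    exact lt_irrefl _ h4
  · have := hz 0 ⟨le_rfl, by linarith⟩
    rwa [prim2_zero, sub_zero] at this

/-- On the functions with `u'' = -(step function) γ` and `u' = 0` at the endpoints, the second
derivative is bounded by the function itself. -/
theorem integral_stepMul_rpow_le (hN : 1 ≤ N) (c : Fin (N + 1) → ℝ) (κ : ℝ)
    (hc : ∫ x in (0 : ℝ)..N, stepMul γ c x = 0) :
    ∫ x in (0 : ℝ)..N, |stepMul γ c x| ^ P ≤
      lam * ∫ x in (0 : ℝ)..N, |κ - prim2 (stepMul γ c) x| ^ P := by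
  by_contra! hcon
  have hP := h.one_lt
  have hlam := h.lam_pos
  have hN' : (0 : ℝ) ≤ N := by positivity
  have hpc : ∀ k, Continuous (piece γ k) := h.continuous_piece
  have habs := continuous_abs_rpow hP
  -- The pair `(c, κ)` parametrizes functions `u` with `u' 0 = 0`, and `W` encodes `u' N = 0`. The
  -- constant `κ` is left free so that varying it yields `∫ sp P u = 0`, which gives the second
  -- primitive of `sp P u` zero derivatives at both ends as well.
  let U : (Fin (N + 1) → ℝ) × ℝ → ℝ → ℝ := fun v x => v.2 - prim2 (stepMul γ v.1) x
  let m : Fin (N + 1) → ℝ := fun k => ∫ x in (0 : ℝ)..N, |piece γ k x| ^ P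
  let N1 : (Fin (N + 1) → ℝ) × ℝ → ℝ := fun v => ∫ x in (0 : ℝ)..N, |U v x| ^ P
  let N2 : (Fin (N + 1) → ℝ) × ℝ → ℝ := fun v => ∑ k, |v.1 k| ^ P * m k
  let W : Set ((Fin (N + 1) → ℝ) × ℝ) := {v | ∫ x in (0 : ℝ)..N, stepMul γ v.1 x = 0}
  have hUlin : ∀ (v e : (Fin (N + 1) → ℝ) × ℝ) (t x : ℝ), U (v + t • e) x = U v x + t * U e x := by
    intro v e t x
    simp only [U, h.prim2_stepMul, Prod.fst_add, Prod.snd_add, Prod.smul_fst, Prod.smul_snd,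
      Pi.add_apply, Pi.smul_apply, smul_eq_mul, add_mul, Finset.sum_add_distrib, mul_sub,
      Finset.mul_sum, mul_assoc]
    ring
  have hUsmul : ∀ (e : (Fin (N + 1) → ℝ) × ℝ) (t x : ℝ), U (t • e) x = t * U e x := by
    intro e t x
    have := hUlin 0 e t x
    rw [zero_add] at this
    rw [this]
    simp [U, h.prim2_stepMul]
  have hUc : ∀ v, Continuous (U v) := fun v =>
    continuous_const.sub (continuous_prim2 (h.continuous_stepMul v.1))
  have hN2eq : ∀ v, ∫ x in (0 : ℝ)..N, |stepMul γ v.1 x| ^ P = N2 v := by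
    intro v
    have h1 : ∫ x in (0 : ℝ)..N, |stepMul γ v.1 x| ^ P =
        ∫ x in (0 : ℝ)..N, ∑ k, |v.1 k| ^ P * |piece γ k x| ^ P := by
      refine intervalIntegral.integral_congr fun x hx => ?_
      rw [uIcc_of_le hN'] at hx
      exact h.abs_stepMul_rpow v.1 hx
    rw [h1, intervalIntegral.integral_finsetSum]
    · simp only [intervalIntegral.integral_const_mul, N2, m]
    · exact fun k _ => (continuous_const.mul (habs.comp (hpc k))).intervalIntegrable _ _
  have hN1pos : ∀ v, v ≠ 0 → 0 < N1 v := by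
    intro v hv
    have hN1 : (1 : ℝ) ≤ N := by exact_mod_cast hN
    obtain ⟨x, hx, hne⟩ : ∃ x ∈ Icc (0 : ℝ) N, U v x ≠ 0 := by
      by_contra! hz
      obtain ⟨h1, h2⟩ := h.eq_zero_of_prim2_eq hN v.1 v.2 hz
      exact hv (Prod.ext h1 h2)
    exact intervalIntegral.integral_pos (by linarith) (habs.comp (hUc v)).continuousOn
      (fun x _ => Real.rpow_nonneg (abs_nonneg _) _)
      ⟨x, hx, Real.rpow_pos_of_pos (abs_pos.2 hne) _⟩
  have hN1c : Continuous N1 := by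
    refine intervalIntegral.continuous_parametric_intervalIntegral_of_continuous' ?_ _ _
    refine habs.comp ?_
    simp only [U, h.prim2_stepMul]
    have hp2 : ∀ k, Continuous (prim2 (piece γ k)) := fun k => continuous_prim2 (hpc k)
    refine (continuous_snd.comp continuous_fst).sub (continuous_finsetSum _ fun k _ => ?_)
    exact ((continuous_apply k).comp (continuous_fst.comp continuous_fst)).mul
      ((hp2 k).comp continuous_snd)
  have hN2c : Continuous N2 := by
    refine continuous_finsetSum _ fun k _ => ?_
    exact (habs.comp ((continuous_apply k).comp continuous_fst)).mul continuous_const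
  have hWc : IsClosed W := by
    refine isClosed_eq ?_ continuous_const
    simp only [h.integral_stepMul]
    refine continuous_finsetSum _ fun k _ => ?_
    exact ((continuous_apply k).comp continuous_fst).mul continuous_const
  have hWadd : ∀ v ∈ W, ∀ e ∈ W, ∀ t : ℝ, v + t • e ∈ W := by
    intro v hv e he t
    simp only [W, mem_ofPred_eq, h.integral_stepMul] at hv he ⊢
    simp only [Prod.fst_add, Prod.smul_fst, Pi.add_apply, Pi.smul_apply, smul_eq_mul, add_mul,
      Finset.sum_add_distrib, hv, mul_assoc, ← Finset.mul_sum, he, mul_zero, add_zero]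
  have hW0 : (0 : (Fin (N + 1) → ℝ) × ℝ) ∈ W := by simp [W, h.integral_stepMul]
  have hWsmul : ∀ v ∈ W, ∀ t : ℝ, t • v ∈ W := fun v hv t => by
    have := hWadd 0 hW0 v hv t
    rwa [zero_add] at this
  have hN1smul : ∀ v (t : ℝ), N1 (t • v) = |t| ^ P * N1 v := by
    intro v t
    simp only [N1, hUsmul, abs_mul, Real.mul_rpow (abs_nonneg _) (abs_nonneg _),
      intervalIntegral.integral_const_mul]
  have hN2smul : ∀ v (t : ℝ), N2 (t • v) = |t| ^ P * N2 v := by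
    intro v t
    simp only [N2, Prod.smul_fst, Pi.smul_apply, smul_eq_mul, abs_mul,
      Real.mul_rpow (abs_nonneg _) (abs_nonneg _), Finset.mul_sum, mul_assoc]
  have hv₀ : ((c, κ) : (Fin (N + 1) → ℝ) × ℝ) ∈ W := hc
  have hcon' : lam * N1 (c, κ) < N2 (c, κ) := by
    rw [← hN2eq]
    exact hcon
  have hv₀0 : ((c, κ) : (Fin (N + 1) → ℝ) × ℝ) ≠ 0 := by
    intro h0
    rw [h0] at hcon'
    have h1 := hN1smul 0 0
    have h2 := hN2smul 0 0
    simp only [smul_zero, abs_zero, Real.zero_rpow (by linarith : P ≠ 0), zero_mul] at h1 h2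
    rw [h1, h2] at hcon'
    simp at hcon'
  -- The quotient is homogeneous of degree zero, so its maximum over the unit sphere of `W` is a
  -- maximum over all nonzero elements of `W`.
  have hS : IsCompact (Metric.sphere (0 : (Fin (N + 1) → ℝ) × ℝ) 1 ∩ W) := (isCompact_sphere _ _).inter_right hWc
  have hunit : ∀ v : (Fin (N + 1) → ℝ) × ℝ, v ≠ 0 → v ∈ W → ‖v‖⁻¹ • v ∈ Metric.sphere (0 : (Fin (N + 1) → ℝ) × ℝ) 1 ∩ W := by
    intro v hv hvW
    refine ⟨?_, hWsmul v hvW _⟩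
    rw [mem_sphere_zero_iff_norm, norm_smul, norm_inv, norm_norm,
      inv_mul_cancel₀ (norm_ne_zero_iff.2 hv)]
  obtain ⟨w, hw, hmax⟩ := hS.exists_isMaxOn ⟨_, hunit _ hv₀0 hv₀⟩
    (f := fun v => N2 v / N1 v) (hN2c.continuousOn.div hN1c.continuousOn fun v hv => by
      refine (hN1pos v ?_).ne'
      rintro rfl
      simpa using hv.1)
  have hw0 : w ≠ 0 := by
    rintro rfl
    simpa using hw.1
  set M := N2 w / N1 w with hM
  have hMle : ∀ v ∈ W, N2 v ≤ M * N1 v := by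
    intro v hv
    rcases eq_or_ne v 0 with rfl | hv0
    · have h1 := hN1smul 0 0
      have h2 := hN2smul 0 0
      simp only [smul_zero, abs_zero, Real.zero_rpow (by linarith : P ≠ 0), zero_mul] at h1 h2
      rw [h1, h2, mul_zero]
    · have h1 := hmax (hunit v hv0 hv)
      simp only [mem_ofPred_eq, hN1smul, hN2smul] at h1
      rw [mul_div_mul_left _ _ (Real.rpow_pos_of_pos (abs_pos.2
        (inv_ne_zero (norm_ne_zero_iff.2 hv0))) _).ne'] at h1
      exact (div_le_iff₀ (hN1pos v hv0)).1 h1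
  have hMlam : lam < M := by
    have h1 := hMle _ hv₀
    have h2 := hN1pos _ hv₀0
    by_contra! h3
    nlinarith
  have hcrit : ∀ v ∈ W, v ≠ 0 → N2 v = M * N1 v → ∀ k, v.1 k ≤ 0 := by
    intro v hv hv0 hveq
    have hEL : ∀ e ∈ W, M * ∫ x in (0 : ℝ)..N, sp P (U v x) * U e x =
        ∑ k, e.1 k * (sp P (v.1 k) * m k) := by
      intro e he
      -- `M * N1 - N2` is nonnegative on `W` and vanishes at `v`, so its derivative in every
      -- direction of `W` is zero.
      have hmin : IsLocalMin (fun t : ℝ => M * N1 (v + t • e) - N2 (v + t • e)) 0 := by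
        refine Eventually.of_forall fun t => ?_
        have h1 := hMle _ (hWadd v hv e he t)
        simp only [zero_smul, add_zero]
        linarith
      have hd1 : HasDerivAt (fun t : ℝ => N1 (v + t • e))
          (P * ∫ x in (0 : ℝ)..N, sp P (U v x) * U e x) 0 := by
        simp only [N1, hUlin]
        exact hasDerivAt_integral_abs_rpow hP (hUc v) (hUc e) 0 N
      have hd2 : HasDerivAt (fun t : ℝ => N2 (v + t • e))
          (∑ k, P * sp P (v.1 k) * e.1 k * m k) 0 := by
        simp only [N2]
        refine HasDerivAt.fun_sum fun k _ => HasDerivAt.mul_const ?_ _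
        have h1 : HasDerivAt (fun t : ℝ => (v + t • e).1 k) (e.1 k) 0 := by
          simp only [Prod.fst_add, Prod.smul_fst, Pi.add_apply, Pi.smul_apply, smul_eq_mul]
          simpa using ((hasDerivAt_id (0 : ℝ)).mul_const (e.1 k)).const_add (v.1 k)
        have h2 : HasDerivAt (fun t : ℝ => |t| ^ P) (P * sp P (v.1 k)) ((v + (0 : ℝ) • e).1 k) := by
          simpa using hasDerivAt_abs_rpow_sp hP (v.1 k)
        exact h2.comp 0 h1
      have h3 := hmin.hasDerivAt_eq_zero ((hd1.const_mul M).sub hd2)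
      have h4 : ∑ k, P * sp P (v.1 k) * e.1 k * m k = P * ∑ k, e.1 k * (sp P (v.1 k) * m k) := by
        rw [Finset.mul_sum]
        exact Finset.sum_congr rfl fun k _ => by ring
      rw [h4] at h3
      have h5 : P * (M * (∫ x in (0 : ℝ)..N, sp P (U v x) * U e x) -
        ∑ k, e.1 k * (sp P (v.1 k) * m k)) = 0 := by linarith
      exact sub_eq_zero.1 ((mul_eq_zero.1 h5).resolve_left (by linarith))
    refine h.nonpos_of_critical hN (κ := v.2) hMlam hv ?_ fun e he => ?_
    · have h1 := hEL (0, 1) hW0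
      have h2 : ∀ x, U ((0, 1) : (Fin (N + 1) → ℝ) × ℝ) x = 1 := fun x => by simp [U, h.prim2_stepMul]
      simp only [h2, mul_one, Pi.zero_apply, zero_mul, Finset.sum_const_zero] at h1
      exact (mul_eq_zero.1 h1).resolve_left (by linarith)
    · have h1 := hEL (e, 0) he
      simp only [U, zero_sub] at h1
      exact h1
  have hweq : N2 w = M * N1 w := by
    rw [hM, div_mul_cancel₀ _ (hN1pos w hw0).ne']
  have hle := hcrit w hw.2 hw0 hweq
  -- The maximizer `-w` has nonpositive coefficients too, so `w` has none of either sign; then `M =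
  -- 0`, against `lam < M`.
  have hge := hcrit ((-1 : ℝ) • w) (hWsmul w hw.2 _) (by simpa using hw0) (by
    rw [hN1smul, hN2smul, hweq]
    ring)
  have hzero : N2 w = 0 := by
    refine Finset.sum_eq_zero fun k _ => ?_
    have h1 : w.1 k = 0 := le_antisymm (hle k) (by simpa using hge k)
    rw [h1, abs_zero, Real.zero_rpow (by linarith), zero_mul]
  rw [hM, hzero, zero_div] at hMlam
  exact lt_asymm hMlam hlam

end IsCosPair

/-! ### The integral operator with kernel `min x y` -/

/-- The solution of `-u'' = w`, `u 0 = 0`, `u' h = 0` on `[0, h]`. -/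
def minOp (h : ℝ) (w : ℝ → ℝ) (x : ℝ) : ℝ := ∫ y in (0 : ℝ)..h, min x y * w y

section MinOp
variable {h : ℝ}

lemma continuous_minOp {w : ℝ → ℝ} (hw : Continuous w) : Continuous (minOp h w) := by
  refine intervalIntegral.continuous_parametric_intervalIntegral_of_continuous' ?_ _ _
  exact (continuous_fst.min continuous_snd).mul (hw.comp continuous_snd)

lemma minOp_nonneg (hh : 0 ≤ h) {w : ℝ → ℝ} (hw : ∀ x ∈ Icc 0 h, 0 ≤ w x) {x : ℝ} (hx : 0 ≤ x) :
    0 ≤ minOp h w x :=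
  intervalIntegral.integral_nonneg hh fun y hy => mul_nonneg (le_min hx hy.1) (hw y hy)

lemma minOp_zero (hh : 0 ≤ h) (w : ℝ → ℝ) : minOp h w 0 = 0 := by
  rw [minOp, intervalIntegral.integral_congr (g := fun _ => 0)]
  · simp
  · intro y hy
    rw [uIcc_of_le hh] at hy
    simp [min_eq_left hy.1]

lemma minOp_const_mul (c : ℝ) (w : ℝ → ℝ) (x : ℝ) :
    minOp h (fun y => c * w y) x = c * minOp h w x := by
  rw [minOp, minOp, ← intervalIntegral.integral_const_mul]
  exact intervalIntegral.integral_congr fun y _ => by ring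

lemma minOp_congr (hh : 0 ≤ h) {w v : ℝ → ℝ} (hwv : ∀ x ∈ Icc 0 h, w x = v x) (x : ℝ) :
    minOp h w x = minOp h v x := by
  refine intervalIntegral.integral_congr fun y hy => ?_
  rw [uIcc_of_le hh] at hy
  simp only [hwv y hy]

lemma integral_mul_minOp (hh : 0 ≤ h) {u w : ℝ → ℝ} (hu : Continuous u) (hw : Continuous w) :
    ∫ x in (0 : ℝ)..h, u x * minOp h w x = ∫ y in (0 : ℝ)..h, minOp h u y * w y := by
  have hc : Continuous (fun z : ℝ × ℝ => u z.1 * (min z.1 z.2 * w z.2)) := by fun_prop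
  have h1 := intervalIntegral_integral_swap (a := 0) (b := h) (μ := volume.restrict (Ioc 0 h))
    (f := fun x y => u x * (min x y * w y)) (by
      have h2 : IntegrableOn (fun z : ℝ × ℝ => u z.1 * (min z.1 z.2 * w z.2))
          (Icc 0 h ×ˢ Icc 0 h) (volume.prod volume) :=
        hc.continuousOn.integrableOn_compact (isCompact_Icc.prod isCompact_Icc)
      rw [uIoc_of_le hh, Measure.prod_restrict]
      exact h2.mono_set (prod_mono Ioc_subset_Icc_self Ioc_subset_Icc_self))
  simp only [minOp, ← intervalIntegral.integral_const_mul, ← intervalIntegral.integral_mul_const]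
  rw [intervalIntegral.integral_of_le (f := fun y => ∫ x in (0 : ℝ)..h, min y x * u x * w y) hh]
  simp only [intervalIntegral.integral_of_le hh] at h1 ⊢
  rw [h1]
  refine integral_congr_ae (ae_of_all _ fun y => integral_congr_ae (ae_of_all _ fun x => ?_))
  simp only [min_comm y x]
  ring

/-- The kernel is `1`-Lipschitz in its first variable. The bound keeps the normalized power step of
the maximizer inside a fixed Lipschitz class. -/
lemma minOp_sub_le (hh : 0 ≤ h) {w : ℝ → ℝ} (hw : Continuous w) (hw0 : ∀ x ∈ Icc 0 h, 0 ≤ w x)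
    (x y : ℝ) : |minOp h w x - minOp h w y| ≤ (∫ t in (0 : ℝ)..h, w t) * |x - y| := by
  have hi : ∀ x, IntervalIntegrable (fun t => min x t * w t) volume 0 h := fun x =>
    Continuous.intervalIntegrable (by fun_prop) _ _
  rw [minOp, minOp, ← intervalIntegral.integral_sub (hi x) (hi y),
    ← intervalIntegral.integral_mul_const]
  refine (intervalIntegral.abs_integral_le_integral_abs hh).trans
    (intervalIntegral.integral_mono_on hh (Continuous.intervalIntegrable (by fun_prop) _ _)
      (Continuous.intervalIntegrable (by fun_prop) _ _) fun t ht => ?_)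
  rw [← sub_mul, abs_mul, abs_of_nonneg (hw0 t ht), mul_comm]
  exact mul_le_mul_of_nonneg_left (abs_min_sub_min_le_max x t y t |>.trans (by simp)) (hw0 t ht)

lemma minOp_pos {w : ℝ → ℝ} (hw : Continuous w) (hw0 : ∀ x ∈ Icc 0 h, 0 ≤ w x)
    {y : ℝ} (hy : y ∈ Ioc 0 h) (hwy : w y ≠ 0) {x : ℝ} (hx : 0 < x) : 0 < minOp h w x := by
  have hh : 0 < h := hy.1.trans_le hy.2
  refine intervalIntegral.integral_pos hh (by fun_prop) (fun t ht =>
    mul_nonneg (le_min hx.le ht.1.le) (hw0 t ⟨ht.1.le, ht.2⟩)) ⟨y, ⟨hy.1.le, hy.2⟩, ?_⟩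
  exact mul_pos (lt_min hx hy.1) (lt_of_le_of_ne (hw0 y ⟨hy.1.le, hy.2⟩) hwy.symm)

end MinOp

/-! ### Hölder's and Young's inequalities -/

lemma holder_interval {P q : ℝ} (hPq : P.HolderConjugate q) {h : ℝ} (hh : 0 ≤ h) {u w : ℝ → ℝ}
    (hu : Continuous u) (hw : Continuous w) (hu0 : ∀ x ∈ Icc 0 h, 0 ≤ u x)
    (hw0 : ∀ x ∈ Icc 0 h, 0 ≤ w x) :
    ∫ x in (0 : ℝ)..h, u x * w x ≤
      (∫ x in (0 : ℝ)..h, u x ^ P) ^ (1 / P) * (∫ x in (0 : ℝ)..h, w x ^ q) ^ (1 / q) := by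
  simp only [intervalIntegral.integral_of_le hh]
  have hmem : ∀ {v : ℝ → ℝ} (r : ℝ≥0∞), Continuous v → MemLp v r (volume.restrict (Ioc 0 h)) := by
    intro v r hv
    obtain ⟨C, hC⟩ := isCompact_Icc.exists_bound_of_continuousOn (s := Icc 0 h) hv.continuousOn
    exact MemLp.of_bound hv.aestronglyMeasurable C
      ((ae_restrict_iff' measurableSet_Ioc).2 (ae_of_all _ fun x hx => hC x (Ioc_subset_Icc_self hx)))
  refine integral_mul_le_Lp_mul_Lq_of_nonneg hPq ?_ ?_ (hmem _ hu) (hmem _ hw)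
  · exact (ae_restrict_iff' measurableSet_Ioc).2 (ae_of_all _ fun x hx =>
      hu0 x (Ioc_subset_Icc_self hx))
  · exact (ae_restrict_iff' measurableSet_Ioc).2 (ae_of_all _ fun x hx =>
      hw0 x (Ioc_subset_Icc_self hx))

/-- The equality case of Young's inequality. -/
lemma eq_rpow_of_young_eq {P q : ℝ} (hPq : P.HolderConjugate q) {a b : ℝ} (ha : 0 ≤ a)
    (hb : 0 ≤ b) (hab : a ^ P / P + b ^ q / q - a * b = 0) : b = a ^ (P - 1) := by
  have hP := hPq.lt
  rcases ha.eq_or_lt with rfl | ha'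
  · rw [Real.zero_rpow (by linarith), zero_div, zero_mul, zero_add, sub_zero,
      div_eq_zero_iff, Real.rpow_eq_zero hb hPq.symm.ne_zero] at hab
    rw [Real.zero_rpow (by linarith)]
    exact hab.resolve_right hPq.symm.ne_zero
  -- The defect in Young's inequality is nonnegative near `a` and vanishes at `a`, so its derivative
  -- `a ^ (P - 1) - b` is zero.
  · have hmin : IsLocalMin (fun t : ℝ => t ^ P / P + b ^ q / q - t * b) a := by
      filter_upwards [lt_mem_nhds ha'] with t ht
      rw [hab]
      linarith [Real.young_inequality_of_nonneg ht.le hb hPq]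
    have hd : HasDerivAt (fun t : ℝ => t ^ P / P + b ^ q / q - t * b) (a ^ (P - 1) - b) a := by
      have h1 := ((Real.hasDerivAt_rpow_const (p := P) (Or.inl ha'.ne')).div_const P).add_const
        (b ^ q / q)
      have h2 := h1.sub ((hasDerivAt_id a).mul_const b)
      refine h2.congr_deriv ?_
      rw [mul_div_cancel_left₀ _ (by linarith), one_mul]
    linarith [hmin.hasDerivAt_eq_zero hd]

/-- The equality case of Hölder's inequality for continuous functions of norm one. -/
lemma eq_rpow_of_integral_mul_eq_one {P q : ℝ} (hPq : P.HolderConjugate q) {h : ℝ} (hh : 0 < h)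
    {u w : ℝ → ℝ} (hu : Continuous u) (hw : Continuous w) (hu0 : ∀ x ∈ Icc 0 h, 0 ≤ u x)
    (hw0 : ∀ x ∈ Icc 0 h, 0 ≤ w x) (hu1 : ∫ x in (0 : ℝ)..h, u x ^ P = 1)
    (hw1 : ∫ x in (0 : ℝ)..h, w x ^ q = 1) (huw : ∫ x in (0 : ℝ)..h, u x * w x = 1) :
    ∀ x ∈ Icc 0 h, w x = u x ^ (P - 1) := by
  have c1 : Continuous fun x => u x ^ P := hu.rpow_const fun _ => Or.inr hPq.nonneg
  have c2 : Continuous fun x => w x ^ q := hw.rpow_const fun _ => Or.inr hPq.symm.nonneg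
  have hnn : ∀ x ∈ Icc 0 h, 0 ≤ u x ^ P / P + w x ^ q / q - u x * w x := fun x hx =>
    sub_nonneg.2 (Real.young_inequality_of_nonneg (hu0 x hx) (hw0 x hx) hPq)
  have hc : Continuous fun x => u x ^ P / P + w x ^ q / q - u x * w x :=
    ((c1.div_const P).add (c2.div_const q)).sub (hu.mul hw)
  have hint : ∫ x in (0 : ℝ)..h, (u x ^ P / P + w x ^ q / q - u x * w x) = 0 := by
    rw [intervalIntegral.integral_sub, intervalIntegral.integral_add,
      intervalIntegral.integral_div, intervalIntegral.integral_div, hu1, hw1, huw]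
    · have := hPq.inv_add_inv_eq_one
      rw [one_div, one_div]
      linarith
    all_goals apply Continuous.intervalIntegrable; fun_prop
  intro x hx
  refine eq_rpow_of_young_eq hPq (hu0 x hx) (hw0 x hx) ?_
  by_contra hne
  exact (intervalIntegral.integral_pos hh hc.continuousOn
    (fun y hy => hnn y (Ioc_subset_Icc_self hy))
    ⟨x, hx, lt_of_le_of_ne (hnn x hx) (Ne.symm hne)⟩).ne' hint

/-! ### The power method and its fixed points. -/

section Ascent

variable {P q h : ℝ}

/-- The functional `∫ (T ψ^(1/(P-1)))^P`. -/
def quot (P h : ℝ) (ψ : ℝ → ℝ) : ℝ :=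
  ∫ x in (0 : ℝ)..h, minOp h (fun y => ψ y ^ (P - 1)⁻¹) x ^ P

/-- One step of the power method for maximizing `quot`. -/
def ascent (P h : ℝ) (ψ : ℝ → ℝ) : ℝ → ℝ :=
  minOp h fun x => minOp h (fun y => ψ y ^ (P - 1)⁻¹) x ^ (P - 1)

lemma conj_eq (hPq : P.HolderConjugate q) : q = P * (P - 1)⁻¹ := by
  rw [← div_eq_mul_inv]
  exact hPq.conjugate_eq

/-- The degree `P / (P - 1) = q` is also that of `∫ ψ ^ q`, so normalizing this integral to one
loses nothing. -/
lemma quot_const_mul (hPq : P.HolderConjugate q) {c : ℝ} (hc : 0 ≤ c) {ψ : ℝ → ℝ} (hh : 0 ≤ h)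
    (hψ : ∀ x ∈ Icc 0 h, 0 ≤ ψ x) : quot P h (fun x => c * ψ x) = c ^ q * quot P h ψ := by
  have hP := hPq.lt
  rw [quot, quot, ← intervalIntegral.integral_const_mul]
  refine intervalIntegral.integral_congr fun x hx => ?_
  rw [uIcc_of_le hh] at hx
  have h1 : minOp h (fun y => (c * ψ y) ^ (P - 1)⁻¹) x =
      c ^ (P - 1)⁻¹ * minOp h (fun y => ψ y ^ (P - 1)⁻¹) x := by
    rw [← minOp_const_mul]
    exact minOp_congr hh (fun y hy => Real.mul_rpow hc (hψ y hy)) x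
  have h2 : 0 ≤ minOp h (fun y => ψ y ^ (P - 1)⁻¹) x :=
    minOp_nonneg hh (fun y hy => Real.rpow_nonneg (hψ y hy) _) hx.1
  simp only [h1]
  rw [Real.mul_rpow (Real.rpow_nonneg hc _) h2, ← Real.rpow_mul hc, conj_eq hPq, mul_comm P]

variable (hPq : P.HolderConjugate q) (hh : 0 < h) {ψ : ℝ → ℝ} (hψ : Continuous ψ)
  (hψ0 : ∀ x ∈ Icc 0 h, 0 ≤ ψ x)
include hPq hψ

lemma continuous_rpow_inv : Continuous fun x => ψ x ^ (P - 1)⁻¹ :=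
  hψ.rpow_const fun _ => Or.inr (inv_nonneg.2 (by linarith [hPq.lt]))

lemma continuous_ascent : Continuous (ascent P h ψ) :=
  continuous_minOp ((continuous_minOp (continuous_rpow_inv hPq hψ)).rpow_const
    fun _ => Or.inr (by linarith [hPq.lt]))

include hψ0 hh

omit hPq hψ in
lemma ascent_nonneg {x : ℝ} (hx : 0 ≤ x) : 0 ≤ ascent P h ψ x :=
  minOp_nonneg hh.le (fun _ hy => Real.rpow_nonneg
    (minOp_nonneg hh.le (fun y hy => Real.rpow_nonneg (hψ0 y hy) _) hy.1) _) hx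

/-- Split `f ^ P = f ^ (P - 1) * f` with `f = minOp h (ψ ^ (P - 1)⁻¹)`, and move the operator in the
last factor to the first one by symmetry of the kernel. -/
lemma quot_eq_integral_ascent_mul :
    quot P h ψ = ∫ x in (0 : ℝ)..h, ψ x ^ (P - 1)⁻¹ * ascent P h ψ x := by
  have hP := hPq.lt
  have c1 := continuous_rpow_inv hPq hψ
  have c2 : Continuous fun x => minOp h (fun y => ψ y ^ (P - 1)⁻¹) x ^ (P - 1) :=
    (continuous_minOp c1).rpow_const fun _ => Or.inr (by linarith)
  rw [ascent, integral_mul_minOp hh.le c1 c2]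
  refine intervalIntegral.integral_congr fun x hx => ?_
  rw [uIcc_of_le hh.le] at hx
  have h2 : 0 ≤ minOp h (fun y => ψ y ^ (P - 1)⁻¹) x :=
    minOp_nonneg hh.le (fun y hy => Real.rpow_nonneg (hψ0 y hy) _) hx.1
  rw [← Real.rpow_one_add' h2 (by linarith), show 1 + (P - 1) = P by ring]

omit hψ in
lemma integral_rpow_inv_rpow :
    ∫ x in (0 : ℝ)..h, (ψ x ^ (P - 1)⁻¹) ^ P = ∫ x in (0 : ℝ)..h, ψ x ^ q := by
  refine intervalIntegral.integral_congr fun x hx => ?_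
  rw [uIcc_of_le hh.le] at hx
  rw [← Real.rpow_mul (hψ0 x hx), conj_eq hPq, mul_comm P]

/-- Hölder's inequality for the preceding pairing, whose first factor has norm one. -/
lemma quot_le_ascent (h1 : ∫ x in (0 : ℝ)..h, ψ x ^ q = 1) :
    quot P h ψ ≤ (∫ x in (0 : ℝ)..h, ascent P h ψ x ^ q) ^ (1 / q) := by
  rw [quot_eq_integral_ascent_mul hPq hh hψ hψ0]
  refine (holder_interval hPq hh.le (continuous_rpow_inv hPq hψ) (continuous_ascent hPq hψ)
    (fun x hx => Real.rpow_nonneg (hψ0 x hx) _)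
    (fun x hx => ascent_nonneg hh hψ0 hx.1)).trans_eq ?_
  rw [integral_rpow_inv_rpow hPq hh hψ0, h1, Real.one_rpow, one_mul]

/-- With `A = ascent P h ψ`, the integral of `A ^ q = A * A ^ (P - 1)⁻¹` is by symmetry a pairing of
`f ^ (P - 1)` with `minOp h (A ^ (P - 1)⁻¹)`, where `f = minOp h (ψ ^ (P - 1)⁻¹)`; Hölder's
inequality bounds it. Together with `quot_le_ascent` this shows that a normalized power step never
decreases `quot`. -/
lemma ascent_le_quot :
    (∫ x in (0 : ℝ)..h, ascent P h ψ x ^ q) ^ P ≤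
      quot P h ψ ^ (P - 1) * quot P h (ascent P h ψ) := by
  have hP := hPq.lt
  have c1 := continuous_rpow_inv hPq hψ
  have ca := continuous_ascent (h := h) hPq hψ
  have a0 : ∀ x ∈ Icc 0 h, 0 ≤ ascent P h ψ x := fun x hx => ascent_nonneg hh hψ0 hx.1
  have f0 : ∀ x ∈ Icc 0 h, 0 ≤ minOp h (fun y => ψ y ^ (P - 1)⁻¹) x := fun x hx =>
    minOp_nonneg hh.le (fun y hy => Real.rpow_nonneg (hψ0 y hy) _) hx.1
  have c2 : Continuous fun x => minOp h (fun y => ψ y ^ (P - 1)⁻¹) x ^ (P - 1) :=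
    (continuous_minOp c1).rpow_const fun _ => Or.inr (by linarith)
  have c3 := continuous_rpow_inv hPq ca
  have e1 : ∫ x in (0 : ℝ)..h, ascent P h ψ x ^ q =
      ∫ x in (0 : ℝ)..h, minOp h (fun y => ψ y ^ (P - 1)⁻¹) x ^ (P - 1) *
        minOp h (fun y => ascent P h ψ y ^ (P - 1)⁻¹) x := by
    rw [integral_mul_minOp hh.le c2 c3]
    refine intervalIntegral.integral_congr fun x hx => ?_
    rw [uIcc_of_le hh.le] at hx
    change ascent P h ψ x ^ q = ascent P h ψ x * ascent P h ψ x ^ (P - 1)⁻¹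
    have h2 : q = 1 + (P - 1)⁻¹ := by
      rw [conj_eq hPq]
      field_simp [(by linarith : P - 1 ≠ 0)]
      ring
    rw [h2, Real.rpow_one_add' (a0 x hx)]
    rw [← h2]
    exact hPq.symm.ne_zero
  have e2 := holder_interval hPq.symm hh.le c2 (continuous_minOp c3)
    (fun x hx => Real.rpow_nonneg (f0 x hx) _)
    (fun x hx => minOp_nonneg hh.le (fun y hy => Real.rpow_nonneg (a0 y hy) _) hx.1)
  have e3 : ∫ x in (0 : ℝ)..h, (minOp h (fun y => ψ y ^ (P - 1)⁻¹) x ^ (P - 1)) ^ q =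
      quot P h ψ := by
    refine intervalIntegral.integral_congr fun x hx => ?_
    rw [uIcc_of_le hh.le] at hx
    rw [← Real.rpow_mul (f0 x hx), conj_eq hPq]
    congr 1
    field_simp [(by linarith : P - 1 ≠ 0)]
  rw [← e1, e3, ← quot] at e2
  have q0 : 0 ≤ quot P h ψ := intervalIntegral.integral_nonneg hh.le fun x hx =>
    Real.rpow_nonneg (f0 x hx) _
  have q1 : 0 ≤ quot P h (ascent P h ψ) := intervalIntegral.integral_nonneg hh.le fun x hx =>
    Real.rpow_nonneg (minOp_nonneg hh.le (fun y hy => Real.rpow_nonneg (a0 y hy) _) hx.1) _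
  have s0 : 0 ≤ ∫ x in (0 : ℝ)..h, ascent P h ψ x ^ q :=
    intervalIntegral.integral_nonneg hh.le fun x hx => Real.rpow_nonneg (a0 x hx) _
  refine (Real.rpow_le_rpow s0 e2 hPq.nonneg).trans_eq ?_
  rw [Real.mul_rpow (Real.rpow_nonneg q0 _) (Real.rpow_nonneg q1 _), ← Real.rpow_mul q0,
    ← Real.rpow_mul q1, one_div_mul_cancel hPq.ne_zero, Real.rpow_one]
  congr 2
  rw [conj_eq hPq]
  field_simp [(by linarith : P - 1 ≠ 0)]

/-- At a maximizer of `quot` the power method stops. -/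
lemma ascent_eq_of_max (h1 : ∫ x in (0 : ℝ)..h, ψ x ^ q = 1) (hpos : 0 < quot P h ψ)
    (hmax : quot P h (fun x => (∫ x in (0 : ℝ)..h, ascent P h ψ x ^ q) ^ (-1 / q) *
      ascent P h ψ x) ≤ quot P h ψ) :
    ∀ x ∈ Icc 0 h, ascent P h ψ x = quot P h ψ * ψ x := by
  have hP := hPq.lt
  have hq := hPq.symm.pos
  have a0 : ∀ x ∈ Icc 0 h, 0 ≤ ascent P h ψ x := fun x hx => ascent_nonneg hh hψ0 hx.1
  have hA := quot_le_ascent hPq hh hψ hψ0 h1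
  have hB := ascent_le_quot hPq hh hψ hψ0
  have hC := quot_eq_integral_ascent_mul hPq hh hψ hψ0
  set ρ := quot P h ψ with hρ
  set s := ∫ x in (0 : ℝ)..h, ascent P h ψ x ^ q with hs
  have s0 : 0 ≤ s := intervalIntegral.integral_nonneg hh.le fun x hx => Real.rpow_nonneg (a0 x hx) _
  have spos : 0 < s := by
    refine s0.lt_of_ne fun h0 => ?_
    rw [← h0, Real.zero_rpow (by positivity)] at hA
    linarith
  rw [quot_const_mul hPq (Real.rpow_nonneg s0 _) hh.le a0, ← Real.rpow_mul s0,
    div_mul_cancel₀ _ hq.ne', Real.rpow_neg_one, inv_mul_le_iff₀ spos] at hmax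
  -- Maximality says `quot P h (ascent P h ψ) ≤ s * ρ`. Inserted in `hB` it gives `s ^ (P - 1) ≤ ρ ^
  -- P`, the reverse of `hA`, so Hölder's inequality is an equality.
  have hle : s ^ (1 / q) ≤ ρ := by
    have h2 : s ^ P ≤ ρ ^ P * s := by
      calc s ^ P ≤ ρ ^ (P - 1) * (s * ρ) := hB.trans (by gcongr)
        _ = ρ ^ P * s := by
          rw [show ρ ^ P = ρ ^ (P - 1 + 1) by ring_nf, Real.rpow_add_one hpos.ne']
          ring
    have h3 : s ^ (P - 1) ≤ ρ ^ P := by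
      rw [show s ^ P = s ^ (P - 1 + 1) by ring_nf, Real.rpow_add_one spos.ne'] at h2
      exact le_of_mul_le_mul_right h2 spos
    have h4 := Real.rpow_le_rpow (by positivity) h3 (inv_nonneg.2 hPq.nonneg)
    rw [← Real.rpow_mul s0, ← Real.rpow_mul hpos.le, mul_inv_cancel₀ hPq.ne_zero,
      Real.rpow_one] at h4
    convert h4 using 2
    rw [conj_eq hPq]
    field_simp
  have heq : s ^ (1 / q) = ρ := le_antisymm hle hA
  have hsq : s = ρ ^ q := by
    rw [← heq, ← Real.rpow_mul s0, one_div_mul_cancel hq.ne', Real.rpow_one]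
  have ca := continuous_ascent (h := h) hPq hψ
  have hfin := eq_rpow_of_integral_mul_eq_one hPq hh (u := fun x => ψ x ^ (P - 1)⁻¹)
    (w := fun x => ρ⁻¹ * ascent P h ψ x) (continuous_rpow_inv hPq hψ) (continuous_const.mul ca)
    (fun x hx => Real.rpow_nonneg (hψ0 x hx) _)
    (fun x hx => mul_nonneg (inv_nonneg.2 hpos.le) (a0 x hx))
    (by rw [integral_rpow_inv_rpow hPq hh hψ0, h1]) (by
      rw [intervalIntegral.integral_congr (g := fun x => (ρ ^ q)⁻¹ * ascent P h ψ x ^ q)]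
      · rw [intervalIntegral.integral_const_mul, ← hs, hsq]
        exact inv_mul_cancel₀ (Real.rpow_pos_of_pos hpos _).ne'
      · intro x hx
        rw [uIcc_of_le hh.le] at hx
        simp only
        rw [Real.mul_rpow (inv_nonneg.2 hpos.le) (a0 x hx), Real.inv_rpow hpos.le])
    (by
      have : ∀ x, ψ x ^ (P - 1)⁻¹ * (ρ⁻¹ * ascent P h ψ x) =
        ρ⁻¹ * (ψ x ^ (P - 1)⁻¹ * ascent P h ψ x) := fun x => by ring
      simp only [this]
      rw [intervalIntegral.integral_const_mul, ← hC]
      exact inv_mul_cancel₀ hpos.ne')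
  intro x hx
  have h2 := hfin x hx
  rw [← Real.rpow_mul (hψ0 x hx), inv_mul_cancel₀ (by linarith), Real.rpow_one,
    inv_mul_eq_iff_eq_mul₀ hpos.ne'] at h2
  exact h2

end Ascent

/-! ### Existence of a maximizer and of the half-interval eigenfunction. -/

section

open BoundedContinuousFunction

/-- The extension of a function on `[0, h]` by its end values. -/
def extendIcc {h : ℝ} (hh : 0 ≤ h) (f : Icc (0 : ℝ) h →ᵇ ℝ) : ℝ → ℝ := IccExtend hh f

lemma continuous_extendIcc {h : ℝ} (hh : 0 ≤ h) :
    Continuous fun z : (Icc (0 : ℝ) h →ᵇ ℝ) × ℝ => extendIcc hh z.1 z.2 := by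
  have h1 : Continuous fun z : (Icc (0 : ℝ) h →ᵇ ℝ) × ℝ => z.1 (projIcc 0 h hh z.2) :=
    continuous_eval.comp (continuous_fst.prodMk ((continuous_projIcc (h := hh)).comp continuous_snd))
  exact h1

/-- Arzelà–Ascoli: the common Lipschitz constant gives equicontinuity, and the zero at `0` confines
the values to `[0, K * h]`. -/
lemma isCompact_lipschitz {h : ℝ} (hh : 0 ≤ h) (K : ℝ≥0) :
    IsCompact {f : Icc (0 : ℝ) h →ᵇ ℝ | LipschitzWith K f ∧ f ⟨0, le_rfl, hh⟩ = 0 ∧ ∀ x, 0 ≤ f x} := by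
  have hev : ∀ x, Continuous fun f : Icc (0 : ℝ) h →ᵇ ℝ => f x := fun x => continuous_eval_const x
  refine arzela_ascoli₂ (Icc 0 (K * h)) isCompact_Icc _ ?_ ?_ ?_
  · have : {f : Icc (0 : ℝ) h →ᵇ ℝ | LipschitzWith K f ∧ f ⟨0, le_rfl, hh⟩ = 0 ∧ ∀ x, 0 ≤ f x} =
        (⋂ x, ⋂ y, {f : Icc (0 : ℝ) h →ᵇ ℝ | dist (f x) (f y) ≤ K * dist x y}) ∩
          ({f | f ⟨0, le_rfl, hh⟩ = 0} ∩ ⋂ x, {f : Icc (0 : ℝ) h →ᵇ ℝ | 0 ≤ f x}) := by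
      ext f
      simp only [mem_ofPred_eq, mem_inter_iff, mem_iInter, lipschitzWith_iff_dist_le_mul]
    rw [this]
    exact (isClosed_iInter fun x => isClosed_iInter fun y =>
        isClosed_le ((hev x).dist (hev y)) continuous_const).inter
      ((isClosed_eq (hev _) continuous_const).inter
        (isClosed_iInter fun x => isClosed_le continuous_const (hev x)))
  · rintro f x ⟨hL, h0, hnn⟩
    refine ⟨hnn x, ?_⟩
    have h1 := hL.dist_le_mul x ⟨0, le_rfl, hh⟩
    rw [h0, Real.dist_0_eq_abs, Subtype.dist_eq, Real.dist_0_eq_abs, abs_of_nonneg x.2.1] at h1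
    exact (le_abs_self _).trans (h1.trans (mul_le_mul_of_nonneg_left x.2.2 K.2))
  · refine Metric.equicontinuous_of_continuity_modulus (fun d => K * d) ?_ _ ?_
    · have : Tendsto (fun d : ℝ => (K : ℝ) * d) (𝓝 0) (𝓝 (K * 0)) :=
        (continuous_const.mul continuous_id).tendsto 0
      simpa using this
    · rintro x y ⟨f, hf⟩
      exact hf.1.dist_le_mul x y

/-- The functional and the normalization are continuous for uniform convergence, so the constraint
survives in the limit. Competition is restricted to the Lipschitz constant `K`, which must therefore
be chosen so large that the power step of the maximizer is still a competitor. -/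
lemma exists_maximizer {P q h : ℝ} (hPq : P.HolderConjugate q) (hh : 0 < h) (K : ℝ≥0)
    {ψ₀ : ℝ → ℝ} (hL : LipschitzWith K ψ₀) (h0 : ψ₀ 0 = 0) (hnn : ∀ x ∈ Icc 0 h, 0 ≤ ψ₀ x)
    (h1 : ∫ x in (0 : ℝ)..h, ψ₀ x ^ q = 1) :
    ∃ ψ : ℝ → ℝ, Continuous ψ ∧ ψ 0 = 0 ∧ (∀ x ∈ Icc 0 h, 0 ≤ ψ x) ∧
      ∫ x in (0 : ℝ)..h, ψ x ^ q = 1 ∧ ∀ χ : ℝ → ℝ, LipschitzWith K χ → χ 0 = 0 →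
        (∀ x ∈ Icc 0 h, 0 ≤ χ x) → ∫ x in (0 : ℝ)..h, χ x ^ q = 1 → quot P h χ ≤ quot P h ψ := by
  have hP := hPq.lt
  have hq := hPq.symm.pos
  have hce := continuous_extendIcc hh.le
  let toB : (χ : ℝ → ℝ) → Continuous χ → (Icc (0 : ℝ) h →ᵇ ℝ) := fun χ hχ =>
    mkOfCompact ⟨fun x => χ x, hχ.comp continuous_subtype_val⟩
  have hext : ∀ (χ : ℝ → ℝ) (hχ : Continuous χ), ∀ x ∈ Icc 0 h, extendIcc hh.le (toB χ hχ) x = χ x :=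
    fun χ hχ x hx => IccExtend_of_mem hh.le _ hx
  have hqc : Continuous fun f : Icc (0 : ℝ) h →ᵇ ℝ => quot P h (extendIcc hh.le f) := by
    refine intervalIntegral.continuous_parametric_intervalIntegral_of_continuous' ?_ _ _
    refine Continuous.rpow_const ?_ fun _ => Or.inr hPq.nonneg
    refine intervalIntegral.continuous_parametric_intervalIntegral_of_continuous' ?_ _ _
    refine ((continuous_snd.comp continuous_fst).min continuous_snd).mul
      (Continuous.rpow_const ?_ fun _ => Or.inr (inv_nonneg.2 (by linarith)))
    exact hce.comp ((continuous_fst.comp continuous_fst).prodMk continuous_snd)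
  have hnc : Continuous fun f : Icc (0 : ℝ) h →ᵇ ℝ =>
      ∫ x in (0 : ℝ)..h, extendIcc hh.le f x ^ q := by
    refine intervalIntegral.continuous_parametric_intervalIntegral_of_continuous' ?_ _ _
    exact hce.rpow_const fun _ => Or.inr hq.le
  have hcomp := (isCompact_lipschitz hh.le K).inter_right
    (isClosed_eq hnc continuous_const : IsClosed {f | ∫ x in (0 : ℝ)..h, extendIcc hh.le f x ^ q = 1})
  have hmem : ∀ (χ : ℝ → ℝ) (hχ : LipschitzWith K χ), χ 0 = 0 → (∀ x ∈ Icc 0 h, 0 ≤ χ x) →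
      ∫ x in (0 : ℝ)..h, χ x ^ q = 1 → toB χ hχ.continuous ∈
        {f : Icc (0 : ℝ) h →ᵇ ℝ | LipschitzWith K f ∧ f ⟨0, le_rfl, hh.le⟩ = 0 ∧ ∀ x, 0 ≤ f x} ∩
        {f | ∫ x in (0 : ℝ)..h, extendIcc hh.le f x ^ q = 1} := by
    intro χ hχ h2 h3 h4
    refine ⟨⟨?_, h2, fun x => h3 x x.2⟩, ?_⟩
    · exact LipschitzWith.of_dist_le_mul fun x y => hχ.dist_le_mul x y
    · refine Eq.trans (intervalIntegral.integral_congr fun x hx => ?_) h4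
      rw [uIcc_of_le hh.le] at hx
      simp only [hext χ hχ.continuous x hx]
  obtain ⟨f, hf, hmax⟩ := hcomp.exists_isMaxOn ⟨_, hmem ψ₀ hL h0 hnn h1⟩ hqc.continuousOn
  refine ⟨extendIcc hh.le f, hce.comp (continuous_const.prodMk continuous_id), ?_, ?_, hf.2, ?_⟩
  · rw [extendIcc, IccExtend_of_mem hh.le _ ⟨le_rfl, hh.le⟩]
    exact hf.1.2.1
  · intro x hx
    rw [extendIcc, IccExtend_of_mem hh.le _ hx]
    exact hf.1.2.2 _
  · intro χ hχ h2 h3 h4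
    refine le_of_eq_of_le ?_ (hmax (hmem χ hχ h2 h3 h4))
    refine intervalIntegral.integral_congr fun x _ => ?_
    congr 1
    exact minOp_congr hh.le (fun y hy => by rw [hext χ hχ.continuous y hy]) x

/-- Existence of a positive solution of the eigenvalue problem on half of the interval. -/
theorem exists_halfEigen {P h : ℝ} (hP : 1 < P) (hh : 0 < h) :
    ∃ (ρ : ℝ) (g : ℝ → ℝ), 0 < ρ ∧ Continuous g ∧ g 0 = 0 ∧ (∀ x ∈ Ioc 0 h, 0 < g x) ∧
      ∀ x ∈ Icc 0 h, minOp h (fun y => minOp h g y ^ (P - 1)) x = ρ * g x ^ (P - 1) := by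
  obtain ⟨q, hPq⟩ : ∃ q, P.HolderConjugate q := ⟨_, Real.HolderConjugate.conjExponent hP⟩
  have hq := hPq.symm.pos
  have hquot0 : ∀ {ψ : ℝ → ℝ}, (∀ x ∈ Icc 0 h, 0 ≤ ψ x) → ∀ x ∈ Icc 0 h,
      0 ≤ minOp h (fun y => ψ y ^ (P - 1)⁻¹) x := fun hψ x hx =>
    minOp_nonneg hh.le (fun y hy => Real.rpow_nonneg (hψ y hy) _) hx.1
  have hex : ∀ {ψ : ℝ → ℝ}, ψ 0 = 0 → ∫ x in (0 : ℝ)..h, ψ x ^ q = 1 → ∃ y ∈ Ioc 0 h, ψ y ≠ 0 := by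
    intro ψ h0 h1
    by_contra! hcon
    rw [intervalIntegral.integral_congr (g := fun _ => 0)] at h1
    · simp at h1
    · intro x hx
      rw [uIcc_of_le hh.le] at hx
      have : ψ x = 0 := by
        rcases hx.1.eq_or_lt with rfl | h2
        · exact h0
        · exact hcon x ⟨h2, hx.2⟩
      simp only [this, Real.zero_rpow hq.ne']
  have hqpos : ∀ {ψ : ℝ → ℝ}, Continuous ψ → ψ 0 = 0 → (∀ x ∈ Icc 0 h, 0 ≤ ψ x) →
      ∫ x in (0 : ℝ)..h, ψ x ^ q = 1 → 0 < quot P h ψ := by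
    intro ψ hc h0 hnn h1
    obtain ⟨y, hy, hne⟩ := hex h0 h1
    have cr := continuous_rpow_inv hPq hc
    refine intervalIntegral.integral_pos hh
      ((continuous_minOp cr).rpow_const fun _ => Or.inr hPq.nonneg).continuousOn
      (fun x hx => Real.rpow_nonneg (hquot0 hnn x ⟨hx.1.le, hx.2⟩) _) ⟨h, ⟨hh.le, le_rfl⟩, ?_⟩
    refine Real.rpow_pos_of_pos (minOp_pos cr (fun y hy => Real.rpow_nonneg (hnn y hy) _) hy ?_ hh) _
    exact (Real.rpow_pos_of_pos (lt_of_le_of_ne (hnn y ⟨hy.1.le, hy.2⟩) hne.symm) _).ne'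
  -- a Lipschitz competitor
  have hI : 0 < ∫ x in (0 : ℝ)..h, x ^ q :=
    intervalIntegral.integral_pos hh (continuous_id.rpow_const fun _ => Or.inr hq.le).continuousOn
      (fun x hx => Real.rpow_nonneg hx.1.le _) ⟨h, ⟨hh.le, le_rfl⟩, Real.rpow_pos_of_pos hh _⟩
  set c := (∫ x in (0 : ℝ)..h, x ^ q) ^ (-1 / q) with hc
  have hc0 : 0 < c := Real.rpow_pos_of_pos hI _
  have hcI : ∫ x in (0 : ℝ)..h, (c * x) ^ q = 1 := by
    rw [intervalIntegral.integral_congr (g := fun x => c ^ q * x ^ q)]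
    · rw [intervalIntegral.integral_const_mul, hc, ← Real.rpow_mul hI.le, div_mul_cancel₀ _ hq.ne',
        Real.rpow_neg_one, inv_mul_cancel₀ hI.ne']
    · intro x hx
      rw [uIcc_of_le hh.le] at hx
      exact Real.mul_rpow hc0.le hx.1
  have hcnn : ∀ x ∈ Icc 0 h, 0 ≤ c * x := fun x hx => mul_nonneg hc0.le hx.1
  have hρ₀ := hqpos (ψ := fun x => c * x) (by fun_prop) (by simp) hcnn hcI
  set ρ₀ := quot P h fun x => c * x with hρ₀d
  -- `D` bounds the Lipschitz constant of the normalized power step of the maximizer. The integrand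
  -- of `ascent` has integral at most `h * (h * (h + 1)) ^ (P - 1)`, and the normalizing factor is
  -- at most `ρ₀⁻¹` because the maximum is at least the value `ρ₀` of the linear competitor.
  set D := h * (h * (h + 1)) ^ (P - 1) / ρ₀ with hD
  have hD0 : 0 ≤ D := by positivity
  have hlin : ∀ (d : ℝ≥0), (d : ℝ) = c → LipschitzWith (d ⊔ D.toNNReal) fun x : ℝ => c * x := by
    intro d hd
    refine LipschitzWith.weaken (LipschitzWith.of_dist_le_mul fun x y => ?_) le_sup_left
    rw [Real.dist_eq, Real.dist_eq, ← mul_sub, abs_mul, abs_of_pos hc0, hd]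
  obtain ⟨ψ, hψc, hψ0, hψnn, hψ1, hmax⟩ := exists_maximizer hPq hh (⟨c, hc0.le⟩ ⊔ D.toNNReal)
    (hlin ⟨c, hc0.le⟩ rfl) (by simp) hcnn hcI
  have hge : ρ₀ ≤ quot P h ψ := hmax _ (hlin ⟨c, hc0.le⟩ rfl) (by simp) hcnn hcI
  have hρ : 0 < quot P h ψ := hρ₀.trans_le hge
  have cr := continuous_rpow_inv hPq hψc
  have hwnn : ∀ x ∈ Icc 0 h, 0 ≤ ψ x ^ (P - 1)⁻¹ := fun x hx => Real.rpow_nonneg (hψnn x hx) _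
  have ca := continuous_ascent (h := h) hPq hψc
  have a0 : ∀ x ∈ Icc 0 h, 0 ≤ ascent P h ψ x := fun x hx => ascent_nonneg hh hψnn hx.1
  have hA := quot_le_ascent hPq hh hψc hψnn hψ1
  set s := ∫ x in (0 : ℝ)..h, ascent P h ψ x ^ q with hs
  have s0 : 0 ≤ s := intervalIntegral.integral_nonneg hh.le fun x hx => Real.rpow_nonneg (a0 x hx) _
  have spos : 0 < s := by
    refine s0.lt_of_ne fun h0 => ?_
    rw [← h0, Real.zero_rpow (by positivity)] at hA
    linarith
  have hfc := continuous_minOp (h := h) cr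
  have hf_le : ∀ x ∈ Icc 0 h, minOp h (fun y => ψ y ^ (P - 1)⁻¹) x ≤ h * (h + 1) := by
    intro x hx
    -- Pointwise `t ^ (P - 1)⁻¹ ≤ 1 + t ^ q` for `t ≥ 0`, by comparing exponents when `t ≥ 1`; the
    -- integral of `ψ ^ q` is one.
    have h2 : ∫ y in (0 : ℝ)..h, ψ y ^ (P - 1)⁻¹ ≤ h + 1 := by
      have h3 : ∫ y in (0 : ℝ)..h, (1 + ψ y ^ q) = h + 1 := by
        rw [intervalIntegral.integral_add, hψ1]
        · simp
        · simp
        · exact (hψc.rpow_const fun _ => Or.inr hq.le).intervalIntegrable _ _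
      rw [← h3]
      refine intervalIntegral.integral_mono_on hh.le (cr.intervalIntegrable _ _)
        (Continuous.intervalIntegrable (continuous_const.add
          (hψc.rpow_const fun _ => Or.inr hq.le)) _ _) fun y hy => ?_
      rcases le_total (ψ y) 1 with h4 | h4
      · have h5 := Real.rpow_le_one (hψnn y hy) h4 (z := (P - 1)⁻¹)
          (inv_nonneg.2 (by linarith))
        have h6 := Real.rpow_nonneg (hψnn y hy) q
        linarith
      · have h5 : ψ y ^ (P - 1)⁻¹ ≤ ψ y ^ q := by
          refine Real.rpow_le_rpow_of_exponent_le h4 ?_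
          rw [conj_eq hPq]
          exact le_mul_of_one_le_left (inv_nonneg.2 (by linarith)) hP.le
        linarith
    calc minOp h (fun y => ψ y ^ (P - 1)⁻¹) x ≤ ∫ y in (0 : ℝ)..h, h * ψ y ^ (P - 1)⁻¹ := by
          refine intervalIntegral.integral_mono_on hh.le
            (((continuous_const.min continuous_id).mul cr).intervalIntegrable _ _)
            ((continuous_const.mul cr).intervalIntegrable _ _) fun y hy => ?_
          exact mul_le_mul_of_nonneg_right ((min_le_left _ _).trans hx.2) (hwnn y hy)
      _ ≤ h * (h + 1) := by
          rw [intervalIntegral.integral_const_mul]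
          exact mul_le_mul_of_nonneg_left h2 hh.le
  have hf0 := hquot0 hψnn
  have hrc : Continuous fun x => minOp h (fun y => ψ y ^ (P - 1)⁻¹) x ^ (P - 1) :=
    hfc.rpow_const fun _ => Or.inr (by linarith)
  have hint : ∫ x in (0 : ℝ)..h, minOp h (fun y => ψ y ^ (P - 1)⁻¹) x ^ (P - 1) ≤
      h * (h * (h + 1)) ^ (P - 1) := by
    have h3 : ∫ _ in (0 : ℝ)..h, (h * (h + 1)) ^ (P - 1) = h * (h * (h + 1)) ^ (P - 1) := by simp
    rw [← h3]
    exact intervalIntegral.integral_mono_on hh.le (hrc.intervalIntegrable _ _) (by simp)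
      fun x hx => Real.rpow_le_rpow (hf0 x hx) (hf_le x hx) (by linarith)
  have hnorm : s ^ (-1 / q) ≤ ρ₀⁻¹ := by
    rw [neg_div, Real.rpow_neg s0]
    exact inv_anti₀ hρ₀ (hge.trans hA)
  have hasc := ascent_eq_of_max hPq hh hψc hψnn hψ1 hρ (hmax _ (by
      refine LipschitzWith.weaken (K := D.toNNReal) (LipschitzWith.of_dist_le_mul fun x y => ?_)
        le_sup_right
      rw [Real.dist_eq, Real.dist_eq, ← mul_sub, abs_mul, abs_of_nonneg (Real.rpow_nonneg s0 _),
        Real.coe_toNNReal _ hD0]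
      have h4 := minOp_sub_le hh.le hrc (fun x hx => Real.rpow_nonneg (hf0 x hx) _) x y
      calc s ^ (-1 / q) * |ascent P h ψ x - ascent P h ψ y| ≤
          ρ₀⁻¹ * ((h * (h * (h + 1)) ^ (P - 1)) * |x - y|) := by
            refine mul_le_mul hnorm (h4.trans ?_) (abs_nonneg _) (inv_nonneg.2 hρ₀.le)
            exact mul_le_mul_of_nonneg_right hint (abs_nonneg _)
        _ = D * |x - y| := by
            rw [hD]
            ring)
    (by rw [ascent, minOp_zero hh.le, mul_zero])
    (fun x hx => mul_nonneg (Real.rpow_nonneg s0 _) (a0 x hx)) (by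
      rw [intervalIntegral.integral_congr (g := fun x => s⁻¹ * ascent P h ψ x ^ q)]
      · rw [intervalIntegral.integral_const_mul, ← hs, inv_mul_cancel₀ spos.ne']
      · intro x hx
        rw [uIcc_of_le hh.le] at hx
        simp only
        rw [Real.mul_rpow (Real.rpow_nonneg s0 _) (a0 x hx), ← Real.rpow_mul s0,
          div_mul_cancel₀ _ hq.ne', Real.rpow_neg_one]))
  have hrr : ∀ x ∈ Icc 0 h, (ψ x ^ (P - 1)⁻¹) ^ (P - 1) = ψ x := fun x hx => by
    rw [← Real.rpow_mul (hψnn x hx), inv_mul_cancel₀ (by linarith), Real.rpow_one]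
  refine ⟨quot P h ψ, fun x => ψ x ^ (P - 1)⁻¹, hρ, cr, ?_, fun x hx => ?_, fun x hx => ?_⟩
  · simp only [hψ0]
    exact Real.zero_rpow (inv_ne_zero (by linarith))
  · have hx' : x ∈ Icc 0 h := ⟨hx.1.le, hx.2⟩
    refine Real.rpow_pos_of_pos ?_ _
    obtain ⟨y, hy, hne⟩ := hex hψ0 hψ1
    have hwy : ψ y ^ (P - 1)⁻¹ ≠ 0 :=
      (Real.rpow_pos_of_pos (lt_of_le_of_ne (hψnn y ⟨hy.1.le, hy.2⟩) hne.symm) _).ne'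
    have hfp : ∀ z, 0 < z → 0 < minOp h (fun y => ψ y ^ (P - 1)⁻¹) z := fun z hz =>
      minOp_pos cr hwnn hy hwy hz
    have hap : 0 < ascent P h ψ x := minOp_pos hrc (fun z hz => Real.rpow_nonneg (hf0 z hz) _)
      (y := h) ⟨hh, le_rfl⟩ (Real.rpow_pos_of_pos (hfp h hh) _).ne' hx.1
    rw [hasc x hx'] at hap
    exact pos_of_mul_pos_right hap hρ.le
  · rw [hrr x hx, ← hasc x hx]
    rfl

end

/-! ### Extension by reflection -/

/-- Functions that are odd about `0` and even about `1 / 2`. -/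
structure IsSineLike (u : ℝ → ℝ) : Prop where
  continuous : Continuous u
  neg : ∀ x, u (-x) = -u x
  one_sub : ∀ x, u (1 - x) = u x

namespace IsSineLike
variable {u v : ℝ → ℝ}

lemma add_one (hu : IsSineLike u) (x : ℝ) : u (x + 1) = -u x := by
  rw [← hu.neg, ← hu.one_sub (-x)]
  congr 1
  ring

lemma zero (hu : IsSineLike u) : u 0 = 0 := by
  have := hu.neg 0
  rw [neg_zero] at this
  linarith

/-- The symmetries make `|u - v|` periodic with period `1`, and the period `[-1 / 2, 1 / 2)` is
covered by `[0, 1 / 2]` and its mirror image. -/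
lemma eq_of_eqOn (hu : IsSineLike u) (hv : IsSineLike v) (huv : ∀ x ∈ Icc (0 : ℝ) (1 / 2), u x = v x) :
    u = v := by
  have hper : Function.Periodic (fun x => |u x - v x|) 1 := fun x => by
    simp only [hu.add_one, hv.add_one]
    rw [← abs_neg]
    congr 1
    ring
  ext x
  obtain ⟨y, hy, hxy⟩ := hper.exists_mem_Ico one_pos x (-1 / 2)
  have hy0 : |u y - v y| = 0 := by
    rcases le_total 0 y with h | h
    · rw [huv y ⟨h, by linarith [hy.2]⟩, sub_self, abs_zero]
    · have := huv (-y) ⟨by linarith, by linarith [hy.1]⟩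
      rw [hu.neg, hv.neg, neg_inj] at this
      rw [this, sub_self, abs_zero]
  simp only [hy0] at hxy
  exact sub_eq_zero.1 (abs_eq_zero.1 hxy)

lemma sp_comp (hu : IsSineLike u) {P : ℝ} (hP : 1 < P) : IsSineLike fun x => sp P (u x) where
  continuous := (continuous_sp hP).comp hu.continuous
  neg x := by rw [hu.neg, sp_neg]
  one_sub x := by rw [hu.one_sub]

lemma const_mul (hu : IsSineLike u) (c : ℝ) : IsSineLike fun x => c * u x where
  continuous := continuous_const.mul hu.continuous
  neg x := by rw [hu.neg, mul_neg]
  one_sub x := by rw [hu.one_sub]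

end IsSineLike

/-- The primitive of `-u` that vanishes at `1 / 2`. -/
def primHalf (u : ℝ → ℝ) (x : ℝ) : ℝ := ∫ s in x..(1 / 2), u s

/-- The solution of `-f'' = u`, `f 0 = 0`, `f' (1 / 2) = 0`. -/
def solve (u : ℝ → ℝ) (x : ℝ) : ℝ := ∫ t in (0 : ℝ)..x, primHalf u t

section Solve
variable {u : ℝ → ℝ}

lemma hasDerivAt_primHalf (hu : Continuous u) (x : ℝ) : HasDerivAt (primHalf u) (-u x) x :=
  intervalIntegral.integral_hasDerivAt_left (hu.intervalIntegrable _ _)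
    (hu.stronglyMeasurableAtFilter _ _) hu.continuousAt

lemma continuous_primHalf (hu : Continuous u) : Continuous (primHalf u) :=
  continuous_iff_continuousAt.2 fun x => (hasDerivAt_primHalf hu x).continuousAt

lemma hasDerivAt_solve (hu : Continuous u) (x : ℝ) : HasDerivAt (solve u) (primHalf u x) x :=
  hasDerivAt_primitive (continuous_primHalf hu) x

lemma primHalf_neg (hu : IsSineLike u) (x : ℝ) : primHalf u (-x) = primHalf u x := by
  have hi : ∀ a b, IntervalIntegrable u volume a b := fun a b => hu.continuous.intervalIntegrable a b
  have h1 : ∫ s in (-x)..x, u s = 0 := by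
    have h2 := intervalIntegral.integral_comp_neg (a := -x) (b := x) u
    simp only [hu.neg, neg_neg, intervalIntegral.integral_neg] at h2
    linarith
  rw [primHalf, primHalf, ← intervalIntegral.integral_add_adjacent_intervals (hi (-x) x) (hi _ _),
    h1, zero_add]

lemma primHalf_one_sub (hu : IsSineLike u) (x : ℝ) : primHalf u (1 - x) = -primHalf u x := by
  have h2 := intervalIntegral.integral_comp_sub_left (a := x) (b := 1 / 2) u 1
  simp only [hu.one_sub] at h2
  rw [primHalf, primHalf, h2, show (1 : ℝ) - 1 / 2 = 1 / 2 by norm_num,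
    intervalIntegral.integral_symm]

lemma primHalf_half : primHalf u (1 / 2) = 0 := intervalIntegral.integral_same

lemma isSineLike_solve (hu : IsSineLike u) : IsSineLike (solve u) where
  continuous := continuous_primitive (continuous_primHalf hu.continuous)
  neg x := by
    have h2 := intervalIntegral.integral_comp_neg (a := 0) (b := x) (primHalf u)
    simp only [primHalf_neg hu, neg_zero] at h2
    rw [solve, solve, h2, intervalIntegral.integral_symm]
  one_sub x := by
    have hi : ∀ a b, IntervalIntegrable (primHalf u) volume a b := fun a b =>
      (continuous_primHalf hu.continuous).intervalIntegrable a b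
    have h2 := intervalIntegral.integral_comp_sub_left (a := x) (b := 1 - x) (primHalf u) 1
    simp only [primHalf_one_sub hu, sub_sub_cancel, intervalIntegral.integral_neg] at h2
    rw [solve, solve, ← intervalIntegral.integral_add_adjacent_intervals (hi 0 x) (hi x (1 - x))]
    linarith

/-- One integration by parts turns the iterated integral into the kernel `min x y`. -/
lemma solve_eq_minOp (hu : Continuous u) {x : ℝ} (hx : x ∈ Icc (0 : ℝ) (1 / 2)) :
    solve u x = minOp (1 / 2) u x := by
  have hp := continuous_primHalf hu
  have h1 := intervalIntegral.integral_mul_deriv_eq_deriv_mul (a := 0) (b := x)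
    (u := primHalf u) (u' := fun t => -u t) (v := fun t => t) (v' := fun _ => 1)
    (fun t _ => hasDerivAt_primHalf hu t) (fun t _ => hasDerivAt_id t)
    (hu.neg.intervalIntegrable _ _) (by simp)
  have hc : Continuous fun y => min x y * u y := by fun_prop
  have h2 : ∫ y in (0 : ℝ)..x, min x y * u y = ∫ y in (0 : ℝ)..x, u y * y := by
    refine intervalIntegral.integral_congr fun y hy => ?_
    rw [uIcc_of_le hx.1] at hy
    simp only [min_eq_right hy.2, mul_comm]
  have h3 : ∫ y in x..(1 / 2), min x y * u y = x * primHalf u x := by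
    rw [primHalf, ← intervalIntegral.integral_const_mul]
    refine intervalIntegral.integral_congr fun y hy => ?_
    rw [uIcc_of_le hx.2] at hy
    simp only [min_eq_left hy.1]
  rw [minOp, ← intervalIntegral.integral_add_adjacent_intervals (hc.intervalIntegrable 0 x)
    (hc.intervalIntegrable x _), h2, h3, solve]
  simp only [mul_one, mul_zero, sub_zero, neg_mul, intervalIntegral.integral_neg] at h1
  rw [h1]
  ring

end Solve

/-- The triangle wave that is odd about `0`, even about `1 / 2` and equal to `x` in between. -/
def triangleWave (x : ℝ) : ℝ := Real.arcsin (Real.sin (Real.pi * x)) / Real.pi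

lemma isSineLike_triangleWave : IsSineLike triangleWave where
  continuous := (Real.continuous_arcsin.comp (Real.continuous_sin.comp
    (continuous_const.mul continuous_id))).div_const _
  neg x := by simp [triangleWave, neg_div]
  one_sub x := by rw [triangleWave, triangleWave, mul_sub, mul_one, Real.sin_pi_sub]

lemma triangleWave_of_mem {x : ℝ} (hx : x ∈ Icc (0 : ℝ) (1 / 2)) : triangleWave x = x := by
  have hpi := Real.pi_pos
  rw [triangleWave, Real.arcsin_sin, mul_div_cancel_left₀ _ hpi.ne']
  · nlinarith [hx.1]
  · nlinarith [hx.2]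

/-- Compose `g` with the positive and the negative part of the triangle wave and subtract; `g 0 = 0`
cancels the inactive part on `[0, 1 / 2]`. -/
lemma exists_isSineLike_extension {g : ℝ → ℝ} (hg : Continuous g) (h0 : g 0 = 0) :
    ∃ G, IsSineLike G ∧ ∀ x ∈ Icc (0 : ℝ) (1 / 2), G x = g x := by
  have ht := isSineLike_triangleWave
  refine ⟨fun x => g (max (triangleWave x) 0) - g (max (-triangleWave x) 0), ⟨?_, ?_, ?_⟩, ?_⟩
  · have := ht.continuous
    fun_prop
  · intro x
    rw [ht.neg, neg_neg]
    ring
  · intro x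
    rw [ht.one_sub]
  · intro x hx
    beta_reduce
    rw [triangleWave_of_mem hx, max_eq_left hx.1, max_eq_right (by linarith [hx.1]), h0, sub_zero]

/-! ### The eigenfunction -/

/-- A solution `F'' = -G`, `(sp G)'' = -lam sp F` of the eigenvalue problem on the line, with
`F = G = 0` exactly at the integers. -/
structure IsSinePair (P lam : ℝ) (F G : ℝ → ℝ) : Prop where
  one_lt : 1 < P
  lam_pos : 0 < lam
  sineLike : IsSineLike G
  F_eq : F = solve G
  G_eq : (fun x => sp P (G x)) = fun x => lam * solve (fun y => sp P (F y)) x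
  G_pos : ∀ x ∈ Ioo (0 : ℝ) 1, 0 < G x

/-- Both sides of the equation for `sp P G` are sine-like, so it suffices to compare them on `[0, 1
/ 2]`. There `solve` is `minOp (1 / 2)` and the half-interval eigenfunction applies, with `lam =
ρ⁻¹`. -/
theorem exists_isSinePair {P : ℝ} (hP : 1 < P) : ∃ lam F G, IsSinePair P lam F G := by
  obtain ⟨ρ, g, hρ, hgc, hg0, hgpos, hg⟩ := exists_halfEigen hP (h := 1 / 2) (by norm_num)
  obtain ⟨G, hG, hGg⟩ := exists_isSineLike_extension hgc hg0
  have hF := isSineLike_solve hG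
  have hFnn : ∀ x ∈ Icc (0 : ℝ) (1 / 2), solve G x = minOp (1 / 2) g x := fun x hx => by
    rw [solve_eq_minOp hG.continuous hx]
    exact minOp_congr (by norm_num) hGg x
  have hgnn : ∀ x ∈ Icc (0 : ℝ) (1 / 2), 0 ≤ g x := fun x hx => by
    rcases hx.1.eq_or_lt with rfl | h
    · exact hg0.ge
    · exact (hgpos x ⟨h, hx.2⟩).le
  refine ⟨ρ⁻¹, solve G, G, hP, inv_pos.2 hρ, hG, rfl, ?_, ?_⟩
  · refine (hG.sp_comp hP).eq_of_eqOn ((isSineLike_solve (hF.sp_comp hP)).const_mul ρ⁻¹) ?_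
    intro x hx
    rw [hGg x hx, sp_of_nonneg hP (hgnn x hx), solve_eq_minOp (hF.sp_comp hP).continuous hx,
      eq_inv_mul_iff_mul_eq₀ hρ.ne', ← hg x hx]
    refine minOp_congr (by norm_num) (fun y hy => ?_) x
    rw [hFnn y hy, sp_of_nonneg hP (minOp_nonneg (by norm_num) hgnn hy.1)]
  · intro x hx
    rcases le_total x (1 / 2) with h | h
    · rw [hGg x ⟨hx.1.le, h⟩]
      exact hgpos x ⟨hx.1, h⟩
    · rw [← hG.one_sub, hGg (1 - x) ⟨by linarith [hx.2], by linarith⟩]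
      exact hgpos _ ⟨by linarith [hx.2], by linarith⟩

namespace IsSinePair
variable {P lam : ℝ} {F G : ℝ → ℝ} (h : IsSinePair P lam F G)
include h

lemma sineLike_F : IsSineLike F := by
  rw [h.F_eq]
  exact isSineLike_solve h.sineLike

/-- The shift by `1 / 2` turns evenness about `1 / 2` into zero first derivatives at the integers,
and the zeros of `G` at the integers into sign changes half way between them. -/
lemma isCosPair : IsCosPair P lam (fun x => F (x + 1 / 2)) (fun x => primHalf G (x + 1 / 2))
    (fun x => G (x + 1 / 2)) (fun x => lam * primHalf (fun y => sp P (F y)) (x + 1 / 2)) := by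
  have hF := h.sineLike_F
  have hS := hF.sp_comp h.one_lt
  have hprim : ∀ {u : ℝ → ℝ}, IsSineLike u → ∀ k : ℕ, primHalf u (k + 1 / 2) = 0 := by
    intro u hu k
    induction k with
    | zero => simpa using primHalf_half
    | succ k ih =>
      have h1 := primHalf_one_sub hu (-((k : ℝ) + 1 / 2))
      rw [primHalf_neg hu, ih] at h1
      rw [← neg_zero, ← h1]
      congr 1
      push_cast
      ring
  have hnat : ∀ (k : ℕ) (x : ℝ), G (x + k) = (-1) ^ k * G x := by
    intro k
    induction k with
    | zero => simp
    | succ k ih =>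
      intro x
      rw [Nat.cast_succ, ← add_assoc, h.sineLike.add_one, ih, pow_succ]
      ring
  have hshift : ∀ {u : ℝ → ℝ} {d x : ℝ}, HasDerivAt u d (x + 1 / 2) →
      HasDerivAt (fun y => u (y + 1 / 2)) d x := fun hu => hu.comp_add_const _ _
  refine ⟨h.one_lt, h.lam_pos, fun x => ?_, fun x => ?_, fun x => ?_, fun x => ?_, ?_,
    fun k => hprim h.sineLike k, fun k => ?_, fun k x hx => ?_, fun k x hx => ?_⟩
  · refine hshift ?_
    rw [h.F_eq]
    exact hasDerivAt_solve h.sineLike.continuous _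
  · exact hshift (hasDerivAt_primHalf h.sineLike.continuous _)
  · refine hshift (u := fun y => sp P (G y)) ?_
    rw [h.G_eq]
    exact (hasDerivAt_solve hS.continuous _).const_mul lam
  · refine hshift (u := fun y => lam * primHalf (fun y => sp P (F y)) y) ?_
    rw [← mul_neg]
    exact (hasDerivAt_primHalf hS.continuous _).const_mul lam
  · exact h.sineLike.continuous.comp (continuous_add_const _)
  · rw [hprim hS, mul_zero]
  · have hG0 := h.sineLike.zero
    rcases (abs_eq (by norm_num)).1 hx with h1 | h1
    · have := hnat (k + 1) 0
      rw [hG0, mul_zero] at this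
      rw [← this]
      congr 1
      push_cast
      linarith
    · have := hnat k 0
      rw [hG0, mul_zero] at this
      rw [← this]
      congr 1
      linarith
  · rw [abs_lt] at hx
    have h1 := hnat k (x + 1 / 2 - k)
    rw [sub_add_cancel] at h1
    rw [h1, ← mul_assoc, ← mul_pow]
    simp only [mul_neg, mul_one, neg_neg, one_pow, one_mul]
    exact h.G_pos _ ⟨by linarith, by linarith⟩

end IsSinePair

/-! ### Schur's test -/

/-- Schur's test for the boundedness in `L^P` of an integral operator with nonnegative kernel. -/
theorem schur_test {α : Type*} [MeasurableSpace α] {μ : Measure α} [SFinite μ] {P q : ℝ}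
    (hPq : P.HolderConjugate q) {k : α → α → ℝ≥0∞} (hk : Measurable (Function.uncurry k))
    {f g w : α → ℝ≥0∞} (hf : AEMeasurable f μ) (hg : AEMeasurable g μ) (hw : AEMeasurable w μ)
    (hg0 : ∀ᵐ x ∂μ, g x ≠ 0 ∧ g x ≠ ⊤)
    {ρ : ℝ≥0∞} (h1 : ∀ᵐ x ∂μ, ∫⁻ y, k x y * g y ∂μ ≤ f x)
    (h2 : ∀ᵐ y ∂μ, ∫⁻ x, k x y * f x ^ (P - 1) ∂μ ≤ ρ * g y ^ (P - 1)) :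
    ∫⁻ x, (∫⁻ y, k x y * w y ∂μ) ^ P ∂μ ≤ ρ * ∫⁻ y, w y ^ P ∂μ := by
  have hP := hPq.lt
  have hP0 := hPq.pos
  have hq := hPq.symm.pos
  have hkx : ∀ x, Measurable (k x) := fun x => hk.comp measurable_prodMk_left
  -- The integrand splits as `k * w = (k * g) ^ (1 / q) * (k * v) ^ (1 / P)`. Hölder's inequality
  -- and `h1` control the first factor by `f`; after exchanging the integrals, `h2` absorbs the
  -- weight `f ^ (P - 1)` and cancels the power of `g` in `v`.
  set v : α → ℝ≥0∞ := fun y => w y ^ P * (g y ^ (P - 1))⁻¹ with hv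
  have hvm : AEMeasurable v μ := (hw.pow_const P).mul (hg.pow_const _).inv
  have hpq1 : P * (1 / q) = P - 1 := by
    have := hPq.sub_one_mul_conj
    field_simp
    linarith
  have key : ∀ᵐ x ∂μ, (∫⁻ y, k x y * w y ∂μ) ^ P ≤ ∫⁻ y, f x ^ (P - 1) * (k x y * v y) ∂μ := by
    filter_upwards [h1] with x hx
    have e1 : ∫⁻ y, k x y * w y ∂μ = ∫⁻ y, ((fun y => (k x y * g y) ^ (1 / q)) *
        fun y => (k x y * v y) ^ (1 / P)) y ∂μ := by
      refine lintegral_congr_ae ?_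
      filter_upwards [hg0] with y hy
      simp only [Pi.mul_apply, hv]
      rw [ENNReal.mul_rpow_of_nonneg _ _ (by positivity), ENNReal.mul_rpow_of_nonneg _ _ (by positivity),
        ENNReal.mul_rpow_of_nonneg _ _ (by positivity), ENNReal.inv_rpow, ← ENNReal.rpow_mul,
        ← ENNReal.rpow_mul, mul_one_div_cancel hP0.ne', ENNReal.rpow_one]
      have e2 : (P - 1) * (1 / P) = 1 / q := by
        rw [← hpq1]
        field_simp
      have e3 : k x y = k x y ^ (1 / q) * k x y ^ (1 / P) := by
        rw [← ENNReal.rpow_add_of_nonneg _ _ (by positivity) (by positivity), one_div, one_div,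
          add_comm, hPq.inv_add_inv_eq_one, ENNReal.rpow_one]
      have e4 : g y ^ (1 / q) * (g y ^ (1 / q))⁻¹ = 1 :=
        ENNReal.mul_inv_cancel (by simp [hy.1, hy.2]) (by simp [hy.1, hy.2])
      rw [e2]
      calc k x y * w y = k x y ^ (1 / q) * k x y ^ (1 / P) * w y * 1 := by rw [← e3, mul_one]
        _ = _ := by
          rw [← e4]
          ring
    have e5 := ENNReal.lintegral_mul_le_Lp_mul_Lq μ hPq.symm
      (((hkx x).aemeasurable.mul hg).pow_const (1 / q))
      (((hkx x).aemeasurable.mul hvm).pow_const (1 / P))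
    have e6 : ∀ s : ℝ≥0∞, (s ^ (1 / q)) ^ q = s := fun s => by
      rw [← ENNReal.rpow_mul, one_div_mul_cancel hq.ne', ENNReal.rpow_one]
    have e7 : ∀ s : ℝ≥0∞, (s ^ (1 / P)) ^ P = s := fun s => by
      rw [← ENNReal.rpow_mul, one_div_mul_cancel hP0.ne', ENNReal.rpow_one]
    have hkv : AEMeasurable (fun y => k x y * v y) μ := (hkx x).aemeasurable.mul hvm
    rw [e1]
    refine (ENNReal.rpow_le_rpow e5 hP0.le).trans ?_
    simp only [Pi.mul_apply, e6, e7]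
    rw [ENNReal.mul_rpow_of_nonneg _ _ hP0.le, e7, ← ENNReal.rpow_mul, mul_comm (1 / q), hpq1,
      lintegral_const_mul'' _ hkv]
    gcongr
  have hm : AEMeasurable (Function.uncurry fun x y => f x ^ (P - 1) * (k x y * v y)) (μ.prod μ) :=
    ((hf.pow_const _).comp_fst).mul (hk.aemeasurable.mul hvm.comp_snd)
  calc ∫⁻ x, (∫⁻ y, k x y * w y ∂μ) ^ P ∂μ
      ≤ ∫⁻ x, ∫⁻ y, f x ^ (P - 1) * (k x y * v y) ∂μ ∂μ := lintegral_mono_ae key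
    _ = ∫⁻ y, ∫⁻ x, f x ^ (P - 1) * (k x y * v y) ∂μ ∂μ := lintegral_lintegral_swap hm
    _ ≤ ∫⁻ y, ρ * w y ^ P ∂μ := by
      refine lintegral_mono_ae ?_
      filter_upwards [h2, hg0] with y hy hgy
      have hky : Measurable fun x => k x y := hk.comp measurable_prodMk_right
      have e1 : ∀ x, f x ^ (P - 1) * (k x y * v y) = k x y * f x ^ (P - 1) * v y := fun x => by ring
      simp only [e1]
      have hkf : AEMeasurable (fun x => k x y * f x ^ (P - 1)) μ :=
        hky.aemeasurable.mul (hf.pow_const _)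
      rw [lintegral_mul_const'' _ hkf]
      refine (mul_le_mul_left hy _).trans_eq ?_
      have e4 : g y ^ (P - 1) * (g y ^ (P - 1))⁻¹ = 1 :=
        ENNReal.mul_inv_cancel (by simp [hgy.1, hgy.2]) (by simp [hgy.1, hgy.2])
      calc ρ * g y ^ (P - 1) * v y = ρ * w y ^ P * (g y ^ (P - 1) * (g y ^ (P - 1))⁻¹) := by
            rw [hv]
            ring
        _ = ρ * w y ^ P := by rw [e4, mul_one]
    _ = ρ * ∫⁻ y, w y ^ P ∂μ := lintegral_const_mul'' _ (hw.pow_const P)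

/-! ### Green's function -/

/-- Green's function of `-u''` on `[c, d]` with zero boundary values. -/
def green (c d x y : ℝ) : ℝ := (min x y - c) * (d - max x y) / (d - c)

/-- The solution of `-u'' = w` on `[c, d]` with zero boundary values. -/
def greenOp (c d : ℝ) (w : ℝ → ℝ) (x : ℝ) : ℝ := ∫ y in c..d, green c d x y * w y

section Green
variable {c d : ℝ}

lemma green_comm (x y : ℝ) : green c d x y = green c d y x := by
  rw [green, green, min_comm, max_comm]

lemma continuous_green : Continuous fun z : ℝ × ℝ => green c d z.1 z.2 := by
  unfold green
  fun_prop

lemma green_nonneg (hcd : c < d) {x y : ℝ} (hx : x ∈ Icc c d) (hy : y ∈ Icc c d) :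
    0 ≤ green c d x y :=
  div_nonneg (mul_nonneg (sub_nonneg.2 (le_min hx.1 hy.1)) (sub_nonneg.2 (max_le hx.2 hy.2)))
    (sub_nonneg.2 hcd.le)

lemma continuous_greenOp {w : ℝ → ℝ} (hw : Continuous w) : Continuous (greenOp c d w) := by
  refine intervalIntegral.continuous_parametric_intervalIntegral_of_continuous' ?_ _ _
  exact continuous_green.mul (hw.comp continuous_snd)

lemma greenOp_nonneg (hcd : c < d) {w : ℝ → ℝ} (hw : ∀ y ∈ Icc c d, 0 ≤ w y) {x : ℝ}
    (hx : x ∈ Icc c d) : 0 ≤ greenOp c d w x :=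
  intervalIntegral.integral_nonneg hcd.le fun y hy => mul_nonneg (green_nonneg hcd hx hy) (hw y hy)

/-- Splitting the kernel at `y = x` exhibits the Green operator as a linear function minus a second
primitive. -/
lemma greenOp_eq (hcd : c < d) {w : ℝ → ℝ} (hw : IntervalIntegrable w volume c d) {x : ℝ}
    (hx : x ∈ Icc c d) : greenOp c d w x =
      (x - c) / (d - c) * (∫ y in c..d, (d - y) * w y) - ∫ y in c..x, (x - y) * w y := by
  have hdc : d - c ≠ 0 := (sub_pos.2 hcd).ne'
  have hsub1 : uIcc c x ⊆ uIcc c d := by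
    rw [uIcc_of_le hx.1, uIcc_of_le hcd.le]
    exact Icc_subset_Icc_right hx.2
  have hsub2 : uIcc x d ⊆ uIcc c d := by
    rw [uIcc_of_le hx.2, uIcc_of_le hcd.le]
    exact Icc_subset_Icc_left hx.1
  have hi : ∀ {φ : ℝ → ℝ}, Continuous φ → IntervalIntegrable (fun y => φ y * w y) volume c d :=
    fun hφ => hw.continuousOn_mul hφ.continuousOn
  have hg : Continuous fun y => green c d x y :=
    continuous_green.comp (Continuous.prodMk_right x)
  have hA : Continuous fun y => (x - c) / (d - c) * (d - y) := by fun_prop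
  have hB : Continuous fun y => x - y := by fun_prop
  have e1 : ∫ y in c..x, green c d x y * w y =
      ∫ y in c..x, ((x - c) / (d - c) * (d - y) * w y - (x - y) * w y) := by
    refine intervalIntegral.integral_congr fun y hy => ?_
    rw [uIcc_of_le hx.1] at hy
    simp only [green, min_eq_right hy.2, max_eq_left hy.2]
    field_simp
    ring
  have e2 : ∫ y in x..d, green c d x y * w y = ∫ y in x..d, (x - c) / (d - c) * (d - y) * w y := by
    refine intervalIntegral.integral_congr fun y hy => ?_
    rw [uIcc_of_le hx.2] at hy
    simp only [green, min_eq_left hy.1, max_eq_right hy.1]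
    ring
  rw [greenOp, ← intervalIntegral.integral_add_adjacent_intervals ((hi hg).mono_set hsub1)
    ((hi hg).mono_set hsub2), e1, e2,
    intervalIntegral.integral_sub ((hi hA).mono_set hsub1) ((hi hB).mono_set hsub1)]
  have e3 := intervalIntegral.integral_add_adjacent_intervals ((hi hA).mono_set hsub1)
    ((hi hA).mono_set hsub2)
  rw [← intervalIntegral.integral_const_mul]
  simp only [← mul_assoc]
  linarith

lemma greenOp_left (hcd : c < d) (w : ℝ → ℝ) : greenOp c d w c = 0 := by
  rw [greenOp, intervalIntegral.integral_congr (g := fun _ => 0)]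
  · simp
  · intro y hy
    rw [uIcc_of_le hcd.le] at hy
    simp [green, min_eq_left hy.1]

lemma greenOp_right (hcd : c < d) (w : ℝ → ℝ) : greenOp c d w d = 0 := by
  rw [greenOp, intervalIntegral.integral_congr (g := fun _ => 0)]
  · simp
  · intro y hy
    rw [uIcc_of_le hcd.le] at hy
    simp [green, max_eq_left hy.2]

/-- A function with second derivative `-w` differs from its affine interpolant on a subinterval by
the Green operator of the subinterval. -/
lemma sub_affineInterp_eq {a b : ℝ} {w f : ℝ → ℝ} (hw : IntervalIntegrable w volume a b) {A B : ℝ}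
    (hf : ∀ x ∈ Icc a b, f x = A + B * x - ∫ y in a..x, (x - y) * w y) (hac : a ≤ c) (hcd : c < d)
    (hdb : d ≤ b) {x : ℝ} (hx : x ∈ Icc c d) : f x - affineInterp c d f x = greenOp c d w x := by
  have hab : a ≤ b := hac.trans (hcd.le.trans hdb)
  have hdc : d - c ≠ 0 := (sub_pos.2 hcd).ne'
  have hsub : ∀ {s t : ℝ}, s ∈ Icc a b → t ∈ Icc a b → IntervalIntegrable w volume s t := by
    intro s t hs ht
    refine hw.mono_set ?_
    rw [uIcc_of_le hab]
    exact uIcc_subset_Icc hs ht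
  have hmem : ∀ {t : ℝ}, t ∈ Icc c d → t ∈ Icc a b := fun ht => ⟨hac.trans ht.1, ht.2.trans hdb⟩
  have ha : a ∈ Icc a b := ⟨le_rfl, hab⟩
  have hc : c ∈ Icc a b := hmem ⟨le_rfl, hcd.le⟩
  -- Moving the base point from `a` to `c` changes the second primitive by an affine function, which
  -- affine interpolation reproduces.
  have hlin : ∀ t ∈ Icc c d, ∫ y in a..t, (t - y) * w y =
      t * (∫ y in a..c, w y) - (∫ y in a..c, y * w y) + ∫ y in c..t, (t - y) * w y := by
    intro t ht
    have i1 : ∀ {s u : ℝ}, s ∈ Icc a b → u ∈ Icc a b →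
        IntervalIntegrable (fun y => (t - y) * w y) volume s u := fun hs hu =>
      (hsub hs hu).continuousOn_mul (by fun_prop)
    rw [← intervalIntegral.integral_add_adjacent_intervals (i1 ha hc) (i1 hc (hmem ht))]
    congr 1
    rw [← intervalIntegral.integral_const_mul, ← intervalIntegral.integral_sub
      ((hsub ha hc).const_mul t) ((hsub ha hc).continuousOn_mul (by fun_prop))]
    exact intervalIntegral.integral_congr fun y _ => by ring
  have e1 := hlin x hx
  have e2 := hlin d ⟨hcd.le, le_rfl⟩
  have e3 := hlin c ⟨le_rfl, hcd.le⟩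
  rw [intervalIntegral.integral_same, add_zero] at e3
  rw [greenOp_eq hcd (hsub hc (hmem ⟨hcd.le, le_rfl⟩)) hx, affineInterp, hf x (hmem hx),
    hf c hc, hf d (hmem ⟨hcd.le, le_rfl⟩), e1, e2, e3]
  field_simp
  ring

/-- Taylor's formula with integral remainder. -/
lemma eq_of_deriv2 {F F' q : ℝ → ℝ} (hF : ∀ x, HasDerivAt F (F' x) x)
    (hF' : ∀ x, HasDerivAt F' (-q x) x) (hq : Continuous q) (a x : ℝ) :
    F x = F a + F' a * (x - a) - ∫ y in a..x, (x - y) * q y := by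
  have hF'c : Continuous F' := continuous_iff_continuousAt.2 fun x => (hF' x).continuousAt
  have h1 := intervalIntegral.integral_mul_deriv_eq_deriv_mul (a := a) (b := x)
    (u := fun y => x - y) (u' := fun _ => -1) (v := F') (v' := fun y => -q y)
    (fun y _ => by simpa using (hasDerivAt_id y).const_sub x) (fun y _ => hF' y) (by simp)
    (hq.neg.intervalIntegrable _ _)
  have h2 := intervalIntegral.integral_eq_sub_of_hasDerivAt (fun y _ => hF y)
    (hF'c.intervalIntegrable a x)
  simp only [mul_neg, neg_mul, one_mul, intervalIntegral.integral_neg, sub_self, zero_mul,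
    zero_sub] at h1
  linarith

/-- A function with second derivative `-q` and zero boundary values is given by Green's function. -/
lemma eq_greenOp {F F' q : ℝ → ℝ} (hF : ∀ x, HasDerivAt F (F' x) x)
    (hF' : ∀ x, HasDerivAt F' (-q x) x) (hq : Continuous q) (hcd : c < d) (hc : F c = 0)
    (hd : F d = 0) {x : ℝ} (hx : x ∈ Icc c d) : F x = greenOp c d q x := by
  rw [← sub_affineInterp_eq (f := F) (hq.intervalIntegrable c d) (A := F c - F' c * c) (B := F' c)
    (fun y _ => (eq_of_deriv2 hF hF' hq c y).trans (by ring)) le_rfl hcd le_rfl hx, affineInterp,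
    hc, hd]
  ring

lemma green_scale (hcd : c < d) (x y : ℝ) :
    green c d (c + (d - c) * x) (c + (d - c) * y) = (d - c) * green 0 1 x y := by
  have hl : 0 < d - c := sub_pos.2 hcd
  have e1 : min (c + (d - c) * x) (c + (d - c) * y) = c + (d - c) * min x y := by
    rw [mul_min_of_nonneg _ _ hl.le, min_add_add_left]
  have e2 : max (c + (d - c) * x) (c + (d - c) * y) = c + (d - c) * max x y := by
    rw [mul_max_of_nonneg _ _ hl.le, max_add_add_left]
  rw [green, green, e1, e2]
  field_simp
  ring

lemma greenOp_scale (hcd : c < d) (w : ℝ → ℝ) (x : ℝ) :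
    greenOp c d w (c + (d - c) * x) = (d - c) ^ 2 * greenOp 0 1 (fun t => w (c + (d - c) * t)) x := by
  have hl : 0 < d - c := sub_pos.2 hcd
  have h1 := intervalIntegral.integral_comp_add_mul (a := 0) (b := 1)
    (fun y => green c d (c + (d - c) * x) y * w y) hl.ne' c
  simp only [mul_zero, mul_one, add_zero, add_sub_cancel, smul_eq_mul, green_scale hcd] at h1
  rw [greenOp, greenOp]
  rw [eq_inv_mul_iff_mul_eq₀ hl.ne'] at h1
  rw [← h1, ← intervalIntegral.integral_const_mul, ← intervalIntegral.integral_const_mul]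
  exact intervalIntegral.integral_congr fun y _ => by ring

lemma lintegral_green_mul (hcd : c < d) {w : ℝ → ℝ} (hw : Continuous w)
    (hw0 : ∀ y ∈ Icc c d, 0 ≤ w y) {x : ℝ} (hx : x ∈ Icc c d) :
    ∫⁻ y in Ioo c d, ENNReal.ofReal (green c d x y) * ENNReal.ofReal (w y) =
      ENNReal.ofReal (greenOp c d w x) := by
  have hc : Continuous fun y => green c d x y * w y :=
    (continuous_green.comp (Continuous.prodMk_right x)).mul hw
  rw [greenOp, intervalIntegral.integral_of_le hcd.le, integral_Ioc_eq_integral_Ioo,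
    ofReal_integral_eq_lintegral_ofReal]
  · refine setLIntegral_congr_fun measurableSet_Ioo fun y hy => ?_
    exact (ENNReal.ofReal_mul (green_nonneg hcd hx (Ioo_subset_Icc_self hy))).symm
  · exact (hc.continuousOn.integrableOn_Icc (a := c) (b := d)).mono_set Ioo_subset_Icc_self
  · refine (ae_restrict_iff' measurableSet_Ioo).2 (ae_of_all _ fun y hy => ?_)
    exact mul_nonneg (green_nonneg hcd hx (Ioo_subset_Icc_self hy)) (hw0 y (Ioo_subset_Icc_self hy))

end Green

/-! ### The sharp bound of the Green operator. -/

namespace IsSinePair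
variable {P lam : ℝ} {F G : ℝ → ℝ} (h : IsSinePair P lam F G)
include h

lemma G_nonneg {x : ℝ} (hx : x ∈ Icc (0 : ℝ) 1) : 0 ≤ G x := by
  have hG := h.sineLike
  rcases hx.1.eq_or_lt with rfl | h0
  · exact hG.zero.ge
  rcases hx.2.eq_or_lt with rfl | h1
  · have := hG.one_sub 0
    rw [sub_zero, hG.zero] at this
    exact this.ge
  · exact (h.G_pos x ⟨h0, h1⟩).le

lemma F_eq_greenOp {x : ℝ} (hx : x ∈ Icc (0 : ℝ) 1) : F x = greenOp 0 1 G x := by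
  have hF := h.sineLike_F
  refine eq_greenOp (F := F) (F' := primHalf G) (fun x => ?_)
    (fun x => hasDerivAt_primHalf h.sineLike.continuous x) h.sineLike.continuous one_pos hF.zero ?_ hx
  · rw [h.F_eq]
    exact hasDerivAt_solve h.sineLike.continuous x
  · have := hF.one_sub 0
    rwa [sub_zero, hF.zero] at this

lemma F_nonneg {x : ℝ} (hx : x ∈ Icc (0 : ℝ) 1) : 0 ≤ F x := by
  rw [h.F_eq_greenOp hx]
  exact greenOp_nonneg one_pos (fun y hy => h.G_nonneg hy) hx

/-- The second equation of the system, read through Green's function. With `F_eq_greenOp` it shows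
that `G` and `F` satisfy the hypotheses of Schur's test with equality. -/
lemma greenOp_F {x : ℝ} (hx : x ∈ Icc (0 : ℝ) 1) :
    greenOp 0 1 (fun y => F y ^ (P - 1)) x = lam⁻¹ * G x ^ (P - 1) := by
  have hF := h.sineLike_F
  have hS := hF.sp_comp h.one_lt
  have hSS := isSineLike_solve hS
  have h1 : solve (fun y => sp P (F y)) x = greenOp 0 1 (fun y => sp P (F y)) x := by
    refine eq_greenOp (fun x => hasDerivAt_solve hS.continuous x)
      (fun x => hasDerivAt_primHalf hS.continuous x) hS.continuous one_pos hSS.zero ?_ hx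
    have := hSS.one_sub 0
    rwa [sub_zero, hSS.zero] at this
  have h2 := congrFun h.G_eq x
  rw [sp_of_nonneg h.one_lt (h.G_nonneg hx), h1] at h2
  rw [h2, inv_mul_cancel_left₀ h.lam_pos.ne']
  refine intervalIntegral.integral_congr fun y hy => ?_
  rw [uIcc_of_le zero_le_one] at hy
  simp only [sp_of_nonneg h.one_lt (h.F_nonneg hy)]

/-- The bound of the Green operator in `L^P`. -/
theorem lintegral_greenOp_le {c d : ℝ} (hcd : c < d) {w : ℝ → ℝ}
    (hw : AEMeasurable w (volume.restrict (Ioo c d))) :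
    ∫⁻ x in Ioo c d, ‖greenOp c d w x‖ₑ ^ P ≤
      ENNReal.ofReal ((d - c) ^ (2 * P) * lam⁻¹) * ∫⁻ x in Ioo c d, ‖w x‖ₑ ^ P := by
  have hP := h.one_lt
  have hl : 0 < d - c := sub_pos.2 hcd
  -- The weights for Schur's test are the eigenfunction `g` transplanted to `[c, d]` and its image
  -- under the Green operator. Two applications of the operator produce the scaling factors `(d - c)
  -- ^ 2` and `((d - c) ^ 2) ^ (P - 1)`, whose product is `(d - c) ^ (2 * P)`.
  set g : ℝ → ℝ := fun x => G ((x - c) / (d - c)) with hg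
  have hgc : Continuous g := h.sineLike.continuous.comp (by fun_prop)
  have hpar : ∀ t, (c + (d - c) * t - c) / (d - c) = t := fun t => by
    field_simp
    ring
  have hgt : ∀ t, g (c + (d - c) * t) = G t := fun t => by rw [hg]; simp only [hpar]
  have hxt : ∀ x ∈ Icc c d, ∃ t ∈ Icc (0 : ℝ) 1, x = c + (d - c) * t := fun x hx => by
    refine ⟨(x - c) / (d - c), ⟨div_nonneg (sub_nonneg.2 hx.1) hl.le, ?_⟩, ?_⟩
    · rw [div_le_one hl]
      linarith [hx.2]
    · field_simp
      ring
  have hg0 : ∀ x ∈ Icc c d, 0 ≤ g x := fun x hx => by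
    obtain ⟨t, ht, rfl⟩ := hxt x hx
    rw [hgt]
    exact h.G_nonneg ht
  have hgpos : ∀ x ∈ Ioo c d, 0 < g x := fun x hx => by
    refine h.G_pos _ ⟨div_pos (sub_pos.2 hx.1) hl, ?_⟩
    rw [div_lt_one hl]
    linarith [hx.2]
  set f : ℝ → ℝ := greenOp c d g with hf
  have hfc : Continuous f := continuous_greenOp hgc
  have hf0 : ∀ x ∈ Icc c d, 0 ≤ f x := fun x hx => greenOp_nonneg hcd hg0 hx
  have hfr : Continuous fun x => f x ^ (P - 1) := hfc.rpow_const fun _ => Or.inr (by linarith)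
  have hft : ∀ t ∈ Icc (0 : ℝ) 1, f (c + (d - c) * t) = (d - c) ^ 2 * F t := fun t ht => by
    rw [hf, greenOp_scale hcd, h.F_eq_greenOp ht]
    simp only [hgt]
  have hff : ∀ x ∈ Icc c d, greenOp c d (fun y => f y ^ (P - 1)) x =
      (d - c) ^ (2 * P) * lam⁻¹ * g x ^ (P - 1) := fun x hx => by
    obtain ⟨t, ht, rfl⟩ := hxt x hx
    rw [greenOp_scale hcd, hgt, mul_assoc, ← h.greenOp_F ht]
    have e1 : greenOp 0 1 (fun t => f (c + (d - c) * t) ^ (P - 1)) t =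
        greenOp 0 1 (fun t => ((d - c) ^ 2) ^ (P - 1) * F t ^ (P - 1)) t := by
      refine intervalIntegral.integral_congr fun y hy => ?_
      rw [uIcc_of_le zero_le_one] at hy
      simp only [hft y hy, Real.mul_rpow (sq_nonneg (d - c)) (h.F_nonneg hy)]
    have e2 : greenOp 0 1 (fun t => ((d - c) ^ 2) ^ (P - 1) * F t ^ (P - 1)) t =
        ((d - c) ^ 2) ^ (P - 1) * greenOp 0 1 (fun t => F t ^ (P - 1)) t := by
      rw [greenOp, greenOp, ← intervalIntegral.integral_const_mul]
      exact intervalIntegral.integral_congr fun y _ => by ring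
    rw [e1, e2, ← mul_assoc]
    congr 1
    rw [← Real.rpow_one_add' (sq_nonneg _) (by linarith), ← Real.rpow_natCast,
      ← Real.rpow_mul hl.le]
    congr 1
    push_cast
    ring
  obtain ⟨q, hPq⟩ : ∃ q, P.HolderConjugate q := ⟨_, Real.HolderConjugate.conjExponent hP⟩
  have hmem : ∀ᵐ x ∂(volume.restrict (Ioo c d)), x ∈ Ioo c d := ae_restrict_mem measurableSet_Ioo
  have hS := schur_test (μ := volume.restrict (Ioo c d)) hPq
    (k := fun x y => ENNReal.ofReal (green c d x y)) (f := fun x => ENNReal.ofReal (f x))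
    (g := fun x => ENNReal.ofReal (g x)) (w := fun x => ‖w x‖ₑ)
    (ρ := ENNReal.ofReal ((d - c) ^ (2 * P) * lam⁻¹))
    (ENNReal.measurable_ofReal.comp continuous_green.measurable)
    (ENNReal.measurable_ofReal.comp hfc.measurable).aemeasurable
    (ENNReal.measurable_ofReal.comp hgc.measurable).aemeasurable hw.enorm
    (by
      filter_upwards [hmem] with x hx
      exact ⟨by simpa using hgpos x hx, ENNReal.ofReal_ne_top⟩)
    (by
      filter_upwards [hmem] with x hx
      exact (lintegral_green_mul hcd hgc hg0 (Ioo_subset_Icc_self hx)).le)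
    (by
      filter_upwards [hmem] with y hy
      have hy' := Ioo_subset_Icc_self hy
      rw [ENNReal.ofReal_rpow_of_nonneg (hg0 y hy') (by linarith),
        ← ENNReal.ofReal_mul (mul_nonneg (Real.rpow_nonneg hl.le _) (inv_nonneg.2 h.lam_pos.le)),
        ← hff y hy', ← lintegral_green_mul hcd hfr
          (fun x hx => Real.rpow_nonneg (hf0 x hx) _) hy']
      refine (setLIntegral_congr_fun measurableSet_Ioo fun x hx => ?_).le
      rw [green_comm, ENNReal.ofReal_rpow_of_nonneg (hf0 x (Ioo_subset_Icc_self hx)) (by linarith)])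
  refine le_trans (lintegral_mono_ae ?_) hS
  filter_upwards [hmem] with x hx
  refine ENNReal.rpow_le_rpow ?_ hPq.nonneg
  rw [greenOp, intervalIntegral.integral_of_le hcd.le, integral_Ioc_eq_integral_Ioo]
  refine (enorm_integral_le_lintegral_enorm _).trans (setLIntegral_mono' measurableSet_Ioo fun y hy => ?_)
  rw [enorm_mul, Real.enorm_of_nonneg (green_nonneg hcd (Ioo_subset_Icc_self hx)
    (Ioo_subset_Icc_self hy))]

end IsSinePair

/-! ### Integration by parts against a primitive -/

/-- As `v` is merely integrable, its primitive is only absolutely continuous, and integration by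
parts is used in that generality. -/
lemma integral_primitive_mul_deriv {a b : ℝ} {v g g' : ℝ → ℝ} (hv : IntervalIntegrable v volume a b)
    (hg : ∀ x, HasDerivAt g (g' x) x) (hg' : Continuous g') :
    ∫ x in a..b, (∫ t in a..x, v t) * g' x = (∫ t in a..b, v t) * g b - ∫ x in a..b, v x * g x := by
  have hgc : ContDiff ℝ 1 g := by
    rw [contDiff_one_iff_deriv]
    refine ⟨fun x => (hg x).differentiableAt, ?_⟩
    rwa [show deriv g = g' from funext fun x => (hg x).deriv]
  have h1 := AbsolutelyContinuousOnInterval.integral_mul_deriv_eq_deriv_mul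
    (hv.absolutelyContinuousOnInterval_intervalIntegral (c := a) left_mem_uIcc)
    (hgc.contDiffOn (s := uIcc a b)).absolutelyContinuousOnInterval
  rw [intervalIntegral.integral_same, zero_mul, sub_zero] at h1
  simp only [fun x => (hg x).deriv] at h1
  rw [h1]
  congr 1
  refine intervalIntegral.integral_congr_ae ?_
  filter_upwards [hv.ae_hasDerivAt_integral] with x hx hxm
  rw [(hx (uIoc_subset_uIcc hxm) a left_mem_uIcc).deriv]

lemma integral_primitive {a b : ℝ} {v : ℝ → ℝ} (hv : IntervalIntegrable v volume a b) :
    ∫ x in a..b, ∫ t in a..x, v t = ∫ x in a..b, (b - x) * v x := by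
  have h1 := integral_primitive_mul_deriv (g := fun x => x - b) (g' := fun _ => 1) hv
    (fun x => (hasDerivAt_id x).sub_const b) continuous_const
  simp only [mul_one, sub_self, mul_zero, zero_sub] at h1
  rw [h1, ← intervalIntegral.integral_neg]
  exact intervalIntegral.integral_congr fun x _ => by ring

/-! ### Test functions -/

section TestFunctions
variable {a b : ℝ}

lemma IsTestFunction.deriv {φ : ℝ → ℝ} (h : IsTestFunction a b φ) : IsTestFunction a b (deriv φ) :=
  ⟨(contDiff_infty_iff_deriv.1 h.1).2, h.2.1.deriv, tsupport_deriv_subset.trans h.2.2⟩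

lemma IsTestFunction.hasDerivAt {φ : ℝ → ℝ} (h : IsTestFunction a b φ) (x : ℝ) :
    HasDerivAt φ (_root_.deriv φ x) x :=
  ((contDiff_infty_iff_deriv.1 h.1).1 x).hasDerivAt

lemma IsTestFunction.eq_zero {φ : ℝ → ℝ} (h : IsTestFunction a b φ) {x : ℝ} (hx : x ∉ Ioo a b) :
    φ x = 0 :=
  image_eq_zero_of_notMem_tsupport fun hx' => hx (h.2.2 hx')

lemma IsTestFunction.left {φ : ℝ → ℝ} (h : IsTestFunction a b φ) : φ a = 0 :=
  h.eq_zero fun h => lt_irrefl _ h.1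

lemma IsTestFunction.right {φ : ℝ → ℝ} (h : IsTestFunction a b φ) : φ b = 0 :=
  h.eq_zero fun h => lt_irrefl _ h.2

lemma IsTestFunction.sub {φ ψ : ℝ → ℝ} (hφ : IsTestFunction a b φ) (hψ : IsTestFunction a b ψ) :
    IsTestFunction a b fun x => φ x - ψ x :=
  ⟨hφ.1.sub hψ.1, hφ.2.1.sub hψ.2.1, (tsupport_sub φ ψ).trans (union_subset hφ.2.2 hψ.2.2)⟩

lemma IsTestFunction.const_mul {φ : ℝ → ℝ} (hφ : IsTestFunction a b φ) (c : ℝ) :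
    IsTestFunction a b fun x => c * φ x :=
  ⟨contDiff_const.mul hφ.1, hφ.2.1.mul_left, (tsupport_mul_subset_right).trans hφ.2.2⟩

lemma exists_isTestFunction_integral_one (hab : a < b) :
    ∃ η, IsTestFunction a b η ∧ ∫ x in Ioo a b, η x = 1 := by
  let f : ContDiffBump ((a + b) / 2) := ⟨(b - a) / 8, (b - a) / 4, by linarith, by linarith⟩
  have hsub : tsupport (f.normed volume) ⊆ Ioo a b := by
    rw [f.tsupport_normed_eq, Real.closedBall_eq_Icc]
    intro x hx
    have h1 : f.rOut = (b - a) / 4 := rfl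
    rw [h1] at hx
    constructor
    · linarith [hx.1]
    · linarith [hx.2]
  refine ⟨f.normed volume, ⟨f.contDiff_normed, f.hasCompactSupport_normed, hsub⟩, ?_⟩
  rw [setIntegral_eq_integral_of_forall_compl_eq_zero, f.integral_normed]
  exact fun x hx => image_eq_zero_of_notMem_tsupport fun h => hx (hsub h)

lemma exists_Icc_of_isCompact (hab : a < b) {K : Set ℝ} (hK : IsCompact K) (hKs : K ⊆ Ioo a b) :
    ∃ a' b', a < a' ∧ a' ≤ b' ∧ b' < b ∧ K ⊆ Icc a' b' := by
  rcases K.eq_empty_or_nonempty with rfl | hne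
  · exact ⟨(a + b) / 2, (a + b) / 2, by linarith, le_rfl, by linarith, empty_subset _⟩
  · obtain ⟨m, hm, hm'⟩ := hK.exists_isLeast hne
    obtain ⟨M, hM, hM'⟩ := hK.exists_isGreatest hne
    exact ⟨m, M, (hKs hm).1, hm' hM, (hKs hM).2, fun x hx => ⟨hm' hx, hM' hx⟩⟩

/-- The primitive of a test function of mean zero is a test function. -/
lemma IsTestFunction.primitive (hab : a < b) {ψ : ℝ → ℝ} (hψ : IsTestFunction a b ψ)
    (h0 : ∫ x in a..b, ψ x = 0) : IsTestFunction a b fun x => ∫ t in a..x, ψ t := by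
  have hc := hψ.1.continuous
  have hd : ∀ x, HasDerivAt (fun x => ∫ t in a..x, ψ t) (ψ x) x := fun x =>
    intervalIntegral.integral_hasDerivAt_right (hc.intervalIntegrable _ _)
      (hc.stronglyMeasurableAtFilter _ _) hc.continuousAt
  obtain ⟨a', b', ha', hab', hb', hK⟩ := exists_Icc_of_isCompact hab hψ.2.1 hψ.2.2
  have hz : ∀ x, x ∉ Icc a' b' → ψ x = 0 := fun x hx =>
    image_eq_zero_of_notMem_tsupport fun h => hx (hK h)
  have hsupp : tsupport (fun x => ∫ t in a..x, ψ t) ⊆ Icc a' b' := by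
    refine closure_minimal (fun x hx => ?_) isClosed_Icc
    by_contra hxn
    refine hx ?_
    rw [mem_Icc, not_and_or, not_le, not_le] at hxn
    rcases hxn with h | h
    · beta_reduce
      rw [intervalIntegral.integral_congr (g := fun _ => 0)]
      · simp
      · intro t ht
        refine hz t fun ht' => ?_
        have := ht.2.trans_lt (max_lt ha' h)
        exact absurd ht'.1 (not_le.2 this)
    · beta_reduce
      rw [← intervalIntegral.integral_add_adjacent_intervals (hc.intervalIntegrable a b)
        (hc.intervalIntegrable b x), h0, zero_add, intervalIntegral.integral_congr (g := fun _ => 0)]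
      · simp
      · intro t ht
        refine hz t fun ht' => ?_
        have := (lt_min hb' h).trans_le ht.1
        exact absurd ht'.2 (not_le.2 this)
  refine ⟨?_, ?_, hsupp.trans fun x hx => ⟨ha'.trans_le hx.1, hx.2.trans_lt hb'⟩⟩
  · rw [contDiff_infty_iff_deriv]
    refine ⟨fun x => (hd x).differentiableAt, ?_⟩
    rw [show _root_.deriv (fun x => ∫ t in a..x, ψ t) = ψ from funext fun y => (hd y).deriv]
    exact hψ.1
  · exact HasCompactSupport.of_support_subset_isCompact isCompact_Icc
      ((subset_tsupport _).trans hsupp)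

lemma IsTestFunction.deriv_primitive {ψ : ℝ → ℝ} (hψ : IsTestFunction a b ψ) :
    _root_.deriv (fun x => ∫ t in a..x, ψ t) = ψ :=
  funext fun _ => (intervalIntegral.integral_hasDerivAt_right (hψ.1.continuous.intervalIntegrable _ _)
    (hψ.1.continuous.stronglyMeasurableAtFilter _ _) hψ.1.continuous.continuousAt).deriv

lemma setIntegral_Ioo_eq (hab : a ≤ b) (f : ℝ → ℝ) : ∫ x in Ioo a b, f x = ∫ x in a..b, f x := by
  rw [intervalIntegral.integral_of_le hab, integral_Ioc_eq_integral_Ioo]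

lemma ae_eq_zero_of_test (u : ℝ → ℝ) (hu : IntegrableOn u (Ioo a b))
    (h : ∀ φ, IsTestFunction a b φ → ∫ x in Ioo a b, u x * φ x = 0) : u =ᵐ[mu a b] 0 := by
  have h1 := isOpen_Ioo.ae_eq_zero_of_integral_contDiff_smul_eq_zero (μ := volume) (f := u)
    (U := Ioo a b) hu.locallyIntegrableOn fun g hg hgc hgs => by
      have hφ : IsTestFunction a b g := ⟨hg, hgc, hgs⟩
      rw [← h g hφ, setIntegral_eq_integral_of_forall_compl_eq_zero]
      · simp only [smul_eq_mul, mul_comm]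
      · intro x hx
        rw [hφ.eq_zero hx, mul_zero]
  exact (ae_restrict_iff' measurableSet_Ioo).2 h1

/-- The lemma of du Bois-Reymond. -/
lemma ae_eq_const_of_test (hab : a < b) (u : ℝ → ℝ) (hu : IntegrableOn u (Ioo a b))
    (h : ∀ φ, IsTestFunction a b φ → ∫ x in Ioo a b, u x * deriv φ x = 0) :
    ∃ c, ∀ᵐ x ∂(mu a b), u x = c := by
  obtain ⟨η, hη, hη1⟩ := exists_isTestFunction_integral_one hab
  have hint : ∀ φ, IsTestFunction a b φ → IntegrableOn (fun x => u x * φ x) (Ioo a b) := by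
    intro φ hφ
    obtain ⟨C, hC⟩ := hφ.1.continuous.bounded_above_of_compact_support hφ.2.1
    exact hu.mul_bdd (c := C) hφ.1.continuous.aestronglyMeasurable (ae_of_all _ hC)
  have hint1 : ∀ φ, IsTestFunction a b φ → IntegrableOn φ (Ioo a b) := fun φ hφ =>
    (hφ.1.continuous.integrable_of_hasCompactSupport hφ.2.1).integrableOn
  set c := ∫ x in Ioo a b, u x * η x with hc
  refine ⟨c, ?_⟩
  have hcint : IntegrableOn (fun _ : ℝ => c) (Ioo a b) := integrable_const c
  have h0 := ae_eq_zero_of_test (fun x => u x - c) (hu.sub hcint) fun φ hφ => by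
    -- Subtracting `m * η` leaves a test function of mean zero, whose primitive is an admissible
    -- test function in `h`.
    set m := ∫ x in Ioo a b, φ x with hm
    have hψ := hφ.sub (hη.const_mul m)
    have hψ0 : ∫ x in a..b, (φ x - m * η x) = 0 := by
      rw [← setIntegral_Ioo_eq hab.le, integral_sub (hint1 φ hφ) ((hint1 η hη).const_mul m),
        integral_const_mul, hη1, ← hm]
      ring
    have h2 := h _ (hψ.primitive hab hψ0)
    rw [hψ.deriv_primitive] at h2
    have e1 : ∀ x, u x * (φ x - m * η x) = u x * φ x - m * (u x * η x) := fun x => by ring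
    simp only [e1] at h2
    rw [integral_sub (hint φ hφ) ((hint η hη).const_mul m), integral_const_mul, ← hc] at h2
    have e2 : ∀ x, (u x - c) * φ x = u x * φ x - c * φ x := fun x => by ring
    simp only [e2]
    rw [integral_sub (hint φ hφ) ((hint1 φ hφ).const_mul c), integral_const_mul, ← hm]
    linarith
  filter_upwards [h0] with x hx
  have : u x - c = 0 := hx
  linarith

lemma intervalIntegrable_of_Ioo (hab : a ≤ b) {v : ℝ → ℝ} (hv : IntegrableOn v (Ioo a b)) :
    IntervalIntegrable v volume a b := by
  rwa [intervalIntegrable_iff_integrableOn_Ioo_of_le hab]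

lemma continuousOn_primitive_Icc (hab : a ≤ b) {v : ℝ → ℝ} (hv : IntegrableOn v (Ioo a b)) :
    ContinuousOn (fun x => ∫ t in a..x, v t) (Icc a b) := by
  have h1 := (intervalIntegrable_of_Ioo hab hv).absolutelyContinuousOnInterval_intervalIntegral
    (c := a) left_mem_uIcc
  have := h1.continuousOn
  rwa [uIcc_of_le hab] at this

lemma integral_primitive_mul_deriv_test (hab : a ≤ b) {v φ : ℝ → ℝ} (hv : IntegrableOn v (Ioo a b))
    (hφ : IsTestFunction a b φ) :
    ∫ x in Ioo a b, (∫ t in a..x, v t) * deriv φ x = -∫ x in Ioo a b, v x * φ x := by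
  rw [setIntegral_Ioo_eq hab, setIntegral_Ioo_eq hab, integral_primitive_mul_deriv
    (intervalIntegrable_of_Ioo hab hv) hφ.hasDerivAt hφ.deriv.1.continuous, hφ.right]
  ring

/-- A function with integrable weak derivative is a primitive of it. -/
lemma exists_ae_eq_primitive (hab : a < b) {u v : ℝ → ℝ} (hu : IntegrableOn u (Ioo a b))
    (hv : IntegrableOn v (Ioo a b))
    (h : ∀ φ, IsTestFunction a b φ →
      ∫ x in Ioo a b, u x * deriv φ x = -∫ x in Ioo a b, v x * φ x) :
    ∃ c, ∀ᵐ x ∂(mu a b), u x = c + ∫ t in a..x, v t := by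
  have hV : IntegrableOn (fun x => ∫ t in a..x, v t) (Ioo a b) :=
    (continuousOn_primitive_Icc hab.le hv).integrableOn_Icc.mono_set Ioo_subset_Icc_self
  obtain ⟨c, hc⟩ := ae_eq_const_of_test hab (fun x => u x - ∫ t in a..x, v t) (hu.sub hV)
    fun φ hφ => by
      have hb : ∀ {w : ℝ → ℝ}, IntegrableOn w (Ioo a b) →
          IntegrableOn (fun x => w x * deriv φ x) (Ioo a b) := by
        intro w hw
        obtain ⟨C, hC⟩ := hφ.deriv.1.continuous.bounded_above_of_compact_support hφ.deriv.2.1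
        exact hw.mul_bdd (c := C) hφ.deriv.1.continuous.aestronglyMeasurable (ae_of_all _ hC)
      simp only [sub_mul]
      rw [integral_sub (hb hu) (hb hV), h φ hφ, integral_primitive_mul_deriv_test hab.le hv hφ]
      ring
  refine ⟨c, ?_⟩
  filter_upwards [hc] with x hx
  linarith

end TestFunctions

/-! ### Functions in Sobolev spaces as primitives -/

section Representation
variable {p : ℝ≥0∞} [hp : Fact (1 ≤ p)] {a b : ℝ}

lemma integrableOn_Lp (u : LpI p a b) : IntegrableOn u (Ioo a b) :=
  (Lp.memLp u).integrable hp.out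

omit hp in
lemma memLp_of_continuous {g : ℝ → ℝ} (hg : Continuous g) : MemLp g p (mu a b) := by
  obtain ⟨C, hC⟩ := isCompact_Icc.exists_bound_of_continuousOn (s := Icc a b) hg.continuousOn
  exact MemLp.of_bound hg.aestronglyMeasurable C
    ((ae_restrict_iff' measurableSet_Ioo).2 (ae_of_all _ fun x hx => hC x (Ioo_subset_Icc_self hx)))

/-- Pairing with a continuous function is a bounded functional. -/
lemma exists_pairing_continuous {g : ℝ → ℝ} (hg : Continuous g) :
    ∃ L : LpI p a b →L[ℝ] ℝ, ∀ u, L u = ∫ x in Ioo a b, u x * g x := by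
  set m := (a + b) / 2
  set r := |b - a| / 2 + 1 with hr
  have hr0 : 0 < r := by positivity
  -- A cutoff equal to `1` on `(a, b)` makes the weight compactly supported without changing the
  -- integral.
  let χ : ℝ → ℝ := fun x => max 0 (min 1 (2 - |x - m| / r))
  have hχ : Continuous χ := by fun_prop
  obtain ⟨L, hL⟩ := exists_pairing p a b (g := fun x => g x * χ x) (hg.mul hχ) (by
    refine HasCompactSupport.mul_left (HasCompactSupport.of_support_subset_isCompact
      (isCompact_closedBall m (2 * r)) fun x hx => ?_)
    rw [Metric.mem_closedBall, Real.dist_eq]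
    by_contra! hcon
    refine hx (max_eq_left ((min_le_right _ _).trans ?_))
    rw [sub_nonpos, le_div_iff₀ hr0]
    exact hcon.le)
  refine ⟨L, fun u => ?_⟩
  rw [hL]
  refine setIntegral_congr_fun measurableSet_Ioo fun x hx => ?_
  have h1 : |x - m| / r ≤ 1 := by
    rw [div_le_one hr0, hr, abs_of_pos (sub_pos.2 (hx.1.trans hx.2)), abs_le]
    constructor <;> simp only [m] <;> linarith [hx.1, hx.2]
  have h2 : χ x = 1 := by
    simp only [χ]
    rw [min_eq_left (by linarith), max_eq_right zero_le_one]
  simp only [h2, mul_one]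

/-- Consecutive members of a tuple of weak derivatives. -/
lemma weakDeriv_succ {i : ℕ} {u v w : ℝ → ℝ} (hv : HasWeakDeriv a b i u v)
    (hw : HasWeakDeriv a b (i + 1) u w) {φ : ℝ → ℝ} (hφ : IsTestFunction a b φ) :
    ∫ x in Ioo a b, v x * deriv φ x = -∫ x in Ioo a b, w x * φ x := by
  have h1 := hv _ hφ.deriv
  have h2 := hw _ hφ
  rw [iteratedDeriv_succ'] at h2
  rw [h1, pow_succ] at h2
  have h3 : ((-1 : ℝ) ^ i) ≠ 0 := pow_ne_zero _ (by norm_num)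
  refine mul_left_cancel₀ h3 ?_
  linarith

lemma hasWeakDeriv_of_mem {k : ℕ} (u : Sobolev p a b k) (j : Fin (k + 1)) :
    HasWeakDeriv a b j (u.1 0) (u.1 j) := u.2 j

lemma exists_primitive_of_weakDeriv (hab : a < b) {k : ℕ} (u : Sobolev p a b k) {i j : Fin (k + 1)}
    (hij : (j : ℕ) = i + 1) : ∃ c, ∀ᵐ x ∂(mu a b), u.1 i x = c + ∫ t in a..x, u.1 j t := by
  refine exists_ae_eq_primitive hab (integrableOn_Lp _) (integrableOn_Lp _) fun φ hφ => ?_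
  have h2 := hasWeakDeriv_of_mem u j
  rw [hij] at h2
  exact weakDeriv_succ (hasWeakDeriv_of_mem u i) h2 hφ

lemma primitive_congr {u v : ℝ → ℝ} (huv : u =ᵐ[mu a b] v) {x : ℝ} (hx : x ∈ Icc a b) :
    ∫ t in a..x, u t = ∫ t in a..x, v t := by
  rw [intervalIntegral.integral_of_le hx.1, intervalIntegral.integral_of_le hx.1,
    integral_Ioc_eq_integral_Ioo, integral_Ioc_eq_integral_Ioo]
  exact integral_congr_ae (ae_mono (Measure.restrict_mono (Ioo_subset_Ioo_right hx.2) le_rfl) huv)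

lemma intervalIntegrable_sub_interval {v : ℝ → ℝ} (hv : IntegrableOn v (Ioo a b)) {x : ℝ}
    (hx : x ∈ Icc a b) : IntervalIntegrable v volume a x :=
  intervalIntegrable_of_Ioo hx.1 (hv.mono_set (Ioo_subset_Ioo_right hx.2))

/-- Functions in `W²_p` are second primitives. -/
lemma Sobolev.exists_ae_eq (hab : a < b) (u : Sobolev p a b 2) : ∃ A B : ℝ,
    u.1 0 =ᵐ[mu a b] fun x => A + B * x - ∫ y in a..x, (x - y) * (-u.1 2 y) := by
  obtain ⟨c₁, h1⟩ := exists_primitive_of_weakDeriv hab u (i := 1) (j := 2) rfl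
  obtain ⟨c₀, h0⟩ := exists_primitive_of_weakDeriv hab u (i := 0) (j := 1) rfl
  refine ⟨c₀ - c₁ * a, c₁, ?_⟩
  filter_upwards [h0, ae_restrict_mem measurableSet_Ioo] with x hx hxm
  have hx' := Ioo_subset_Icc_self hxm
  have hi := intervalIntegrable_sub_interval (integrableOn_Lp (u.1 2)) hx'
  have hc : ContinuousOn (fun y => ∫ t in a..y, u.1 2 t) (uIcc a x) := by
    rw [uIcc_of_le hx'.1]
    exact (continuousOn_primitive_Icc hab.le (integrableOn_Lp (u.1 2))).mono
      (Icc_subset_Icc_right hx'.2)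
  rw [hx, primitive_congr h1 hx', intervalIntegral.integral_add (by simp) hc.intervalIntegrable,
    integral_primitive hi, intervalIntegral.integral_const, smul_eq_mul]
  simp only [mul_neg, intervalIntegral.integral_neg]
  ring

lemma continuousOn_secondPrimitive (hab : a < b) {w : ℝ → ℝ} (hw : IntegrableOn w (Ioo a b))
    (A B : ℝ) :
    ContinuousOn (fun x => A + B * x - ∫ y in a..x, (x - y) * w y) (Icc a b) := by
  have h1 := continuousOn_primitive_Icc hab.le hw
  have h2 : ContinuousOn (fun x => ∫ t in a..x, t * w t) (Icc a b) := by
    refine continuousOn_primitive_Icc hab.le ?_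
    rw [← intervalIntegrable_iff_integrableOn_Ioo_of_le hab.le] at hw ⊢
    exact hw.continuousOn_mul (by fun_prop)
  have h3 : ContinuousOn (fun x => A + B * x - (x * (∫ t in a..x, w t) - ∫ t in a..x, t * w t))
      (Icc a b) := by fun_prop
  refine h3.congr fun x hx => ?_
  have hi := intervalIntegrable_sub_interval hw hx
  beta_reduce
  rw [← intervalIntegral.integral_const_mul, ← intervalIntegral.integral_sub (hi.const_mul x)
    (hi.continuousOn_mul (by fun_prop))]
  congr 2
  ext t
  ring

lemma eqOn_Icc_of_ae_eq_Ioo (hab : a < b) {f g : ℝ → ℝ} (hfg : f =ᵐ[mu a b] g)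
    (hf : ContinuousOn f (Icc a b)) (hg : ContinuousOn g (Icc a b)) : EqOn f g (Icc a b) := by
  refine Measure.eqOn_Icc_of_ae_eq volume hab.ne ?_ hf hg
  rwa [Measure.restrict_congr_set Ioo_ae_eq_Icc.symm]

lemma affineInterp_eq_zero {f : ℝ → ℝ} (ha : f a = 0) (hb : f b = 0) (x : ℝ) :
    affineInterp a b f x = 0 := by
  rw [affineInterp, ha, hb]
  ring

/-! ### Zero boundary values -/

lemma IsTestFunction.iteratedDeriv {φ : ℝ → ℝ} (h : IsTestFunction a b φ) (j : ℕ) :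
    IsTestFunction a b (iteratedDeriv j φ) := by
  induction j with
  | zero => simpa using h
  | succ j ih =>
    rw [iteratedDeriv_succ]
    exact ih.deriv

/-- The weak derivative relation already gives a primitive up to a constant `c`. For test functions
the derivative has mean zero and `∫ u = ∫ (b - x) * u'`; both are continuous conditions, so they
pass to the closure, and the second one forces `c = 0`. -/
lemma Sobolev₀.ae_eq_primitive (hab : a < b) {k : ℕ} (u : Sobolev₀ p a b k) {i j : Fin (k + 1)}
    (hij : (j : ℕ) = i + 1) :
    (∫ x in Ioo a b, derivₗ p a b k j u x = 0) ∧
      ∀ᵐ x ∂(mu a b), derivₗ p a b k i u x = ∫ t in a..x, derivₗ p a b k j u t := by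
  obtain ⟨L₁, hL₁⟩ := exists_pairing_continuous (p := p) (a := a) (b := b)
    (continuous_const (y := (1 : ℝ)))
  obtain ⟨L₂, hL₂⟩ := exists_pairing_continuous (p := p) (a := a) (b := b)
    (g := fun y : ℝ => b - y) (by fun_prop)
  simp only [mul_one] at hL₁
  have hcj : ∀ j : Fin (k + 1), Continuous fun x : Sobolev p a b k => x.1 j := fun j =>
    (continuous_apply j).comp continuous_subtype_val
  have hclosed : IsClosed {x : Sobolev p a b k | L₁ (x.1 j) = 0 ∧ L₁ (x.1 i) = L₂ (x.1 j)} :=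
    (isClosed_eq (L₁.continuous.comp (hcj j)) continuous_const).inter
      (isClosed_eq (L₁.continuous.comp (hcj i)) (L₂.continuous.comp (hcj j)))
  have hmem : incl p a b k u ∈ {x : Sobolev p a b k | L₁ (x.1 j) = 0 ∧ L₁ (x.1 i) = L₂ (x.1 j)} := by
    refine closure_minimal (s := (testFunctions p a b k : Set (Sobolev p a b k))) ?_ hclosed u.2
    rintro x ⟨φ, hφ, hx⟩
    have hθ := hφ.iteratedDeriv i
    have hd : iteratedDeriv j φ = deriv (iteratedDeriv i φ) := by rw [hij, iteratedDeriv_succ]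
    have hFTC : ∀ y, ∫ t in a..y, iteratedDeriv j φ t = iteratedDeriv i φ y := by
      intro y
      rw [hd, intervalIntegral.integral_eq_sub_of_hasDerivAt (fun t _ => hθ.hasDerivAt t)
        (hθ.deriv.1.continuous.intervalIntegrable _ _), hθ.left, sub_zero]
    refine ⟨?_, ?_⟩
    · rw [hL₁, integral_congr_ae (hx j), setIntegral_Ioo_eq hab.le, hFTC, hθ.right]
    · rw [hL₁, hL₂, integral_congr_ae (hx i), setIntegral_Ioo_eq hab.le,
        integral_congr_ae (g := fun y => (b - y) * iteratedDeriv j φ y), setIntegral_Ioo_eq hab.le,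
        ← integral_primitive]
      · simp only [hFTC]
      · exact (hφ.continuous_iteratedDeriv j).intervalIntegrable _ _
      · filter_upwards [hx j] with y hy
        rw [hy, mul_comm]
  have h1 : ∫ x in Ioo a b, derivₗ p a b k j u x = 0 := by
    rw [← hL₁]
    exact hmem.1
  refine ⟨h1, ?_⟩
  obtain ⟨c, hc⟩ := exists_primitive_of_weakDeriv hab (incl p a b k u) hij
  have h2 : L₁ (derivₗ p a b k i u) = L₂ (derivₗ p a b k j u) := hmem.2
  have hV : IntegrableOn (fun x => ∫ t in a..x, derivₗ p a b k j u t) (Ioo a b) :=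
    (continuousOn_primitive_Icc hab.le (integrableOn_Lp
      (derivₗ p a b k j u))).integrableOn_Icc.mono_set Ioo_subset_Icc_self
  have hi := intervalIntegrable_of_Ioo hab.le (integrableOn_Lp (derivₗ p a b k j u))
  have h3 : (b - a) * c = 0 := by
    have e1 : ∫ x in Ioo a b, derivₗ p a b k i u x =
        ∫ x in Ioo a b, (c + ∫ t in a..x, derivₗ p a b k j u t) := integral_congr_ae hc
    rw [hL₁, hL₂, e1, integral_add (integrable_const c) hV, setIntegral_Ioo_eq hab.le,
      setIntegral_Ioo_eq hab.le, integral_primitive hi, setIntegral_Ioo_eq hab.le,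
      intervalIntegral.integral_const, smul_eq_mul,
      intervalIntegral.integral_congr (fun x _ => mul_comm (derivₗ p a b k j u x) (b - x))] at h2
    linarith
  have hc0 : c = 0 := (mul_eq_zero.1 h3).resolve_left (sub_pos.2 hab).ne'
  filter_upwards [hc] with x hx
  rw [hc0, zero_add] at hx
  exact hx

lemma Sobolev₀.embedding_apply {k : ℕ} (u : Sobolev₀ p a b k) :
    embedding p a b k u = derivₗ p a b k 0 u := rfl

lemma secondPrimitive_eq_greenOp (hab : a < b) {w : ℝ → ℝ} (hw : IntegrableOn w (Ioo a b)) {A B : ℝ}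
    (ha : A + B * a - ∫ y in a..a, (a - y) * w y = 0)
    (hb : A + B * b - ∫ y in a..b, (b - y) * w y = 0) {x : ℝ} (hx : x ∈ Icc a b) :
    A + B * x - ∫ y in a..x, (x - y) * w y = greenOp a b w x := by
  rw [← sub_affineInterp_eq (f := fun x => A + B * x - ∫ y in a..x, (x - y) * w y)
    (intervalIntegrable_of_Ioo hab.le hw) (fun _ _ => rfl) le_rfl hab le_rfl hx,
    affineInterp_eq_zero (f := fun x => A + B * x - ∫ y in a..x, (x - y) * w y) ha hb, sub_zero]

/-- An element of `W²_p ∩ W̊¹_p` is recovered from its second derivative by Green's function. -/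
lemma ae_eq_greenOp_of_mem_navierSpace (hab : a < b) {u : Sobolev p a b 2}
    (hu : u ∈ navierSpace p a b) : u.1 0 =ᵐ[mu a b] greenOp a b (fun y => -u.1 2 y) := by
  obtain ⟨w, hw⟩ := hu
  obtain ⟨A, B, hAB⟩ := Sobolev.exists_ae_eq hab u
  obtain ⟨h1, h2⟩ := w.ae_eq_primitive hab (i := 0) (j := 1) rfl
  rw [← Sobolev₀.embedding_apply, hw] at h2
  have hi : IntegrableOn (fun y => -u.1 2 y) (Ioo a b) := (integrableOn_Lp (u.1 2)).neg
  have heq := eqOn_Icc_of_ae_eq_Ioo hab (hAB.symm.trans h2)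
    (continuousOn_secondPrimitive hab hi A B)
    (continuousOn_primitive_Icc hab.le (integrableOn_Lp (Sobolev₀.derivₗ p a b 1 1 w)))
  have ha := heq (left_mem_Icc.2 hab.le)
  have hb := heq (right_mem_Icc.2 hab.le)
  rw [setIntegral_Ioo_eq hab.le] at h1
  simp only [h1] at hb
  simp only [intervalIntegral.integral_same (f := fun t => Sobolev₀.derivₗ p a b 1 1 w t)] at ha
  filter_upwards [hAB, ae_restrict_mem measurableSet_Ioo] with x hx hxm
  rw [hx]
  exact secondPrimitive_eq_greenOp hab hi ha hb (Ioo_subset_Icc_self hxm)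

/-- An element of the zero-boundary space of order two is a second primitive. -/
lemma Sobolev₀.ae_eq_secondPrimitive (hab : a < b) (u : Sobolev₀ p a b 2) :
    embedding p a b 2 u =ᵐ[mu a b] fun x => ∫ y in a..x, (x - y) * derivₗ p a b 2 2 u y := by
  obtain ⟨-, h1⟩ := u.ae_eq_primitive hab (i := 0) (j := 1) rfl
  obtain ⟨-, h2⟩ := u.ae_eq_primitive hab (i := 1) (j := 2) rfl
  rw [Sobolev₀.embedding_apply]
  filter_upwards [h1, ae_restrict_mem measurableSet_Ioo] with x hx hxm
  have hx' := Ioo_subset_Icc_self hxm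
  rw [hx, primitive_congr h2 hx',
    integral_primitive (intervalIntegrable_sub_interval (integrableOn_Lp _) hx')]

/-- The integral is `u b`; its vanishing makes the right end a free interpolation node. -/
lemma Sobolev₀.integral_moments (hab : a < b) (u : Sobolev₀ p a b 2) :
    ∫ y in a..b, (b - y) * derivₗ p a b 2 2 u y = 0 := by
  obtain ⟨h0, -⟩ := u.ae_eq_primitive hab (i := 0) (j := 1) rfl
  obtain ⟨-, h2⟩ := u.ae_eq_primitive hab (i := 1) (j := 2) rfl
  rw [setIntegral_Ioo_eq hab.le, primitive_congr h2 (right_mem_Icc.2 hab.le),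
    integral_primitive (intervalIntegrable_of_Ioo hab.le (integrableOn_Lp _))] at h0
  exact h0

end Representation

/-! ### Density of test functions and construction of Sobolev functions -/

section Density
variable {p : ℝ≥0∞} {a b : ℝ}

/-- Smooth cutoff functions. -/
lemma exists_isTestFunction_cutoff {δ : ℝ} (hδ : 0 < δ) (hδab : 2 * δ < b - a) :
    ∃ χ, IsTestFunction a b χ ∧ (∀ x, χ x ∈ Icc 0 1) ∧ ∀ x ∈ Icc (a + δ) (b - δ), χ x = 1 := by
  let f : ContDiffBump ((a + b) / 2) :=
    ⟨(b - a) / 2 - δ, (b - a) / 2 - δ / 2, by linarith, by linarith⟩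
  refine ⟨f, ⟨f.contDiff, f.hasCompactSupport, ?_⟩, fun x => ⟨f.nonneg, f.le_one⟩, fun x hx => ?_⟩
  · rw [f.tsupport_eq, Real.closedBall_eq_Icc]
    have h1 : f.rOut = (b - a) / 2 - δ / 2 := rfl
    rw [h1]
    exact fun x hx => ⟨by linarith [hx.1], by linarith [hx.2]⟩
  · refine f.one_of_mem_closedBall ?_
    have h1 : f.rIn = (b - a) / 2 - δ := rfl
    rw [h1, Real.closedBall_eq_Icc]
    exact ⟨by linarith [hx.1], by linarith [hx.2]⟩

lemma IsTestFunction.mul_left {χ g : ℝ → ℝ} (hχ : IsTestFunction a b χ) (hg : ContDiff ℝ ∞ g) :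
    IsTestFunction a b fun x => g x * χ x :=
  ⟨hg.mul hχ.1, hχ.2.1.mul_left, tsupport_mul_subset_right.trans hχ.2.2⟩

/-- Approximate by a smooth function on the line and multiply by a cutoff equal to `1` off two end
strips of width `δ`. The cutoff error is bounded by the constant `C` on these strips, hence small in
`L_p` for finite `p`. -/
lemma exists_isTestFunction_eLpNorm_sub_le (hab : a < b) (hp : p ≠ ⊤) [Fact (1 ≤ p)] {w : ℝ → ℝ}
    (hw : MemLp w p (mu a b)) {ε : ℝ≥0∞} (hε : ε ≠ 0) :
    ∃ φ, IsTestFunction a b φ ∧ eLpNorm (w - φ) p (mu a b) ≤ ε := by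
  obtain ⟨e, he, heε⟩ : ∃ e : ℝ, 0 < e ∧ ENNReal.ofReal e ≤ ε / 2 := by
    rcases eq_or_ne ε ⊤ with rfl | hε'
    · exact ⟨1, one_pos, by rw [ENNReal.top_div_of_ne_top (by simp)]; exact le_top⟩
    · refine ⟨(ε / 2).toReal, ENNReal.toReal_pos (by simpa using hε) ?_, ENNReal.ofReal_toReal_le⟩
      exact ENNReal.div_ne_top hε' (by simp)
  obtain ⟨g, -, hg, hwg⟩ := hw.exist_eLpNorm_sub_le hp Fact.out he
  obtain ⟨C, hC⟩ := isCompact_Icc.exists_bound_of_continuousOn (s := Icc a b) hg.continuous.continuousOn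
  obtain ⟨η, hη, hη'⟩ := exists_eLpNorm_indicator_le (μ := mu a b) hp C
    (ε := ε / 2) (by simpa using hε)
  obtain ⟨δ, hδ, hδ1, hδ2⟩ : ∃ δ : ℝ, 0 < δ ∧ 2 * δ < b - a ∧ ENNReal.ofReal (2 * δ) ≤ η := by
    refine ⟨min ((b - a) / 4) (η / 2), lt_min (by linarith) (by positivity), ?_, ?_⟩
    · linarith [min_le_left ((b - a) / 4) (η / 2 : ℝ)]
    · rw [ENNReal.ofReal_le_iff_le_toReal (by simp)]
      have := min_le_right ((b - a) / 4) (η / 2 : ℝ)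
      simp only [ENNReal.coe_toReal]
      linarith
  obtain ⟨χ, hχ, hχ01, hχ1⟩ := exists_isTestFunction_cutoff hδ hδ1
  refine ⟨_, hχ.mul_left hg, ?_⟩
  have h1 : eLpNorm (g - fun x => g x * χ x) p (mu a b) ≤ ε / 2 := by
    refine le_trans (eLpNorm_mono_ae ?_) (hη' (Ioo a (a + δ) ∪ Ioo (b - δ) b) ?_)
    · filter_upwards [ae_restrict_mem measurableSet_Ioo] with x hx
      have hgx := hC x (Ioo_subset_Icc_self hx)
      have hC0 : 0 ≤ C := (norm_nonneg _).trans hgx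
      by_cases hxs : x ∈ Ioo a (a + δ) ∪ Ioo (b - δ) b
      · rw [indicator_of_mem hxs, Pi.sub_apply,
          show g x - g x * χ x = g x * (1 - χ x) by ring, norm_mul, Real.norm_of_nonneg hC0,
          Real.norm_of_nonneg (sub_nonneg.2 (hχ01 x).2)]
        have := (hχ01 x).1
        calc ‖g x‖ * (1 - χ x) ≤ C * 1 := by gcongr <;> linarith [(hχ01 x).2]
          _ = C := mul_one C
      · have hx1 : χ x = 1 := by
          simp only [mem_union, mem_Ioo, not_or, not_and, not_lt] at hxs
          refine hχ1 x ⟨hxs.1 hx.1, ?_⟩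
          by_contra! h
          exact absurd hx.2 (not_lt.2 (hxs.2 h))
        rw [Pi.sub_apply, hx1, mul_one, sub_self, norm_zero]
        exact norm_nonneg _
    · refine (Measure.restrict_apply_le _ _).trans ((measure_union_le _ _).trans ?_)
      rwa [Real.volume_Ioo, Real.volume_Ioo, ← ENNReal.ofReal_add (by linarith) (by linarith),
        show a + δ - a + (b - (b - δ)) = 2 * δ by ring]
  have hgm := (memLp_of_continuous (p := p) (a := a) (b := b) hg.continuous)
  calc eLpNorm (w - fun x => g x * χ x) p (mu a b)
      = eLpNorm ((w - g) + (g - fun x => g x * χ x)) p (mu a b) := by rw [sub_add_sub_cancel]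
    _ ≤ eLpNorm (w - g) p (mu a b) + eLpNorm (g - fun x => g x * χ x) p (mu a b) :=
        eLpNorm_add_le (hw.sub hgm).1
          (hgm.sub (memLp_of_continuous (hχ.mul_left hg).1.continuous)).1 Fact.out
    _ ≤ ε / 2 + ε / 2 := add_le_add (hwg.trans heε) h1
    _ = ε := ENNReal.add_halves ε

variable [hp1 : Fact (1 ≤ p)]

lemma mem_closure_isTestFunction (hab : a < b) (hp : p ≠ ⊤) (w : LpI p a b) :
    w ∈ closure {v : LpI p a b | ∃ φ, IsTestFunction a b φ ∧ v =ᵐ[mu a b] φ} := by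
  refine EMetric.mem_closure_iff.2 fun ε hε => ?_
  obtain ⟨δ, hδ, hδε⟩ := exists_between hε
  obtain ⟨φ, hφ, h⟩ := exists_isTestFunction_eLpNorm_sub_le hab hp (Lp.memLp w) hδ.ne'
  have hm := memLp_of_continuous (p := p) (a := a) (b := b) hφ.1.continuous
  refine ⟨hm.toLp φ, ⟨φ, hφ, hm.coeFn_toLp⟩, ?_⟩
  refine lt_of_le_of_lt ?_ hδε
  rw [← Lp.toLp_coeFn w (Lp.memLp w), Lp.edist_toLp_toLp]
  exact h

omit hp1 in
lemma integral_mul_deriv_test (hab : a ≤ b) {F F' φ : ℝ → ℝ} (hF : ∀ x, HasDerivAt F (F' x) x)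
    (hF' : Continuous F') (hφ : IsTestFunction a b φ) :
    ∫ x in Ioo a b, F x * deriv φ x = -∫ x in Ioo a b, F' x * φ x := by
  rw [setIntegral_Ioo_eq hab, setIntegral_Ioo_eq hab,
    intervalIntegral.integral_mul_deriv_eq_deriv_mul (fun x _ => hF x) (fun x _ => hφ.hasDerivAt x)
      (hF'.intervalIntegrable _ _) (hφ.deriv.1.continuous.intervalIntegrable _ _), hφ.left, hφ.right]
  ring

omit hp1 in
lemma hasWeakDeriv_of_chain (hab : a ≤ b) (F : ℕ → ℝ → ℝ) (j : ℕ)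
    (hF : ∀ i < j, ∀ x, HasDerivAt (F i) (F (i + 1) x) x) (hc : ∀ i ≤ j, Continuous (F i)) :
    HasWeakDeriv a b j (F 0) (F j) := by
  induction j generalizing F with
  | zero => intro φ _; simp
  | succ j ih =>
    intro φ hφ
    have h1 := ih (fun i => F (i + 1)) (fun i hi => hF (i + 1) (by omega))
      (fun i hi => hc (i + 1) (by omega)) φ hφ
    rw [iteratedDeriv_succ, integral_mul_deriv_test hab (hF 0 (by omega)) (hc 1 (by omega))
      (hφ.iteratedDeriv j), h1, pow_succ]
    ring

/-- Every test function is an element of the zero-boundary Sobolev space. -/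
lemma IsTestFunction.exists_sobolev₀ (hab : a ≤ b) {φ : ℝ → ℝ} (hφ : IsTestFunction a b φ) (k : ℕ) :
    ∃ u : Sobolev₀ p a b k, ∀ j : Fin (k + 1),
      Sobolev₀.derivₗ p a b k j u =ᵐ[mu a b] _root_.iteratedDeriv j φ := by
  have hm : ∀ j : ℕ, MemLp (_root_.iteratedDeriv j φ) p (mu a b) := fun j =>
    memLp_of_continuous (hφ.continuous_iteratedDeriv j)
  let x : Fin (k + 1) → LpI p a b := fun j => (hm j).toLp _
  have hx : ∀ j, x j =ᵐ[mu a b] _root_.iteratedDeriv (j : ℕ) φ := fun j => (hm j).coeFn_toLp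
  have hxS : x ∈ Sobolev p a b k := by
    intro j ψ hψ
    have h1 := hasWeakDeriv_of_chain hab (fun i => _root_.iteratedDeriv i φ) j
      (fun i _ y => by
        have := (hφ.iteratedDeriv i).hasDerivAt y
        rwa [← iteratedDeriv_succ] at this)
      (fun i _ => hφ.continuous_iteratedDeriv i) ψ hψ
    have e1 : ∫ y in Ioo a b, x 0 y * _root_.iteratedDeriv j ψ y =
        ∫ y in Ioo a b, _root_.iteratedDeriv 0 φ y * _root_.iteratedDeriv j ψ y := by
      refine integral_congr_ae ?_
      filter_upwards [hx 0] with y hy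
      rw [hy]
      rfl
    have e2 : ∫ y in Ioo a b, x j y * ψ y = ∫ y in Ioo a b, _root_.iteratedDeriv j φ y * ψ y := by
      refine integral_congr_ae ?_
      filter_upwards [hx j] with y hy
      rw [hy]
    rw [e1, e2]
    exact h1
  exact ⟨(⟨⟨x, hxS⟩, subset_closure ⟨φ, hφ, hx⟩⟩ :
    (testFunctions p a b k).topologicalClosure), hx⟩

/-- A bounded correction operator that maps test functions into the range of the top derivative
maps everything there. -/
lemma mem_range_derivₗ_of_continuous (hab : a < b) (hp : p ≠ ⊤) {k : ℕ} {R : LpI p a b → LpI p a b}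
    (hR : Continuous R)
    (h : ∀ (v : LpI p a b) (φ : ℝ → ℝ), IsTestFunction a b φ → v =ᵐ[mu a b] φ →
      ∃ θ, IsTestFunction a b θ ∧ R v =ᵐ[mu a b] iteratedDeriv k θ) (w : LpI p a b) :
    R w ∈ range (Sobolev₀.derivₗ p a b k (Fin.last k)) := by
  -- The range is closed, and the test functions are dense in `L_p` because `p` is finite.
  rw [← (Sobolev₀.isComplete_range_derivₗ_last p a b k).isClosed.closure_eq]
  refine map_mem_closure hR (mem_closure_isTestFunction hab hp w) ?_
  rintro v ⟨φ, hφ, hv⟩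
  obtain ⟨θ, hθ, hRθ⟩ := h v φ hφ hv
  obtain ⟨u, hu⟩ := hθ.exists_sobolev₀ (p := p) hab.le k
  exact ⟨u, Lp.ext ((hu (Fin.last k)).trans hRθ.symm)⟩

omit hp1 in
lemma IsTestFunction.intervalIntegrable {φ : ℝ → ℝ} (hφ : IsTestFunction a b φ) :
    IntervalIntegrable φ volume a b := hφ.1.continuous.intervalIntegrable _ _

/-- The continuous operator `v ↦ v - (∫ v) • η` fixes functions of mean zero and sends test
functions to derivatives of test functions. -/
lemma mem_range_derivₗ_one (hab : a < b) (hp : p ≠ ⊤) (w : LpI p a b)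
    (hw : ∫ x in Ioo a b, w x = 0) : ∃ u : Sobolev₀ p a b 1, Sobolev₀.derivₗ p a b 1 1 u = w := by
  obtain ⟨L₁, hL₁⟩ := exists_pairing_continuous (p := p) (a := a) (b := b)
    (continuous_const (y := (1 : ℝ)))
  simp only [mul_one] at hL₁
  obtain ⟨η, hη, hη1⟩ := exists_isTestFunction_integral_one hab
  have hηm := memLp_of_continuous (p := p) (a := a) (b := b) hη.1.continuous
  have h := mem_range_derivₗ_of_continuous (k := 1) hab hp
    (R := fun v => v - L₁ v • hηm.toLp η) (by fun_prop) (fun v φ hφ hv => ?_) w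
  · simpa [hL₁, hw] using h
  · refine ⟨_, (hφ.sub (hη.const_mul (L₁ v))).primitive hab ?_, ?_⟩
    · rw [setIntegral_Ioo_eq hab.le] at hη1
      rw [intervalIntegral.integral_sub hφ.intervalIntegrable (hη.intervalIntegrable.const_mul _),
        intervalIntegral.integral_const_mul, hη1, hL₁, integral_congr_ae hv,
        setIntegral_Ioo_eq hab.le]
      ring
    · rw [iteratedDeriv_one, (hφ.sub (hη.const_mul (L₁ v))).deriv_primitive]
      filter_upwards [Lp.coeFn_sub v (L₁ v • hηm.toLp η), Lp.coeFn_smul (L₁ v) (hηm.toLp η),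
        hηm.coeFn_toLp, hv] with x h1 h2 h3 h4
      rw [h1, Pi.sub_apply, h2, Pi.smul_apply, h3, h4, smul_eq_mul]

/-- Two moments are corrected: `η` has mean one, while `η'` has mean zero and integral one against
`b - x`. Removing `L₁ v • η` changes the second moment by `m * L₁ v`, whence the coefficient `L₂ v -
m * L₁ v` of `η'`. -/
lemma mem_range_derivₗ_two (hab : a < b) (hp : p ≠ ⊤) (w : LpI p a b)
    (hw : ∫ x in Ioo a b, w x = 0) (hw' : ∫ x in Ioo a b, w x * (b - x) = 0) :
    ∃ u : Sobolev₀ p a b 2, Sobolev₀.derivₗ p a b 2 2 u = w := by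
  obtain ⟨L₁, hL₁⟩ := exists_pairing_continuous (p := p) (a := a) (b := b)
    (continuous_const (y := (1 : ℝ)))
  obtain ⟨L₂, hL₂⟩ := exists_pairing_continuous (p := p) (a := a) (b := b)
    (g := fun y : ℝ => b - y) (by fun_prop)
  simp only [mul_one] at hL₁
  obtain ⟨η, hη, hη1⟩ := exists_isTestFunction_integral_one hab
  rw [setIntegral_Ioo_eq hab.le] at hη1
  have hηm := memLp_of_continuous (p := p) (a := a) (b := b) hη.1.continuous
  have hηm' := memLp_of_continuous (p := p) (a := a) (b := b) hη.deriv.1.continuous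
  set m := ∫ y in a..b, (b - y) * η y with hm
  have hη' : ∫ y in a..b, deriv η y = 0 := by
    rw [intervalIntegral.integral_deriv_eq_sub (fun x _ => (hη.hasDerivAt x).differentiableAt)
      hη.deriv.intervalIntegrable, hη.left, hη.right, sub_zero]
  have hη'' : ∫ y in a..b, (b - y) * deriv η y = 1 := by
    rw [← integral_primitive hη.deriv.intervalIntegrable, ← hη1]
    refine intervalIntegral.integral_congr fun x _ => ?_
    rw [intervalIntegral.integral_deriv_eq_sub (fun x _ => (hη.hasDerivAt x).differentiableAt)
      (hη.deriv.1.continuous.intervalIntegrable _ _), hη.left, sub_zero]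
  have h := mem_range_derivₗ_of_continuous (k := 2) hab hp
    (R := fun v => v - L₁ v • hηm.toLp η - (L₂ v - m * L₁ v) • hηm'.toLp _) (by fun_prop)
    (fun v φ hφ hv => ?_) w
  · simpa [hL₁, hL₂, hw, hw'] using h
  · have hψ := (hφ.sub (hη.const_mul (L₁ v))).sub (hη.deriv.const_mul (L₂ v - m * L₁ v))
    have hv1 : L₁ v = ∫ y in a..b, φ y := by
      rw [hL₁, integral_congr_ae hv, setIntegral_Ioo_eq hab.le]
    have hv2 : L₂ v = ∫ y in a..b, (b - y) * φ y := by
      rw [hL₂, ← setIntegral_Ioo_eq hab.le]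
      refine integral_congr_ae ?_
      filter_upwards [hv] with x hx
      rw [hx, mul_comm]
    have h0 : ∫ y in a..b, (φ y - L₁ v * η y - (L₂ v - m * L₁ v) * deriv η y) = 0 := by
      rw [intervalIntegral.integral_sub (hφ.intervalIntegrable.sub (hη.intervalIntegrable.const_mul _))
        (hη.deriv.intervalIntegrable.const_mul _),
        intervalIntegral.integral_sub hφ.intervalIntegrable (hη.intervalIntegrable.const_mul _),
        intervalIntegral.integral_const_mul, intervalIntegral.integral_const_mul, hη1, hη', ← hv1]
      ring
    have hP := hψ.primitive hab h0
    refine ⟨_, hP.primitive hab ?_, ?_⟩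
    · have hc : ∀ {θ : ℝ → ℝ}, IsTestFunction a b θ →
          IntervalIntegrable (fun y => (b - y) * θ y) volume a b := fun hθ =>
        ((continuous_const.sub continuous_id).mul hθ.1.continuous).intervalIntegrable _ _
      rw [integral_primitive hψ.intervalIntegrable]
      have e : ∀ y, (b - y) * (φ y - L₁ v * η y - (L₂ v - m * L₁ v) * deriv η y) =
          (b - y) * φ y - L₁ v * ((b - y) * η y) - (L₂ v - m * L₁ v) * ((b - y) * deriv η y) :=
        fun y => by ring
      simp only [e]
      rw [intervalIntegral.integral_sub ((hc hφ).sub ((hc hη).const_mul _))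
        ((hc hη.deriv).const_mul _),
        intervalIntegral.integral_sub (hc hφ) ((hc hη).const_mul _),
        intervalIntegral.integral_const_mul, intervalIntegral.integral_const_mul, hη'', ← hv2, ← hm]
      ring
    · rw [iteratedDeriv_succ', iteratedDeriv_one, hP.deriv_primitive, hψ.deriv_primitive]
      filter_upwards [Lp.coeFn_sub (v - L₁ v • hηm.toLp η) ((L₂ v - m * L₁ v) • hηm'.toLp _),
        Lp.coeFn_sub v (L₁ v • hηm.toLp η), Lp.coeFn_smul (L₁ v) (hηm.toLp η),
        Lp.coeFn_smul (L₂ v - m * L₁ v) (hηm'.toLp _),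
        hηm.coeFn_toLp, hηm'.coeFn_toLp, hv] with x h1 h2 h3 h4 h5 h6 h7
      rw [h1, Pi.sub_apply, h2, Pi.sub_apply, h3, h4, Pi.smul_apply, Pi.smul_apply, h5, h6, h7,
        smul_eq_mul, smul_eq_mul]

/-- Twice continuously differentiable functions vanishing at the endpoints lie in `W²_p ∩ W̊¹_p`. -/
lemma exists_mem_navierSpace (hab : a < b) (hp : p ≠ ⊤) {F F' F'' : ℝ → ℝ}
    (hF : ∀ x, HasDerivAt F (F' x) x) (hF' : ∀ x, HasDerivAt F' (F'' x) x) (hF'' : Continuous F'')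
    (ha : F a = 0) (hb : F b = 0) :
    ∃ u : Sobolev p a b 2, u ∈ navierSpace p a b ∧ u.1 0 =ᵐ[mu a b] F ∧ u.1 2 =ᵐ[mu a b] F'' := by
  have hFc : Continuous F := continuous_iff_continuousAt.2 fun x => (hF x).continuousAt
  have hFc' : Continuous F' := continuous_iff_continuousAt.2 fun x => (hF' x).continuousAt
  let G : ℕ → ℝ → ℝ := fun j => if j = 0 then F else if j = 1 then F' else F''
  have hGc : ∀ j, Continuous (G j) := fun j => by
    dsimp only [G]
    split_ifs <;> assumption
  have hm : ∀ j : ℕ, MemLp (G j) p (mu a b) := fun j => memLp_of_continuous (hGc j)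
  let x : Fin (2 + 1) → LpI p a b := fun j => (hm j).toLp _
  have hx : ∀ j, x j =ᵐ[mu a b] G j := fun j => (hm j).coeFn_toLp
  have hGd : ∀ i < 2, ∀ y, HasDerivAt (G i) (G (i + 1) y) y := by
    intro i hi y
    interval_cases i
    · exact hF y
    · exact hF' y
  have hxS : x ∈ Sobolev p a b 2 := by
    intro j ψ hψ
    have h1 := hasWeakDeriv_of_chain hab.le G j (fun i hi => hGd i (by omega))
      (fun i _ => hGc i) ψ hψ
    have e1 : ∫ y in Ioo a b, x 0 y * iteratedDeriv j ψ y =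
        ∫ y in Ioo a b, G 0 y * iteratedDeriv j ψ y := by
      refine integral_congr_ae ?_
      filter_upwards [hx 0] with y hy
      rw [hy]
      rfl
    have e2 : ∫ y in Ioo a b, x j y * ψ y = ∫ y in Ioo a b, G j y * ψ y := by
      refine integral_congr_ae ?_
      filter_upwards [hx j] with y hy
      rw [hy]
    rw [e1, e2]
    exact h1
  refine ⟨⟨x, hxS⟩, ?_, hx 0, hx 2⟩
  have hFTC : ∀ y, ∫ t in a..y, F' t = F y := fun y => by
    rw [intervalIntegral.integral_eq_sub_of_hasDerivAt (fun t _ => hF t)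
      (hFc'.intervalIntegrable _ _), ha, sub_zero]
  have hx1 : x 1 =ᵐ[mu a b] F' := hx 1
  obtain ⟨w, hw⟩ := mem_range_derivₗ_one hab hp (x 1) (by
    rw [integral_congr_ae hx1, setIntegral_Ioo_eq hab.le, hFTC, hb])
  refine ⟨w, Lp.ext ?_⟩
  obtain ⟨-, h2⟩ := w.ae_eq_primitive hab (i := 0) (j := 1) rfl
  rw [Sobolev₀.embedding_apply]
  have hx0 : x 0 =ᵐ[mu a b] F := hx 0
  filter_upwards [h2, hx0, ae_restrict_mem measurableSet_Ioo] with y hy hy0 hym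
  rw [hy, hy0, hw, primitive_congr hx1 (Ioo_subset_Icc_self hym), hFTC]

end Density

/-! ### The constants and the least eigenvalue -/

section Norms
variable {p : ℝ≥0∞} {a b : ℝ}

lemma eLpNorm_le_of_lintegral_le (hp0 : p ≠ 0) (hp : p ≠ ⊤) {μ : Measure ℝ} {f g : ℝ → ℝ} {κ : ℝ}
    (hκ : 0 ≤ κ)
    (h : ∫⁻ x, ‖f x‖ₑ ^ p.toReal ∂μ ≤ ENNReal.ofReal κ * ∫⁻ x, ‖g x‖ₑ ^ p.toReal ∂μ) :
    eLpNorm f p μ ≤ ENNReal.ofReal (κ ^ (1 / p.toReal)) * eLpNorm g p μ := by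
  have hP : 0 ≤ 1 / p.toReal := by positivity
  rw [eLpNorm_eq_lintegral_rpow_enorm_toReal hp0 hp, eLpNorm_eq_lintegral_rpow_enorm_toReal hp0 hp,
    ← ENNReal.ofReal_rpow_of_nonneg hκ hP, ← ENNReal.mul_rpow_of_nonneg _ _ hP]
  exact ENNReal.rpow_le_rpow h hP

lemma norm_rpow_eq_integral [hp1 : Fact (1 ≤ p)] (hp : p ≠ ⊤) (w : LpI p a b) :
    ‖w‖ ^ p.toReal = ∫ x in Ioo a b, |w x| ^ p.toReal := by
  have hp0 : p ≠ 0 := (one_pos.trans_le hp1.out).ne'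
  have hP : p.toReal ≠ 0 := ENNReal.toReal_ne_zero.2 ⟨hp0, hp⟩
  have h0 : 0 ≤ ∫ x in Ioo a b, ‖w x‖ ^ p.toReal := integral_nonneg fun x => by positivity
  rw [Lp.norm_def, MemLp.eLpNorm_eq_integral_rpow_norm hp0 hp (Lp.memLp w),
    ENNReal.toReal_ofReal (Real.rpow_nonneg h0 _), ← Real.rpow_mul h0, inv_mul_cancel₀ hP,
    Real.rpow_one]
  rfl

lemma rpow_inv_eq_of_rpow_eq {P x y lam : ℝ} (hP : 0 < P) (hlam : 0 < lam) (hx : 0 ≤ x) (hy : 0 < y)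
    (h : y ^ P = lam * x ^ P) : x / y = lam ^ (-1 / P) := by
  have hr : 0 ≤ x / y := by positivity
  have h1 : (x / y) ^ P = lam⁻¹ := by
    rw [Real.div_rpow hx hy.le, h]
    have : x ^ P ≠ 0 := by
      intro h0
      rw [h0, mul_zero] at h
      exact (Real.rpow_pos_of_pos hy P).ne' h
    field_simp
  rw [neg_div, Real.rpow_neg hlam.le, ← Real.inv_rpow hlam.le, ← h1, ← Real.rpow_mul hr,
    mul_one_div_cancel hP.ne', Real.rpow_one]

end Norms

section GreenOperator
variable {c d : ℝ}

lemma continuousOn_greenOp (hcd : c < d) {w : ℝ → ℝ} (hw : IntegrableOn w (Ioo c d)) :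
    ContinuousOn (greenOp c d w) (Icc c d) := by
  set K := ∫ y in c..d, (d - y) * w y
  refine (continuousOn_secondPrimitive hcd hw (-c * K / (d - c)) (K / (d - c))).congr fun x hx => ?_
  rw [greenOp_eq hcd (intervalIntegrable_of_Ioo hcd.le hw) hx]
  ring

lemma greenOp_congr_ae (hcd : c ≤ d) {v w : ℝ → ℝ} (h : v =ᵐ[mu c d] w) (x : ℝ) :
    greenOp c d v x = greenOp c d w x := by
  rw [greenOp, greenOp, ← setIntegral_Ioo_eq hcd, ← setIntegral_Ioo_eq hcd]
  refine integral_congr_ae ?_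
  filter_upwards [h] with y hy
  rw [hy]

/-- The Green operator is symmetric. -/
lemma integral_greenOp_mul (hcd : c ≤ d) {f w : ℝ → ℝ} (hf : Continuous f)
    (hw : IntegrableOn w (Ioo c d)) :
    ∫ x in Ioo c d, greenOp c d f x * w x = ∫ x in Ioo c d, f x * greenOp c d w x := by
  have hc : Continuous fun z : ℝ × ℝ => green c d z.1 z.2 * f z.2 :=
    continuous_green.mul (hf.comp continuous_snd)
  obtain ⟨C, hC⟩ := (isCompact_Icc.prod isCompact_Icc).exists_bound_of_continuousOn
    (s := Icc c d ×ˢ Icc c d) hc.continuousOn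
  have hint : Integrable (Function.uncurry fun x y => (green c d x y * f y) * w x)
      ((mu c d).prod (mu c d)) := by
    refine (hw.comp_fst (mu c d)).bdd_mul (c := C) hc.aestronglyMeasurable ?_
    rw [Measure.prod_restrict]
    refine (ae_restrict_iff' (measurableSet_Ioo.prod measurableSet_Ioo)).2 (ae_of_all _ ?_)
    exact fun z hz => hC z ⟨Ioo_subset_Icc_self hz.1, Ioo_subset_Icc_self hz.2⟩
  have e1 : ∀ x, greenOp c d f x * w x = ∫ y in Ioo c d, (green c d x y * f y) * w x := fun x => by
    rw [greenOp, ← setIntegral_Ioo_eq hcd, integral_mul_const]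
  have e2 : ∀ y, f y * greenOp c d w y = ∫ x in Ioo c d, (green c d x y * f y) * w x := fun y => by
    rw [greenOp, ← setIntegral_Ioo_eq hcd, ← integral_const_mul]
    congr 1
    ext x
    rw [green_comm y x]
    ring
  simp only [e1, e2]
  exact integral_integral_swap hint

end GreenOperator

/-! ### Sharp inequalities, extremal functions and the first eigenvalue. -/

section Constants
variable {p : ℝ≥0∞} [hp1 : Fact (1 ≤ p)] {lam : ℝ} {F G : ℝ → ℝ}

lemma eLpNorm_greenOp_le (hp : p ≠ ⊤) (h : IsSinePair p.toReal lam F G) {c d : ℝ} (hcd : c < d)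
    {w : ℝ → ℝ} (hw : AEMeasurable w (mu c d)) :
    eLpNorm (greenOp c d w) p (mu c d) ≤
      ENNReal.ofReal ((d - c) ^ 2 * lam ^ (-1 / p.toReal)) * eLpNorm w p (mu c d) := by
  have hP : 0 < p.toReal := one_pos.trans h.one_lt
  have hl := h.lam_pos
  have hdc : 0 < d - c := sub_pos.2 hcd
  have h1 := eLpNorm_le_of_lintegral_le (one_pos.trans_le hp1.out).ne' hp (by positivity)
    (h.lintegral_greenOp_le hcd hw)
  convert h1 using 3
  rw [Real.mul_rpow (by positivity) (by positivity), ← Real.rpow_mul hdc.le, neg_div,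
    Real.rpow_neg hl.le, Real.inv_rpow hl.le, mul_assoc, mul_one_div_cancel hP.ne', mul_one]
  norm_cast

variable {a b : ℝ}

omit hp1 in
lemma toReal_eLpNorm_le {f g : ℝ → ℝ} {μ : Measure ℝ} {C : ℝ} (hC : 0 ≤ C) (hg : MemLp g p μ)
    (h : eLpNorm f p μ ≤ ENNReal.ofReal C * eLpNorm g p μ) :
    (eLpNorm f p μ).toReal ≤ C * (eLpNorm g p μ).toReal := by
  have := ENNReal.toReal_mono (ENNReal.mul_ne_top ENNReal.ofReal_ne_top hg.2.ne) h
  rwa [ENNReal.toReal_mul, ENNReal.toReal_ofReal hC] at this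

lemma norm_le_of_mem_navierSpace (hp : p ≠ ⊤) (h : IsSinePair p.toReal lam F G) (hab : a < b)
    {u : Sobolev p a b 2} (hu : u ∈ navierSpace p a b) :
    ‖u.1 0‖ ≤ (b - a) ^ 2 * lam ^ (-1 / p.toReal) * ‖u.1 2‖ := by
  have hl := h.lam_pos
  have hm := (Lp.memLp (u.1 2)).neg
  have h1 := toReal_eLpNorm_le (by positivity) hm
    (eLpNorm_greenOp_le hp h hab hm.1.aemeasurable)
  have h2 : u.1 0 =ᵐ[mu a b] greenOp a b (-u.1 2) := ae_eq_greenOp_of_mem_navierSpace hab hu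
  rwa [eLpNorm_neg, ← eLpNorm_congr_ae h2] at h1

/-- The weak form of the eigenvalue problem, tested against second derivatives. -/
lemma IsSinePair.integral_sp_mul (h : IsSinePair p.toReal lam F G) {v : Sobolev p 0 1 2}
    (hv : v ∈ navierSpace p 0 1) :
    ∫ x in Ioo (0 : ℝ) 1, sp p.toReal (-G x) * v.1 2 x =
      lam * ∫ x in Ioo (0 : ℝ) 1, sp p.toReal (F x) * v.1 0 x := by
  have hS := h.sineLike_F.sp_comp h.one_lt
  have hw : IntegrableOn (fun y => -v.1 2 y) (Ioo 0 1) := (integrableOn_Lp (v.1 2)).neg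
  have h1 := integral_greenOp_mul zero_le_one hS.continuous hw
  have e1 : ∫ x in Ioo (0 : ℝ) 1, sp p.toReal (F x) * v.1 0 x =
      ∫ x in Ioo (0 : ℝ) 1, sp p.toReal (F x) * greenOp 0 1 (fun y => -v.1 2 y) x := by
    refine integral_congr_ae ?_
    filter_upwards [ae_eq_greenOp_of_mem_navierSpace one_pos hv] with x hx
    rw [hx]
  rw [e1, ← h1, ← integral_const_mul]
  refine setIntegral_congr_fun measurableSet_Ioo fun x hx => ?_
  have hx' := Ioo_subset_Icc_self hx
  have e2 : greenOp 0 1 (fun y => sp p.toReal (F y)) x =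
      greenOp 0 1 (fun y => F y ^ (p.toReal - 1)) x :=
    intervalIntegral.integral_congr fun y hy => by
      rw [uIcc_of_le zero_le_one] at hy
      beta_reduce
      rw [sp_of_nonneg h.one_lt (h.F_nonneg hy)]
  have hl := h.lam_pos.ne'
  rw [e2, h.greenOp_F hx', sp_neg, sp_of_nonneg h.one_lt (h.G_nonneg hx')]
  field_simp

lemma IsSinePair.exists_extremal (hp : p ≠ ⊤) (h : IsSinePair p.toReal lam F G) :
    ∃ u : Sobolev p 0 1 2, u ∈ navierSpace p 0 1 ∧ u.1 0 =ᵐ[mu 0 1] F ∧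
      u.1 2 =ᵐ[mu 0 1] fun x => -G x := by
  have hF := h.sineLike_F
  refine exists_mem_navierSpace one_pos hp (F' := primHalf G) (fun x => ?_)
    (fun x => hasDerivAt_primHalf h.sineLike.continuous x) h.sineLike.continuous.neg hF.zero ?_
  · rw [h.F_eq]
    exact hasDerivAt_solve h.sineLike.continuous x
  · have := hF.one_sub 0
    rwa [sub_zero, hF.zero] at this

omit hp1 in
lemma IsSinePair.ne_zero (h : IsSinePair p.toReal lam F G) {w : LpI p 0 1}
    (hw : w =ᵐ[mu 0 1] fun x => -G x) : w ≠ 0 := by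
  rintro rfl
  have h0 : (fun x => -G x) =ᵐ[mu 0 1] 0 := hw.symm.trans (Lp.coeFn_zero ℝ p _)
  have h1 := eqOn_Icc_of_ae_eq_Ioo one_pos h0 h.sineLike.continuous.neg.continuousOn
    continuousOn_const (show (1 / 2 : ℝ) ∈ Icc 0 1 by norm_num)
  have h2 := h.G_pos (1 / 2) (by norm_num)
  simp only [Pi.zero_apply, neg_eq_zero] at h1
  exact h2.ne' h1

omit hp1 in
lemma integral_sp_mul_congr {P : ℝ} {u v : LpI p a b} {f : ℝ → ℝ} (hu : u =ᵐ[mu a b] f) :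
    ∫ x in Ioo a b, |u x| ^ (P - 2) * u x * v x = ∫ x in Ioo a b, sp P (f x) * v x := by
  refine integral_congr_ae ?_
  filter_upwards [hu] with x hx
  rw [hx, sp]

lemma integral_sp_mul_self (hp : p ≠ ⊤) (hP : 1 < p.toReal) (u : LpI p a b) :
    ∫ x in Ioo a b, |u x| ^ (p.toReal - 2) * u x * u x = ‖u‖ ^ p.toReal := by
  rw [norm_rpow_eq_integral hp]
  exact integral_congr_ae (ae_of_all _ fun x => sp_mul_self hP (u x))

lemma IsSinePair.isNavierEigenvalue (hp : p ≠ ⊤) (h : IsSinePair p.toReal lam F G) :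
    IsNavierEigenvalue p 0 1 lam := by
  obtain ⟨u, hu, h0, h2⟩ := h.exists_extremal hp
  refine ⟨u, hu, ?_, fun v hv => ?_⟩
  · rintro rfl
    exact h.ne_zero h2 rfl
  · rw [integral_sp_mul_congr h0, integral_sp_mul_congr h2]
    exact h.integral_sp_mul hv

/-- Green's function gives `u = 0`, and then the weak derivative `u'` vanishes too. This guarantees
`u'' ≠ 0` for an eigenfunction. -/
lemma eq_zero_of_deriv_two_eq_zero (hab : a < b) {u : Sobolev p a b 2}
    (hu : u ∈ navierSpace p a b) (h2 : u.1 2 = 0) : u = 0 := by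
  have h0 : u.1 0 = 0 := by
    refine Lp.ext ((ae_eq_greenOp_of_mem_navierSpace hab hu).trans ?_)
    have hz : (fun y => -u.1 2 y) =ᵐ[mu a b] fun _ => 0 := by
      rw [h2]
      filter_upwards [Lp.coeFn_zero ℝ p (mu a b)] with y hy
      rw [hy, Pi.zero_apply, neg_zero]
    filter_upwards [Lp.coeFn_zero ℝ p (mu a b)] with x hx
    rw [hx, greenOp_congr_ae hab.le hz]
    simp [greenOp]
  have h1 : u.1 1 = 0 := by
    refine Lp.ext ((ae_eq_zero_of_test _ (integrableOn_Lp _) fun φ hφ => ?_).trans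
      (Lp.coeFn_zero ℝ p _).symm)
    have h3 := weakDeriv_succ (i := 0) (hasWeakDeriv_of_mem u 0) (hasWeakDeriv_of_mem u 1) hφ
    rw [h0] at h3
    have h4 : ∫ x in Ioo a b, (0 : LpI p a b) x * deriv φ x = 0 := by
      refine integral_eq_zero_of_ae ?_
      filter_upwards [Lp.coeFn_zero ℝ p (mu a b)] with x hx
      rw [hx]
      simp
    linarith
  refine Subtype.ext (funext fun j => ?_)
  fin_cases j
  · exact h0
  · exact h1
  · exact h2

/-- `lam` is the least eigenvalue. -/
lemma IsSinePair.isLeast_navierEigenvalue (hp : p ≠ ⊤) (h : IsSinePair p.toReal lam F G) :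
    IsLeast {t | IsNavierEigenvalue p 0 1 t} lam := by
  refine ⟨h.isNavierEigenvalue hp, ?_⟩
  rintro t ⟨u, hu, hu0, ht⟩
  have hP : 0 < p.toReal := one_pos.trans h.one_lt
  have hl := h.lam_pos
  -- Tested with `u` itself, the equation reads `‖u''‖ ^ P = t * ‖u‖ ^ P`; the sharp inequality
  -- bounds `‖u‖ ^ P` by `lam⁻¹ * ‖u''‖ ^ P`.
  have h1 := ht u hu
  rw [integral_sp_mul_self hp h.one_lt, integral_sp_mul_self hp h.one_lt] at h1
  have h2 := norm_le_of_mem_navierSpace hp h one_pos hu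
  rw [sub_zero, one_pow, one_mul] at h2
  have h3 : ‖u.1 0‖ ^ p.toReal ≤ lam⁻¹ * ‖u.1 2‖ ^ p.toReal := by
    refine (Real.rpow_le_rpow (norm_nonneg _) h2 hP.le).trans_eq ?_
    rw [Real.mul_rpow (by positivity) (norm_nonneg _), ← Real.rpow_mul hl.le,
      div_mul_cancel₀ _ hP.ne', Real.rpow_neg_one]
  have h4 : 0 < ‖u.1 2‖ ^ p.toReal :=
    Real.rpow_pos_of_pos (norm_pos_iff.2 fun h => hu0 (eq_zero_of_deriv_two_eq_zero one_pos hu h)) _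
  have h5 : 0 ≤ ‖u.1 0‖ ^ p.toReal := Real.rpow_nonneg (norm_nonneg _) _
  have ht0 : 0 < t := by
    by_contra! hneg
    nlinarith [mul_nonneg (neg_nonneg.2 hneg) h5]
  have h6 : lam * ‖u.1 2‖ ^ p.toReal ≤ t * ‖u.1 2‖ ^ p.toReal := by
    calc lam * ‖u.1 2‖ ^ p.toReal = lam * (t * ‖u.1 0‖ ^ p.toReal) := by rw [h1]
      _ ≤ lam * (t * (lam⁻¹ * ‖u.1 2‖ ^ p.toReal)) := by gcongr
      _ = t * ‖u.1 2‖ ^ p.toReal := by field_simp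
  exact le_of_mul_le_mul_right h6 h4

/-- The eigenfunction equation tested with the eigenfunction is the equality case of the sharp
inequality. -/
lemma IsSinePair.exists_ratio_eq (hp : p ≠ ⊤) (h : IsSinePair p.toReal lam F G) :
    ∃ u ∈ navierSpace p 0 1, u.1 2 ≠ 0 ∧ lam ^ (-1 / p.toReal) = ‖u.1 0‖ / ‖u.1 2‖ := by
  obtain ⟨u, hu, h0, h2⟩ := h.exists_extremal hp
  have hne := h.ne_zero h2
  refine ⟨u, hu, hne, (rpow_inv_eq_of_rpow_eq (one_pos.trans h.one_lt) h.lam_pos (norm_nonneg _)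
    (norm_pos_iff.2 hne) ?_).symm⟩
  have h3 := h.integral_sp_mul hu
  rwa [← integral_sp_mul_congr h0, ← integral_sp_mul_congr h2, integral_sp_mul_self hp h.one_lt,
    integral_sp_mul_self hp h.one_lt] at h3

/-- Every quotient in the definition of `J⁰` is one of those in the definition of `𝓑`. -/
lemma exists_continuous_rep_of_mem_navierSpace (hab : a < b) {u : Sobolev p a b 2}
    (hu : u ∈ navierSpace p a b) : ∃ f : ℝ → ℝ, ContinuousOn f (Icc a b) ∧ u.1 0 =ᵐ[mu a b] f ∧
      (eLpNorm (fun x => f x - affineInterp a b f x) p (mu a b)).toReal = ‖u.1 0‖ := by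
  have hi : IntegrableOn (fun y => -u.1 2 y) (Ioo a b) := (integrableOn_Lp (u.1 2)).neg
  have h1 := ae_eq_greenOp_of_mem_navierSpace hab hu
  refine ⟨_, continuousOn_greenOp hab hi, h1, ?_⟩
  simp only [affineInterp_eq_zero (greenOp_left hab _) (greenOp_right hab _), sub_zero]
  rw [Lp.norm_def, eLpNorm_congr_ae h1]

/-- A continuous representative agrees on all of `[a, b]` with the second primitive, so its end
values are the right ones and its interpolation error is the Green operator applied to `-u''`. -/
lemma norm_sub_affineInterp_le (hp : p ≠ ⊤) (h : IsSinePair p.toReal lam F G) (hab : a < b)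
    (u : Sobolev p a b 2) {f : ℝ → ℝ} (hf : ContinuousOn f (Icc a b)) (huf : u.1 0 =ᵐ[mu a b] f) :
    (eLpNorm (fun x => f x - affineInterp a b f x) p (mu a b)).toReal ≤
      (b - a) ^ 2 * lam ^ (-1 / p.toReal) * ‖u.1 2‖ := by
  have hl := h.lam_pos
  have hi : IntegrableOn (fun y => -u.1 2 y) (Ioo a b) := (integrableOn_Lp (u.1 2)).neg
  obtain ⟨A, B, hAB⟩ := Sobolev.exists_ae_eq hab u
  have heq := eqOn_Icc_of_ae_eq_Ioo hab (huf.symm.trans hAB) hf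
    (continuousOn_secondPrimitive hab hi A B)
  have hm := (Lp.memLp (u.1 2)).neg
  have h1 := toReal_eLpNorm_le (by positivity) hm
    (eLpNorm_greenOp_le hp h hab hm.1.aemeasurable)
  rw [eLpNorm_neg] at h1
  refine le_trans (le_of_eq ?_) h1
  congr 1
  refine eLpNorm_congr_ae ?_
  filter_upwards [ae_restrict_mem measurableSet_Ioo] with x hx
  exact sub_affineInterp_eq (intervalIntegrable_of_Ioo hab.le hi) heq le_rfl hab le_rfl
    (Ioo_subset_Icc_self hx)

lemma IsSinePair.constB_eq (hp : p ≠ ⊤) (h : IsSinePair p.toReal lam F G) :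
    constB p 0 1 = lam ^ (-1 / p.toReal) := by
  refine IsGreatest.csSup_eq ⟨?_, ?_⟩
  · obtain ⟨u, hu, hne, he⟩ := h.exists_ratio_eq hp
    obtain ⟨f, hf, huf, hn⟩ := exists_continuous_rep_of_mem_navierSpace one_pos hu
    exact ⟨u, hne, f, hf, huf, by rw [hn, he]⟩
  · rintro r ⟨u, hne, f, hf, huf, rfl⟩
    rw [div_le_iff₀ (norm_pos_iff.2 hne)]
    simpa using norm_sub_affineInterp_le hp h one_pos u hf huf

lemma IsSinePair.constJ₀_eq (hp : p ≠ ⊤) (h : IsSinePair p.toReal lam F G) :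
    constJ₀ p 0 1 = lam ^ (-1 / p.toReal) := by
  refine IsGreatest.csSup_eq ⟨h.exists_ratio_eq hp, ?_⟩
  rintro r ⟨u, hu, hne, rfl⟩
  rw [div_le_iff₀ (norm_pos_iff.2 hne)]
  simpa using norm_le_of_mem_navierSpace hp h one_pos hu

end Constants

/-! ### Bounds for `s`-numbers -/

section SNumberBounds
variable {X Y : Type} [NormedAddCommGroup X] [NormedSpace ℝ X]
  [NormedAddCommGroup Y] [NormedSpace ℝ Y] {T : X →L[ℝ] Y} {n : ℕ} {C : ℝ}

/-- A map injective on `V` has rank at least `n`. This dimension count drives the estimates of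
approximation, Bernstein and Gelfand numbers. -/
lemma exists_ne_zero_map_eq_zero {X Z : Type} [AddCommGroup X] [Module ℝ X] [AddCommGroup Z]
    [Module ℝ Z] {V : Submodule ℝ X} (hV : Module.rank ℝ V = n) {f : X →ₗ[ℝ] Z} (hf : f.rank < n) :
    ∃ x ∈ V, x ≠ 0 ∧ f x = 0 := by
  by_contra! hcon
  have hinj : Function.Injective (f.domRestrict V) := by
    refine (injective_iff_map_eq_zero _).2 fun x hx => ?_
    by_contra hx0
    exact hcon x x.2 (fun h => hx0 (Subtype.ext h)) hx
  have h1 : Module.rank ℝ V ≤ f.rank := by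
    rw [← rank_range_of_injective _ hinj]
    refine Submodule.rank_mono ?_
    rintro _ ⟨x, rfl⟩
    exact ⟨x, rfl⟩
  rw [hV] at h1
  exact absurd hf (not_lt.2 h1)

lemma rank_zero_lt (hn : 1 ≤ n) : ((0 : X →L[ℝ] Y) : X →ₗ[ℝ] Y).rank < n := by
  rw [ContinuousLinearMap.toLinearMap_zero, LinearMap.rank_zero]
  exact_mod_cast hn

lemma le_norm_sub_of_rank_lt {V : Submodule ℝ X} (hV : Module.rank ℝ V = n)
    (hT : ∀ x ∈ V, C * ‖x‖ ≤ ‖T x‖) {F : X →L[ℝ] Y} (hF : (F : X →ₗ[ℝ] Y).rank < n) :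
    C ≤ ‖T - F‖ := by
  obtain ⟨x, hxV, hx0, hFx⟩ := exists_ne_zero_map_eq_zero hV hF
  refine le_of_mul_le_mul_right ((hT x hxV).trans ?_) (norm_pos_iff.2 hx0)
  have h1 := (T - F).le_opNorm x
  have h2 : F x = 0 := hFx
  rwa [sub_apply, h2, sub_zero] at h1

lemma le_approxNumber (hn : 1 ≤ n) {V : Submodule ℝ X} (hV : Module.rank ℝ V = n)
    (hT : ∀ x ∈ V, C * ‖x‖ ≤ ‖T x‖) : C ≤ approxNumber T n := by
  refine le_csInf ⟨_, 0, rank_zero_lt hn, rfl⟩ ?_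
  rintro r ⟨F, hF, rfl⟩
  exact le_norm_sub_of_rank_lt hV hT hF

lemma approxNumber_le {F : X →L[ℝ] Y} (hF : (F : X →ₗ[ℝ] Y).rank < n) :
    approxNumber T n ≤ ‖T - F‖ :=
  csInf_le ⟨0, by rintro r ⟨F, -, rfl⟩; exact norm_nonneg _⟩ ⟨F, hF, rfl⟩

lemma iInf_le_norm_sub {V : Submodule ℝ X} (hV : Module.rank ℝ V = n) {F : X →L[ℝ] Y}
    (hF : (F : X →ₗ[ℝ] Y).rank < n) :
    ⨅ x : {x : X // x ∈ V ∧ x ≠ 0}, ‖T x.1‖ / ‖x.1‖ ≤ ‖T - F‖ := by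
  obtain ⟨x, hxV, hx0, hFx⟩ := exists_ne_zero_map_eq_zero hV hF
  refine (ciInf_le ⟨0, by rintro r ⟨y, rfl⟩; positivity⟩ ⟨x, hxV, hx0⟩).trans ?_
  rw [div_le_iff₀ (norm_pos_iff.2 hx0)]
  have h1 := (T - F).le_opNorm x
  have h2 : F x = 0 := hFx
  rwa [sub_apply, h2, sub_zero] at h1

lemma le_bernsteinNumber (hn : 1 ≤ n) {V : Submodule ℝ X} (hV : Module.rank ℝ V = n)
    (hT : ∀ x ∈ V, C * ‖x‖ ≤ ‖T x‖) : C ≤ bernsteinNumber T n := by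
  refine le_csSup_of_le ⟨‖T‖, ?_⟩ ⟨V, hV, rfl⟩ ?_
  · rintro r ⟨V, hV, rfl⟩
    simpa using iInf_le_norm_sub (T := T) hV (rank_zero_lt hn)
  · obtain ⟨x, hxV, hx0, -⟩ := exists_ne_zero_map_eq_zero hV
      (rank_zero_lt (X := X) (Y := Y) hn)
    -- Over an empty index type the infimum would take the default value `0`; `n ≥ 1` supplies a
    -- nonzero vector.
    have : Nonempty {x : X // x ∈ V ∧ x ≠ 0} := ⟨⟨x, hxV, hx0⟩⟩
    exact le_ciInf fun y => (le_div_iff₀ (norm_pos_iff.2 y.2.2)).2 (hT _ y.2.1)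

/-- The given `V` only makes the set in the supremum nonempty; the bound holds for every
`n`-dimensional subspace. -/
lemma bernsteinNumber_le {V : Submodule ℝ X} (hV : Module.rank ℝ V = n) {F : X →L[ℝ] Y}
    (hF : (F : X →ₗ[ℝ] Y).rank < n) : bernsteinNumber T n ≤ ‖T - F‖ := by
  refine csSup_le ⟨_, V, hV, rfl⟩ ?_
  rintro r ⟨V, hV, rfl⟩
  exact iInf_le_norm_sub hV hF

lemma le_gelfandNumber (hn : 1 ≤ n) {V : Submodule ℝ X} (hV : Module.rank ℝ V = n)
    (hT : ∀ x ∈ V, C * ‖x‖ ≤ ‖T x‖) : C ≤ gelfandNumber T n := by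
  refine le_csInf ⟨_, ⊤, isClosed_univ, ?_, rfl⟩ ?_
  · rw [rank_subsingleton', Nat.cast_pos]
    exact hn
  rintro r ⟨M, -, hM, rfl⟩
  obtain ⟨x, hxV, hx0, hMx⟩ := exists_ne_zero_map_eq_zero (f := M.mkQ) hV
    ((LinearMap.rank_le_range _).trans_lt hM)
  have hxM : x ∈ M := by simpa using hMx
  refine le_of_mul_le_mul_right ((hT x hxV).trans ?_) (norm_pos_iff.2 hx0)
  exact (T ∘L M.subtypeL).le_opNorm ⟨x, hxM⟩

lemma gelfandNumber_le {F : X →L[ℝ] Y} (hF : (F : X →ₗ[ℝ] Y).rank < n) :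
    gelfandNumber T n ≤ ‖T - F‖ := by
  -- The kernel of `F` is closed, has codimension equal to the rank of `F`, and on it `T` agrees
  -- with `T - F`.
  set M := LinearMap.ker (F : X →ₗ[ℝ] Y)
  have hbdd : BddBelow {r | ∃ M : Submodule ℝ X, IsClosed (M : Set X) ∧
      Module.rank ℝ (X ⧸ M) < n ∧ r = ‖T ∘L M.subtypeL‖} := by
    refine ⟨0, ?_⟩
    rintro r ⟨M, -, -, rfl⟩
    positivity
  refine (csInf_le hbdd ⟨M, F.isClosed_ker, ?_, rfl⟩).trans ?_
  · rw [(LinearMap.quotKerEquivRange (F : X →ₗ[ℝ] Y)).rank_eq]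
    exact hF
  · refine ContinuousLinearMap.opNorm_le_bound _ (norm_nonneg _) fun x => ?_
    have h1 := (T - F).le_opNorm x
    have h2 : F x = 0 := x.2
    rwa [sub_apply, h2, sub_zero] at h1

variable [CompleteSpace X] [CompleteSpace Y] {s : SRule}

lemma IsStrictSNumber.le_norm_sub (hs : IsStrictSNumber s) (hn : 1 ≤ n) {F : X →L[ℝ] Y}
    (hF : (F : X →ₗ[ℝ] Y).rank < n) : s X Y T n ≤ ‖T - F‖ := by
  have h1 := hs.add_le X Y F (T - F) n hn
  rwa [add_sub_cancel, hs.rank_lt X Y F n hn hF, zero_add] at h1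

/-- Let `T₀` be `T` as a bijection of `V` onto its image, with inverse `S` of norm at most `C⁻¹`.
Then `Id = S T₀` on `V` gives `1 ≤ C⁻¹ * s_n(T₀)`. Injectivity of the `s`-number identifies
`s_n(T₀)` with the number of the restriction of `T` to `V` with target `Y`, which is at most
`s_n(T)`. -/
lemma IsStrictSNumber.le_of_injective (hs : IsStrictSNumber s) (hi : IsInjectiveSNumber s)
    (hn : 1 ≤ n) (hC : 0 < C) {V : Submodule ℝ X} (hV : Module.rank ℝ V = n)
    (hT : ∀ x ∈ V, C * ‖x‖ ≤ ‖T x‖) : C ≤ s X Y T n := by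
  have hfin : FiniteDimensional ℝ V := Module.finite_of_rank_eq_nat hV
  have hcV : CompleteSpace V := FiniteDimensional.complete ℝ V
  set T₁ : V →ₗ[ℝ] Y := (T : X →ₗ[ℝ] Y) ∘ₗ V.subtype with hT₁
  have hinj : Function.Injective T₁ := by
    refine (injective_iff_map_eq_zero _).2 fun x hx => ?_
    have h1 := hT x x.2
    rw [show T (x : X) = 0 from hx, norm_zero] at h1
    exact Subtype.ext (norm_le_zero_iff.1 (nonpos_of_mul_nonpos_right h1 hC))
  let e : V ≃ₗ[ℝ] LinearMap.range T₁ := LinearEquiv.ofInjective T₁ hinj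
  have hfinW : FiniteDimensional ℝ (LinearMap.range T₁) := inferInstance
  have hcW : CompleteSpace (LinearMap.range T₁) := FiniteDimensional.complete ℝ _
  let T₀ : V →L[ℝ] LinearMap.range T₁ := LinearMap.toContinuousLinearMap (e : V →ₗ[ℝ] _)
  let S : LinearMap.range T₁ →L[ℝ] V := LinearMap.toContinuousLinearMap (e.symm : _ →ₗ[ℝ] V)
  have hS : ‖S‖ ≤ C⁻¹ := by
    refine ContinuousLinearMap.opNorm_le_bound _ (by positivity) fun y => ?_
    have h1 := hT (S y : V) (S y).2
    have h2 : T (S y : V) = (y : Y) := congrArg Subtype.val (e.apply_symm_apply y)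
    rw [h2] at h1
    rw [inv_mul_eq_div, le_div_iff₀ hC, mul_comm]
    exact h1
  have hid : S ∘L T₀ ∘L ContinuousLinearMap.id ℝ V = ContinuousLinearMap.id ℝ V := by
    ext x
    exact congrArg Subtype.val (e.symm_apply_apply x)
  have h1 := hs.comp_le V V _ V (ContinuousLinearMap.id ℝ V) T₀ S n hn
  rw [hid, hs.id_eq_one V n hn hV.ge] at h1
  have h2 := hi V _ Y T₀ (LinearMap.range T₁).subtypeₗᵢ n hn
  have hcomp : (LinearMap.range T₁).subtypeₗᵢ.toContinuousLinearMap ∘L T₀ =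
      ContinuousLinearMap.id ℝ Y ∘L T ∘L V.subtypeL := rfl
  rw [hcomp] at h2
  have h3 := hs.comp_le V X Y Y V.subtypeL T (ContinuousLinearMap.id ℝ Y) n hn
  rw [h2] at h3
  have h0 := hs.nonneg X Y T n hn
  have h0' := hs.nonneg _ _ T₀ n hn
  have h4 : s V _ T₀ n ≤ s X Y T n := by
    refine h3.trans ?_
    calc _ ≤ 1 * s X Y T n * 1 := by
          gcongr
          · exact ContinuousLinearMap.norm_id_le
          · exact V.norm_subtypeL_le
      _ = s X Y T n := by ring
  have h5 : 1 ≤ C⁻¹ * s V _ T₀ n := by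
    refine h1.trans ?_
    calc _ ≤ C⁻¹ * s V _ T₀ n * 1 := by
          gcongr
          exact ContinuousLinearMap.norm_id_le
      _ = _ := mul_one _
  rw [inv_mul_eq_div, le_div_iff₀ hC, one_mul] at h5
  exact h5.trans h4

end SNumberBounds

/-! ### From two-sided bounds to the limit. -/

section Asymptotics
variable {l B : ℝ}

/-- The upper hypothesis, with `n` in the denominator, is stronger than the required bound with `n -
1`. The limit follows by squeezing `n ^ 2 * σ n` between `(n / (n + 1)) ^ 2 * l ^ 2 * B` and `l ^ 2
* B`. -/
lemma hasSharpAsymptotics_of_bounds (hB : 0 ≤ B) {σ : ℕ → ℝ}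
    (h1 : ∀ n : ℕ, 1 ≤ n → (l / ((n : ℝ) + 1)) ^ 2 * B ≤ σ n)
    (h2 : ∀ n : ℕ, 1 ≤ n → σ n ≤ (l / (n : ℝ)) ^ 2 * B) : HasSharpAsymptotics l B σ := by
  refine ⟨h1, fun n hn => (h2 n (by omega)).trans ?_, ?_⟩
  · have hn' : (2 : ℝ) ≤ n := by exact_mod_cast hn
    rw [div_pow, div_pow]
    have hn'' : (0 : ℝ) < n - 1 := by linarith
    gcongr
    linarith
  · have h3 : Tendsto (fun n : ℕ => ((n : ℝ) / (n + 1)) ^ 2 * (l ^ 2 * B)) atTop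
        (𝓝 (l ^ 2 * B)) := by
      have := ((tendsto_natCast_div_add_atTop (1 : ℝ)).pow 2).mul_const (l ^ 2 * B)
      simpa using this
    refine tendsto_of_tendsto_of_tendsto_of_le_of_le' h3 tendsto_const_nhds ?_ ?_
    · filter_upwards [eventually_ge_atTop 1] with n hn
      calc ((n : ℝ) / (n + 1)) ^ 2 * (l ^ 2 * B) = (n : ℝ) ^ 2 * ((l / (n + 1)) ^ 2 * B) := by
            ring
        _ ≤ _ := by
          gcongr
          exact h1 n hn
    · filter_upwards [eventually_ge_atTop 1] with n hn
      have hn' : (n : ℝ) ≠ 0 := by positivity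
      calc (n : ℝ) ^ 2 * σ n ≤ (n : ℝ) ^ 2 * ((l / n) ^ 2 * B) := by
            gcongr
            exact h2 n hn
        _ = l ^ 2 * B := by field_simp

variable {X Y : Type} [NormedAddCommGroup X] [NormedSpace ℝ X] [CompleteSpace X]
  [NormedAddCommGroup Y] [NormedSpace ℝ Y] [CompleteSpace Y]

/-- Subspaces on which `T` is bounded below and finite rank approximations of `T` determine the
asymptotics of all the numbers considered. -/
theorem hasSharpAsymptotics (hl : 0 < l) (hB : 0 < B) (T : X →L[ℝ] Y)
    (hlow : ∀ n : ℕ, 1 ≤ n → ∃ V : Submodule ℝ X, Module.rank ℝ V = n ∧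
      ∀ x ∈ V, (l / ((n : ℝ) + 1)) ^ 2 * B * ‖x‖ ≤ ‖T x‖)
    (hup : ∀ n : ℕ, 1 ≤ n → ∃ F : X →L[ℝ] Y, (F : X →ₗ[ℝ] Y).rank < n ∧
      ‖T - F‖ ≤ (l / (n : ℝ)) ^ 2 * B) :
    HasSharpAsymptotics l B (approxNumber T) ∧
    (∀ s : SRule, IsStrictSNumber s → IsInjectiveSNumber s →
      HasSharpAsymptotics l B (s _ _ T)) ∧
    HasSharpAsymptotics l B (bernsteinNumber T) ∧ HasSharpAsymptotics l B (gelfandNumber T) := by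
  choose! V hV hTV using hlow
  choose! F hF hTF using hup
  refine ⟨hasSharpAsymptotics_of_bounds hB.le (fun n hn => le_approxNumber hn (hV n hn) (hTV n hn))
      fun n hn => (approxNumber_le (hF n hn)).trans (hTF n hn),
    fun s hs hi => hasSharpAsymptotics_of_bounds hB.le
      (fun n hn => hs.le_of_injective hi hn (by positivity) (hV n hn) (hTV n hn))
      fun n hn => (hs.le_norm_sub hn (hF n hn)).trans (hTF n hn),
    hasSharpAsymptotics_of_bounds hB.le
      (fun n hn => le_bernsteinNumber hn (hV n hn) (hTV n hn))
      fun n hn => (bernsteinNumber_le (hV n hn) (hF n hn)).trans (hTF n hn),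
    hasSharpAsymptotics_of_bounds hB.le (fun n hn => le_gelfandNumber hn (hV n hn) (hTV n hn))
      fun n hn => (gelfandNumber_le (hF n hn)).trans (hTF n hn)⟩

end Asymptotics

/-! ### Piecewise linear interpolation -/

section Interpolation

lemma setLIntegral_Ioc_eq_sum {x : ℕ → ℝ} (hx : Monotone x) (f : ℝ → ℝ≥0∞) (n : ℕ) :
    ∫⁻ t in Ioc (x 0) (x n), f t = ∑ j ∈ Finset.range n, ∫⁻ t in Ioc (x j) (x (j + 1)), f t := by
  induction n with
  | zero => simp
  | succ n ih =>
    rw [Finset.sum_range_succ, ← ih, ← lintegral_union measurableSet_Ioc (Ioc_disjoint_Ioc_of_le le_rfl),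
      Ioc_union_Ioc_eq_Ioc (hx (Nat.zero_le n)) (hx n.le_succ)]

lemma setLIntegral_Ioo_eq_sum {x : ℕ → ℝ} (hx : Monotone x) (f : ℝ → ℝ≥0∞) (n : ℕ) :
    ∫⁻ t in Ioo (x 0) (x n), f t = ∑ j ∈ Finset.range n, ∫⁻ t in Ioo (x j) (x (j + 1)), f t := by
  have h : ∀ c d : ℝ, ∫⁻ t in Ioo c d, f t = ∫⁻ t in Ioc c d, f t := fun c d =>
    setLIntegral_congr Ioo_ae_eq_Ioc
  simp only [h]
  exact setLIntegral_Ioc_eq_sum hx f n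

/-- The hat function centred at `i`. -/
def hat (i : ℕ) (t : ℝ) : ℝ := max 0 (1 - |t - i|)

lemma continuous_hat (i : ℕ) : Continuous (hat i) := by
  unfold hat
  fun_prop

lemma sum_mul_hat (v : ℕ → ℝ) {m j : ℕ} (hj : j ≤ m) {t : ℝ} (ht : t ∈ Icc (j : ℝ) (j + 1)) :
    ∑ i ∈ Finset.range (m + 2), v i * hat i t = v j * (1 - (t - j)) + v (j + 1) * (t - j) := by
  rw [Finset.sum_eq_add_of_mem j (j + 1) (by simp; omega) (by simp; omega) (by omega)]
  · have h1 : hat j t = 1 - (t - j) := by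
      rw [hat, abs_of_nonneg (sub_nonneg.2 ht.1), max_eq_right (by linarith [ht.2])]
    have h2 : hat (j + 1) t = t - j := by
      rw [hat, abs_of_nonpos (by push_cast; linarith [ht.2]), max_eq_right]
      · push_cast
        ring
      · push_cast
        linarith [ht.1]
    rw [h1, h2]
  · rintro i - ⟨hi1, hi2⟩
    have h0 : hat i t = 0 := by
      refine max_eq_left ?_
      rcases lt_or_gt_of_ne hi1 with hi | hi
      · have : (i : ℝ) + 1 ≤ j := by exact_mod_cast hi
        linarith [le_abs_self (t - i), ht.1]
      · have : (j : ℝ) + 2 ≤ i := by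
          have : j + 2 ≤ i := by omega
          exact_mod_cast this
        linarith [neg_abs_le (t - i), ht.2]
    rw [h0, mul_zero]

/-- On each piece, a combination of hat functions is the affine interpolant. -/
lemma sum_mul_hat_eq_affineInterp {a h : ℝ} (hh : 0 < h) {f : ℝ → ℝ} {m j : ℕ} (hj : j ≤ m)
    (ha : f a = 0) (hb : f (a + h * (m + 1 : ℕ)) = 0) {x : ℝ}
    (hx : x ∈ Icc (a + h * j) (a + h * (j + 1 : ℕ))) :
    ∑ i ∈ Finset.range m, f (a + h * (i + 1 : ℕ)) * hat (i + 1) ((x - a) / h) =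
      affineInterp (a + h * j) (a + h * (j + 1 : ℕ)) f x := by
  have ht : (x - a) / h ∈ Icc (j : ℝ) (j + 1) := by
    have h2 := hx.2
    push_cast at h2
    rw [mem_Icc, le_div_iff₀ hh, div_le_iff₀ hh]
    constructor <;> linarith [hx.1]
  -- The hat functions at the two end nodes drop out because `f` vanishes there, which leaves `m` of
  -- the `m + 2` terms.
  have h1 := sum_mul_hat (fun i => f (a + h * i)) hj ht
  rw [Finset.sum_range_succ, Finset.sum_range_succ', hb] at h1
  simp only [Nat.cast_zero, mul_zero, add_zero, ha, zero_mul] at h1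
  rw [h1, affineInterp]
  push_cast
  have e : a + h * (j + 1) - (a + h * j) = h := by ring
  rw [e]
  field_simp
  ring

lemma exists_rank_le_sum_smul {X Y : Type} [NormedAddCommGroup X] [NormedSpace ℝ X]
    [NormedAddCommGroup Y] [NormedSpace ℝ Y] {m : ℕ} (L : Fin m → X →L[ℝ] ℝ) (e : Fin m → Y) :
    ∃ K : X →L[ℝ] Y, (K : X →ₗ[ℝ] Y).rank ≤ m ∧ ∀ u, K u = ∑ i, L i u • e i := by
  let A : (Fin m → ℝ) →ₗ[ℝ] Y := Fintype.linearCombination ℝ e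
  let B : X →L[ℝ] Fin m → ℝ := ContinuousLinearMap.pi L
  refine ⟨A.toContinuousLinearMap ∘L B, ?_, fun u => rfl⟩
  have h1 : ((A.toContinuousLinearMap ∘L B : X →L[ℝ] Y) : X →ₗ[ℝ] Y) = A ∘ₗ (B : X →ₗ[ℝ] _) := rfl
  rw [h1]
  refine (LinearMap.rank_comp_le_left _ _).trans ((LinearMap.rank_le_domain A).trans ?_)
  simp

variable {p : ℝ≥0∞} [hp1 : Fact (1 ≤ p)] {a b lam : ℝ} {F G : ℝ → ℝ}

omit hp1 in
lemma coeFn_sum_smul_toLp {m : ℕ} (c : Fin m → ℝ) {g : Fin m → ℝ → ℝ}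
    (hg : ∀ i, MemLp (g i) p (mu a b)) :
    ((∑ i, c i • (hg i).toLp (g i) : LpI p a b) : ℝ → ℝ) =ᵐ[mu a b] fun y => ∑ i, c i * g i y := by
  have h1 : ∀ i, (c i • (hg i).toLp (g i) : LpI p a b) =ᵐ[mu a b] fun y => c i * g i y := fun i => by
    filter_upwards [Lp.coeFn_smul (c i) ((hg i).toLp (g i)), (hg i).coeFn_toLp] with y h1 h2
    rw [h1, Pi.smul_apply, h2, smul_eq_mul]
  filter_upwards [Lp.coeFn_fun_finsetSum Finset.univ fun i => (c i • (hg i).toLp (g i) : LpI p a b),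
    eventually_countable_forall.2 h1] with y h2 h3
  rw [h2]
  exact Finset.sum_congr rfl fun i _ => h3 i

/-- Evaluation of `u` at `c` is a pairing of `u''` with the continuous weight `max (c - y) 0`, hence
bounded for the norm `‖u''‖`. -/
lemma Sobolev₀.exists_eval (hab : a ≤ b) {c : ℝ} (hc : c ∈ Icc a b) :
    ∃ L : Sobolev₀ p a b 2 →L[ℝ] ℝ,
      ∀ u, L u = ∫ y in a..c, (c - y) * derivₗ p a b 2 2 u y := by
  obtain ⟨L, hL⟩ := exists_pairing_continuous (p := p) (a := a) (b := b)
    (g := fun y : ℝ => max (c - y) 0) (by fun_prop)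
  let D : Sobolev₀ p a b 2 →L[ℝ] LpI p a b :=
    (derivₗ p a b 2 2).mkContinuous 1 fun u => (one_mul ‖u‖).ge
  refine ⟨L ∘L D, fun u => ?_⟩
  have h1 : (L ∘L D) u = L (derivₗ p a b 2 2 u) := rfl
  have hi : IntervalIntegrable (fun y => derivₗ p a b 2 2 u y * max (c - y) 0) volume a b :=
    (intervalIntegrable_of_Ioo hab (integrableOn_Lp _)).mul_continuousOn (by fun_prop)
  rw [h1, hL, setIntegral_Ioo_eq hab, ← intervalIntegral.integral_add_adjacent_intervals (b := c)
    (hi.mono_set (by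
      rw [uIcc_of_le hc.1, uIcc_of_le hab]; exact Icc_subset_Icc_right hc.2))
    (hi.mono_set (by
      rw [uIcc_of_le hc.2, uIcc_of_le hab]; exact Icc_subset_Icc_left hc.1)),
    intervalIntegral.integral_congr (a := c) (b := b) (g := fun _ => 0)]
  · rw [intervalIntegral.integral_zero, add_zero]
    refine intervalIntegral.integral_congr fun y hy => ?_
    rw [uIcc_of_le hc.1] at hy
    rw [max_eq_left (sub_nonneg.2 hy.2), mul_comm]
  · intro y hy
    rw [uIcc_of_le hc.2] at hy
    beta_reduce
    rw [max_eq_right (sub_nonpos.2 hy.1), mul_zero]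

/-- Linear interpolation on `n` equal pieces has rank at most `n - 1`, as the end nodes cost
nothing. On each piece the error is the Green operator of an interval of length `(b - a) / n`, and
the bounds for the `P`-th powers are summed. -/
lemma Sobolev₀.exists_finite_rank (hp : p ≠ ⊤) (h : IsSinePair p.toReal lam F G) (hab : a < b)
    {n : ℕ} (hn : 1 ≤ n) :
    ∃ K : Sobolev₀ p a b 2 →L[ℝ] LpI p a b,
      (K : Sobolev₀ p a b 2 →ₗ[ℝ] LpI p a b).rank < n ∧
      ‖embedding p a b 2 - K‖ ≤ ((b - a) / n) ^ 2 * lam ^ (-1 / p.toReal) := by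
  obtain ⟨m, rfl⟩ : ∃ m, n = m + 1 := ⟨n - 1, by omega⟩
  have hl := h.lam_pos
  have hp0 : p ≠ 0 := (one_pos.trans_le hp1.out).ne'
  have hP : 0 < p.toReal := one_pos.trans h.one_lt
  set δ : ℝ := (b - a) / (m + 1 : ℕ) with hδ
  have hm0 : (0 : ℝ) < (m + 1 : ℕ) := by positivity
  have hδ0 : 0 < δ := div_pos (sub_pos.2 hab) hm0
  have hδm : a + δ * (m + 1 : ℕ) = b := by
    rw [hδ, div_mul_cancel₀ _ hm0.ne']
    ring
  set x : ℕ → ℝ := fun i => a + δ * i with hx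
  have hxm : Monotone x := fun i j hij => by
    simp only [hx]
    gcongr
  have hx0 : x 0 = a := by simp [hx]
  have hxb : x (m + 1) = b := hδm
  have hxI : ∀ i ≤ m + 1, x i ∈ Icc a b := fun i hi =>
    ⟨hx0 ▸ hxm (Nat.zero_le i), hxb ▸ hxm hi⟩
  choose L hL using fun i : Fin m => exists_eval (p := p) hab.le (hxI (i + 1) (by omega))
  have hc : ∀ i : ℕ, Continuous fun y => hat i ((y - a) / δ) := fun i =>
    (continuous_hat i).comp (by fun_prop)
  have hmem : ∀ i : ℕ, MemLp (fun y => hat i ((y - a) / δ)) p (mu a b) := fun i =>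
    memLp_of_continuous (hc i)
  obtain ⟨K, hKr, hK⟩ := exists_rank_le_sum_smul L fun i => (hmem (i + 1)).toLp _
  refine ⟨K, ?_, ?_⟩
  · refine hKr.trans_lt ?_
    exact_mod_cast Nat.lt_succ_self m
  · refine ContinuousLinearMap.opNorm_le_bound _ (by positivity) fun u => ?_
    set w : LpI p a b := derivₗ p a b 2 2 u with hw
    set f : ℝ → ℝ := fun y => ∫ t in a..y, (y - t) * w t with hf
    have hfa : f a = 0 := intervalIntegral.integral_same
    have hfb : f b = 0 := u.integral_moments hab
    set R : ℝ → ℝ := fun y =>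
      f y - ∑ i ∈ Finset.range m, f (x (i + 1)) * hat (i + 1) ((y - a) / δ) with hR
    have h1 : (embedding p a b 2 - K) u =ᵐ[mu a b] R := by
      have hsum : (K u : ℝ → ℝ) =ᵐ[mu a b]
          fun y => ∑ i : Fin m, L i u * hat (i + 1) ((y - a) / δ) := by
        rw [hK]
        exact coeFn_sum_smul_toLp _ fun i : Fin m => hmem (i + 1)
      rw [sub_apply]
      filter_upwards [Lp.coeFn_sub (embedding p a b 2 u) (K u), hsum,
        u.ae_eq_secondPrimitive hab] with y h1 h2 h3
      rw [h1, Pi.sub_apply, h2, h3, hR]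
      beta_reduce
      rw [Finset.sum_range]
      simp only [hL]
      rfl
    have hm := (Lp.memLp w).neg
    have hwi : IntervalIntegrable (fun y => -w y) volume a b :=
      (intervalIntegrable_of_Ioo hab.le (integrableOn_Lp w)).neg
    have hpiece : ∀ j ∈ Finset.range (m + 1), ∫⁻ y in Ioo (x j) (x (j + 1)), ‖R y‖ₑ ^ p.toReal ≤
        ENNReal.ofReal (δ ^ (2 * p.toReal) * lam⁻¹) *
          ∫⁻ y in Ioo (x j) (x (j + 1)), ‖w y‖ₑ ^ p.toReal := by
      intro j hj
      have hj' : j ≤ m := by simpa [Nat.lt_succ_iff] using hj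
      have hlt : x j < x (j + 1) := by
        simp only [hx]
        push_cast
        linarith
      have hsub : Ioo (x j) (x (j + 1)) ⊆ Ioo a b :=
        Ioo_subset_Ioo (hxI j (by omega)).1 (hxI (j + 1) (by omega)).2
      have hwm : AEMeasurable (fun y => -w y) (volume.restrict (Ioo (x j) (x (j + 1)))) :=
        hm.1.aemeasurable.mono_measure (Measure.restrict_mono hsub le_rfl)
      have h2 := h.lintegral_greenOp_le hlt hwm
      have hdx : x (j + 1) - x j = δ := by
        simp only [hx]
        push_cast
        ring
      rw [hdx] at h2
      simp only [enorm_neg] at h2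
      refine le_trans (le_of_eq ?_) h2
      refine setLIntegral_congr_fun measurableSet_Ioo fun y hy => ?_
      have hy' := Ioo_subset_Icc_self hy
      have h3 := sub_affineInterp_eq (f := f) (A := 0) (B := 0) hwi (fun z _ => by
        simp [hf, intervalIntegral.integral_neg]) (hxI j (by omega)).1 hlt
        (hxI (j + 1) (by omega)).2 hy'
      have h4 := sum_mul_hat_eq_affineInterp hδ0 (f := f) hj' hfa (by rw [hδm]; exact hfb) hy'
      rw [← h3, ← h4]
    have h2 : ∫⁻ y in Ioo a b, ‖R y‖ₑ ^ p.toReal ≤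
        ENNReal.ofReal (δ ^ (2 * p.toReal) * lam⁻¹) * ∫⁻ y in Ioo a b, ‖w y‖ₑ ^ p.toReal := by
      have hsum := setLIntegral_Ioo_eq_sum hxm (n := m + 1)
      rw [hx0, hxb] at hsum
      rw [hsum, hsum, Finset.mul_sum]
      exact Finset.sum_le_sum hpiece
    have h3 := toReal_eLpNorm_le (by positivity) (Lp.memLp w)
      (eLpNorm_le_of_lintegral_le hp0 hp (by positivity) h2)
    rw [← eLpNorm_congr_ae h1] at h3
    refine h3.trans_eq ?_
    rw [Real.mul_rpow (by positivity) (by positivity), ← Real.rpow_mul hδ0.le, neg_div,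
      Real.rpow_neg hl.le, Real.inv_rpow hl.le, mul_assoc 2, mul_one_div_cancel hP.ne', mul_one]
    norm_cast

end Interpolation

/-! ### Subspaces on which the embedding is bounded below -/

section LowerBound

lemma integral_comp_sub_div_eq (f : ℝ → ℝ) (a : ℝ) {δ : ℝ} (hδ : 0 < δ) (t : ℝ) :
    ∫ x in a..(a + δ * t), f ((x - a) / δ) = δ * ∫ s in (0 : ℝ)..t, f s := by
  have h1 := intervalIntegral.integral_comp_add_mul (a := 0) (b := t)
    (fun x => f ((x - a) / δ)) hδ.ne' a
  simp only [mul_zero, add_zero, add_sub_cancel_left, mul_div_cancel_left₀ _ hδ.ne',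
    smul_eq_mul] at h1
  rw [h1, mul_inv_cancel_left₀ hδ.ne']

lemma secondPrimitive_scale {q : ℝ → ℝ} (hq : Continuous q) (a : ℝ) {δ : ℝ} (hδ : 0 < δ) (t : ℝ) :
    ∫ y in a..(a + δ * t), (a + δ * t - y) * q ((y - a) / δ) = δ ^ 2 * prim2 q t := by
  have h1 := integral_comp_sub_div_eq (fun s => (δ * t - δ * s) * q s) a hδ t
  have e1 : ∀ y, (δ * t - δ * ((y - a) / δ)) * q ((y - a) / δ) =
      (a + δ * t - y) * q ((y - a) / δ) := fun y => by
    rw [mul_div_cancel₀ _ hδ.ne']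
    ring
  simp only [e1] at h1
  have e2 : ∀ s, (δ * t - δ * s) * q s = δ * ((t - s) * q s) := fun s => by ring
  rw [h1, prim2, integral_primitive (hq.intervalIntegrable _ _)]
  simp only [e2]
  rw [intervalIntegral.integral_const_mul]
  ring

lemma exists_linearIndependent_ker {ι : Type*} [Fintype ι] {n : ℕ} (hn : Fintype.card ι = n + 2)
    (L : (ι → ℝ) →ₗ[ℝ] ℝ × ℝ) : ∃ f : Fin n → LinearMap.ker L, LinearIndependent ℝ f := by
  refine exists_linearIndependent_of_le_finrank ?_
  have h1 := L.finrank_range_add_finrank_ker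
  have h2 := (LinearMap.range L).finrank_le
  rw [Module.finrank_prod, Module.finrank_self] at h2
  rw [Module.finrank_fintype_fun_eq_card, hn] at h1
  omega

lemma rank_span_range_eq {X : Type} [AddCommGroup X] [Module ℝ X] {n : ℕ} {u : Fin n → X}
    (hu : LinearIndependent ℝ u) : Module.rank ℝ (Submodule.span ℝ (range u)) = n := by
  rw [rank_span hu, Cardinal.mk_range_eq u hu.injective, Cardinal.mk_fin]

variable {p : ℝ≥0∞} [hp1 : Fact (1 ≤ p)] {a b lam : ℝ} {F G : ℝ → ℝ}

omit hp1 in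
/-- The step multiples of the cosine-like function, scaled to `(a, b)`. -/
lemma IsCosPair.exists_linearMap {P : ℝ} {φ φ' γ ψ' : ℝ → ℝ} (h : IsCosPair P lam φ φ' γ ψ')
    {N : ℕ} {δ : ℝ} (hδ : 0 < δ) (hab : a < b) (hδb : a + δ * N = b) :
    ∃ Φ : (Fin (N + 1) → ℝ) →ₗ[ℝ] LpI p a b, Function.Injective Φ ∧
      ∀ c, Φ c =ᵐ[mu a b] fun x => stepMul γ c ((x - a) / δ) := by
  have hm : ∀ k : Fin (N + 1), MemLp (fun x => piece γ k ((x - a) / δ)) p (mu a b) := fun k =>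
    memLp_of_continuous ((h.continuous_piece k).comp (by fun_prop))
  have hΦ : ∀ c : Fin (N + 1) → ℝ,
      Fintype.linearCombination ℝ (fun k => ((hm k).toLp _ : LpI p a b)) c =ᵐ[mu a b]
        fun x => stepMul γ c ((x - a) / δ) := fun c => coeFn_sum_smul_toLp c hm
  refine ⟨_, (injective_iff_map_eq_zero _).2 fun c hc => funext fun k => ?_, hΦ⟩
  have h1 : (fun x => stepMul γ c ((x - a) / δ)) =ᵐ[mu a b] 0 := by
    have h2 := hΦ c
    rw [hc] at h2
    exact h2.symm.trans (Lp.coeFn_zero ℝ p _)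
  have hk : ((k : ℕ) : ℝ) ≤ N := by exact_mod_cast Nat.le_of_lt_succ k.2
  have h3 := eqOn_Icc_of_ae_eq_Ioo hab h1
    ((h.continuous_stepMul c).comp (by fun_prop)).continuousOn continuousOn_const
    (show a + δ * (k : ℕ) ∈ Icc a b by
      rw [← hδb]
      constructor
      · have : 0 ≤ δ * (k : ℕ) := by positivity
        linarith
      · gcongr)
  have h4 : stepMul γ c (k : ℕ) = 0 := by
    simpa [mul_div_cancel_left₀ _ hδ.ne'] using h3
  rw [h.stepMul_eq c k (by simp)] at h4
  refine (mul_eq_zero.1 h4).resolve_right fun h5 => ?_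
  have h6 := h.γ_sign k k (by simp)
  rw [h5, mul_zero] at h6
  exact lt_irrefl _ h6

/-- Rescaled to `[0, N]`, `u` is `δ ^ 2 * prim2 q`, and `u' = 0` at both ends becomes `∫ q = 0`;
this is the case `κ = 0` of `integral_stepMul_rpow_le`, up to sign. The vanishing of `u` at the
right end plays no role here. -/
lemma Sobolev₀.le_norm_embedding_of_stepMul (hp : p ≠ ⊤) {φ φ' γ ψ' : ℝ → ℝ}
    (h : IsCosPair p.toReal lam φ φ' γ ψ') {N : ℕ} (hN : 1 ≤ N) {δ : ℝ} (hδ : 0 < δ) (hab : a < b)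
    (hδb : a + δ * N = b) (u : Sobolev₀ p a b 2) {c : Fin (N + 1) → ℝ}
    (hu : derivₗ p a b 2 2 u =ᵐ[mu a b] fun x => stepMul γ c ((x - a) / δ)) :
    δ ^ 2 * lam ^ (-1 / p.toReal) * ‖u‖ ≤ ‖embedding p a b 2 u‖ := by
  have hl := h.lam_pos
  have hP : 0 < p.toReal := one_pos.trans h.one_lt
  set q := stepMul γ c with hq
  have hqc : Continuous q := h.continuous_stepMul c
  have hc0 : ∫ x in (0 : ℝ)..N, q x = 0 := by
    obtain ⟨h0, -⟩ := u.ae_eq_primitive hab (i := 1) (j := 2) rfl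
    rw [integral_congr_ae hu, setIntegral_Ioo_eq hab.le, ← hδb, integral_comp_sub_div_eq q a hδ] at h0
    exact (mul_eq_zero.1 h0).resolve_left hδ.ne'
  have hE : ∀ᵐ x ∂(mu a b), embedding p a b 2 u x = δ ^ 2 * prim2 q ((x - a) / δ) := by
    filter_upwards [u.ae_eq_secondPrimitive hab, ae_restrict_mem measurableSet_Ioo] with x hx hxm
    have h1 := secondPrimitive_scale hqc a hδ ((x - a) / δ)
    rw [mul_div_cancel₀ _ hδ.ne', add_sub_cancel] at h1
    have hu' : (fun y => (x - y) * derivₗ p a b 2 2 u y) =ᵐ[mu a b]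
        fun y => (x - y) * q ((y - a) / δ) := by
      filter_upwards [hu] with y hy
      rw [hy]
    rw [hx, ← h1]
    exact primitive_congr hu' (Ioo_subset_Icc_self hxm)
  have e1 : ‖u‖ ^ p.toReal = δ * ∫ t in (0 : ℝ)..N, |q t| ^ p.toReal := by
    rw [Sobolev₀.norm_eq, norm_rpow_eq_integral hp, ← integral_comp_sub_div_eq _ a hδ, hδb,
      ← setIntegral_Ioo_eq hab.le]
    refine integral_congr_ae ?_
    filter_upwards [hu] with x hx
    rw [← hx]
    rfl
  have e2 : ‖embedding p a b 2 u‖ ^ p.toReal =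
      δ * ∫ t in (0 : ℝ)..N, (δ ^ 2) ^ p.toReal * |prim2 q t| ^ p.toReal := by
    rw [norm_rpow_eq_integral hp, ← integral_comp_sub_div_eq _ a hδ, hδb,
      ← setIntegral_Ioo_eq hab.le]
    refine integral_congr_ae ?_
    filter_upwards [hE] with x hx
    rw [hx, abs_mul, abs_of_nonneg (by positivity : 0 ≤ δ ^ 2),
      Real.mul_rpow (by positivity) (abs_nonneg _)]
  have h1 := h.integral_stepMul_rpow_le hN c 0 hc0
  simp only [zero_sub, abs_neg] at h1
  rw [← Real.rpow_le_rpow_iff (by positivity) (norm_nonneg _) hP, e2,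
    Real.mul_rpow (by positivity) (norm_nonneg _), Real.mul_rpow (by positivity) (by positivity), e1,
    intervalIntegral.integral_const_mul, ← Real.rpow_mul hl.le, div_mul_cancel₀ _ hP.ne',
    Real.rpow_neg_one]
  calc (δ ^ 2) ^ p.toReal * lam⁻¹ * (δ * ∫ t in (0 : ℝ)..N, |q t| ^ p.toReal)
      ≤ (δ ^ 2) ^ p.toReal * lam⁻¹ * (δ * (lam * ∫ t in (0 : ℝ)..N, |prim2 q t| ^ p.toReal)) := by
        gcongr
    _ = _ := by field_simp

/-- With `N = n + 1` there are `n + 2` pieces of scale `(b - a) / (n + 1)`, the two end ones cut in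
half. The conditions `∫ w = 0` and `∫ (b - x) * w = 0` suffice for `w` to be the second derivative
of an element of the zero-boundary space, and they leave at least `n` dimensions. -/
lemma Sobolev₀.exists_submodule (hp : p ≠ ⊤) (h : IsSinePair p.toReal lam F G) (hab : a < b)
    (n : ℕ) : ∃ V : Submodule ℝ (Sobolev₀ p a b 2), Module.rank ℝ V = n ∧
      ∀ u ∈ V, ((b - a) / ((n : ℝ) + 1)) ^ 2 * lam ^ (-1 / p.toReal) * ‖u‖ ≤
        ‖embedding p a b 2 u‖ := by
  set δ : ℝ := (b - a) / ((n : ℝ) + 1) with hδ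
  have hn : (0 : ℝ) < n + 1 := by positivity
  have hδ0 : 0 < δ := div_pos (sub_pos.2 hab) hn
  have hδb : a + δ * (n + 1 : ℕ) = b := by
    push_cast
    rw [hδ, div_mul_cancel₀ _ hn.ne']
    ring
  obtain ⟨Φ, hΦi, hΦ⟩ := h.isCosPair.exists_linearMap (p := p) hδ0 hab hδb
  obtain ⟨L₁, hL₁⟩ := exists_pairing_continuous (p := p) (a := a) (b := b)
    (continuous_const (y := (1 : ℝ)))
  obtain ⟨L₂, hL₂⟩ := exists_pairing_continuous (p := p) (a := a) (b := b)
    (g := fun y : ℝ => b - y) (by fun_prop)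
  simp only [mul_one] at hL₁
  obtain ⟨f, hf⟩ := exists_linearIndependent_ker (n := n) (Fintype.card_fin _)
    (((L₁ : LpI p a b →ₗ[ℝ] ℝ) ∘ₗ Φ).prod ((L₂ : LpI p a b →ₗ[ℝ] ℝ) ∘ₗ Φ))
  have hex : ∀ i, ∃ u : Sobolev₀ p a b 2, derivₗ p a b 2 2 u = Φ (f i) := fun i => by
    have h1 : (L₁ (Φ (f i)), L₂ (Φ (f i))) = 0 := (f i).2
    rw [Prod.mk_eq_zero] at h1
    exact mem_range_derivₗ_two hab hp _ ((hL₁ _).symm.trans h1.1) ((hL₂ _).symm.trans h1.2)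
  choose u hu using hex
  have hlin : LinearIndependent ℝ u := by
    refine LinearIndependent.of_comp (derivₗ p a b 2 2) ?_
    have h1 : derivₗ p a b 2 2 ∘ u = Φ ∘ Subtype.val ∘ f := funext hu
    rw [h1]
    exact (hf.map' (Submodule.subtype _) (Submodule.ker_subtype _)).map' Φ
      (LinearMap.ker_eq_bot.2 hΦi)
  refine ⟨Submodule.span ℝ (range u), rank_span_range_eq hlin, fun v hv => ?_⟩
  have hle : Submodule.span ℝ (range u) ≤ (LinearMap.range Φ).comap (derivₗ p a b 2 2) := by
    rw [Submodule.span_le]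
    rintro _ ⟨i, rfl⟩
    exact ⟨f i, (hu i).symm⟩
  obtain ⟨c, hc⟩ := hle hv
  have hvc := hΦ c
  rw [hc] at hvc
  exact le_norm_embedding_of_stepMul hp h.isCosPair (by omega) hδ0 hab hδb v hvc

end LowerBound

end SobolevEmbedding

end

theorem theorem3p4 (p : ℝ≥0∞) [Fact (1 ≤ p)] (hp : 1 < p) (hp_top : p ≠ ⊤) (a b : ℝ)
    (hab : a < b) :
    (∃ ev : ℝ, 0 < ev ∧ IsLeast {t | SobolevEmbedding.IsNavierEigenvalue p 0 1 t} ev ∧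
      SobolevEmbedding.constB p 0 1 = SobolevEmbedding.constJ₀ p 0 1 ∧
      SobolevEmbedding.constJ₀ p 0 1 = ev ^ (-1 / p.toReal)) ∧
    SobolevEmbedding.HasSharpAsymptotics (b - a) (SobolevEmbedding.constB p 0 1)
      (SobolevEmbedding.approxNumber (SobolevEmbedding.Sobolev₀.embedding p a b 2)) ∧
    (∀ s : SobolevEmbedding.SRule, SobolevEmbedding.IsStrictSNumber s →
      SobolevEmbedding.IsInjectiveSNumber s →
      SobolevEmbedding.HasSharpAsymptotics (b - a) (SobolevEmbedding.constB p 0 1)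
        (s _ _ (SobolevEmbedding.Sobolev₀.embedding p a b 2))) ∧
    SobolevEmbedding.HasSharpAsymptotics (b - a) (SobolevEmbedding.constB p 0 1)
      (SobolevEmbedding.bernsteinNumber (SobolevEmbedding.Sobolev₀.embedding p a b 2)) ∧
    SobolevEmbedding.HasSharpAsymptotics (b - a) (SobolevEmbedding.constB p 0 1)
      (SobolevEmbedding.gelfandNumber (SobolevEmbedding.Sobolev₀.embedding p a b 2)) := by
  have hP : 1 < p.toReal := by
    rw [← ENNReal.toReal_one]
    exact (ENNReal.toReal_lt_toReal (by simp) hp_top).2 hp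
  obtain ⟨lam, F, G, h⟩ := SobolevEmbedding.exists_isSinePair hP
  have hB := h.constB_eq hp_top
  refine ⟨⟨lam, h.lam_pos, h.isLeast_navierEigenvalue hp_top, hB.trans (h.constJ₀_eq hp_top).symm,
    h.constJ₀_eq hp_top⟩, ?_⟩
  rw [hB]
  exact SobolevEmbedding.hasSharpAsymptotics (sub_pos.2 hab) (Real.rpow_pos_of_pos h.lam_pos _) _
    (fun n _ => SobolevEmbedding.Sobolev₀.exists_submodule hp_top h hab n)
    fun n hn => SobolevEmbedding.Sobolev₀.exists_finite_rank hp_top h hab hn
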